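/- Let $(W,S)$ be a finitely generated Coxeter system with Coxeter labels $m_{i,j}$. Its diagram $\Gamma$ has vertex set $S$, with distinct $i,j$ joined by an edge iff $m_{i,j}\neq 2$; an edge is called *unlabeled* if $m_{i,j}=3$. Assume that $\Gamma$ is a tree. Let $\mathbf H$ be the Hecke algebra over $\mathbb Z[v,v^{-1}]$ with standard basis $(H_w)_{w\in W}$, where $H_xH_y=H_{xy}$ if $\ell(xy)=\ell(x)+\ell(y)$ and $H_s^2=1+(v^{-1}-v)H_s$ for $s\in S$. Let $(\underline H_w)_{w\in W}$ be its Kazhdan–Lusztig basis: $\underline H_w$ is the unique bar-invariant element of $H_w+\sum_{y\ne w}v\mathbb Z[v]H_y$. Write $x\le_L y$ (resp. $x\le_R y$) if $\underline H_y$ appears with non-zero coefficient in $\underline H_w\underline H_x$ (resp. $\underline H_x\underline H_w$) for some $w\in W$. For $s\in S$ let $\mathcal L_s=\{x : x\le_L s,\ s\le_L x\}$ and $\mathcal R_s=\{x : x\le_R s,\ s\le_R x\}$ be the left and right cells containing $s$. 1. If all edges of $\Gamma$ are unlabeled, then $|\mathcal L_p\cap\mathcal R_q|=1$ for all $p,q\in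 S$. 2. Assume that one edge $\{s,t\}$ of $\Gamma$ has a finite label $m_{s,t}\ge 4$ and that all other edges are unlabeled. Let $\pi:S\to\{s,t\}$ send $r$ to $s$ if $r$ lies in the connected component of $\Gamma\setminus\{t\}$ containing $s$, and to $t$ otherwise (equivalently, if $r$ lies in the connected component of $\Gamma\setminus\{s\}$ containing $t$). To a walk $t_1,\dots,t_k$ in $\Gamma$ associate the element $t_k\cdots t_2t_1$ of $W$. For $p,q\in S$, let $u_1$ be the product in this sense along the shortest path from $\pi(q)$ to $q$ with its starting point $\pi(q)$ omitted, and let $u_2$ be the product along the shortest path from $p$ to $\pi(p)$ with its end point $\pi(p)$ omitted. (a) For all $p,q\in S$ there is a bijection $$\mathcal L_{\pi(p)}\cap\mathcal R_{\pi(q)}\longrightarrow\mathcal L_p\cap\mathcal R_q$$ which sends $w$ to $u_1wu_2$, except that, if $\pi(p)=\pi(q)$, it sends the simple reflection $w=\pi(p)$ to the product along the shortest path from $p$ to $q$. If the shortest paths from $p$ to $\pi(p)$ and from $\pi(q)$ to $q$ have no common vertex other than $\pi(p)$ (in particular, if $\pi(p)\ne\pi(q)$), then $w\mapsto u_1wu_2$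 itself is a bijection between these two sets. (b) Let $W^{\{s,t\}}$ be the Coxeter group on the generators $s,t$ with label $m_{s,t}$. The canonical homomorphism $W^{\{s,t\}}\to W$ is injective, and if $W^{\{s,t\}}$ is identified with its image, then $$\mathcal L_p\cap\mathcal R_q=\mathcal L_p^{\{s,t\}}\cap\mathcal R_q^{\{s,t\}}\qquad\text{for } p,q\in\{s,t\},$$ where $\mathcal L_p^{\{s,t\}}$ and $\mathcal R_q^{\{s,t\}}$ are the left and right cells of the Coxeter system $(W^{\{s,t\}},\{s,t\})$ containing $p$ and $q$. -/

import Mathlib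

/-! ### Coxeter diagrams -/

namespace CoxeterMatrix

/-- The Coxeter diagram as a graph: distinct vertices `i`, `j` are joined by an edge iff `m i j ≠ 2`.
(The value `0` of a Coxeter matrix stands for `∞`, so pairs with `m i j = ∞` are joined.) -/
def diagram {B : Type*} (M : CoxeterMatrix B) : SimpleGraph B where
  Adj i j := i ≠ j ∧ M i j ≠ 2
  symm := ⟨fun i j h => ⟨h.1.symm, by rw [M.symmetric]; exact h.2⟩⟩
  loopless := ⟨fun _ h => h.1 rfl⟩

/-- All edges of the diagram are unlabeled, that is, they have label `3`. -/
def IsUnlabeled {B : Type*} (M : CoxeterMatrix B) : Prop :=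
  ∀ i j, M.diagram.Adj i j → M i j = 3

/-- `{s, t}` is an edge with a finite label `≥ 4`, and all the other edges are unlabeled. -/
def IsUniqueLabeledEdge {B : Type*} (M : CoxeterMatrix B) (s t : B) : Prop :=
  M.diagram.Adj s t ∧ 4 ≤ M s t ∧
    ∀ i j, M.diagram.Adj i j → s(i, j) ≠ s(s, t) → M i j = 3

/-- The restriction of a Coxeter matrix to a set `J` of indices. -/
def restrict {B : Type*} (M : CoxeterMatrix B) (J : Set B) : CoxeterMatrix J where
  M := Matrix.of fun i j => M i j
  isSymm := by ext i j; exact M.symmetric j i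
  diagonal i := M.diagonal i
  off_diagonal i j h := M.off_diagonal i j fun h' => h (Subtype.ext h')

end CoxeterMatrix

namespace SimpleGraph

/-- The set of all vertices `r` for which there is a walk from `r` to `s` that does not pass
through `t`: the component of `s` after deletion of `t`. -/
def branch {V : Type*} (G : SimpleGraph V) (s t : V) : Set V :=
  {r | ∃ P : G.Walk r s, t ∉ P.support}

open Classical in
/-- The projection of the vertices to `{s, t}`: it sends `branch s t` to `s` and the other vertices
to `t`. In a tree with edge `{s, t}` the other vertices are exactly those of `branch t s`, see
`mem_branch_symm_iff`. -/
noncomputable def branchProj {V : Type*} (G : SimpleGraph V) (s t : V) (r : V) : V :=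
  if r ∈ G.branch s t then s else t

theorem mem_branch_symm_iff {V : Type*} {G : SimpleGraph V} (hG : G.IsTree) {s t : V}
    (hst : G.Adj s t) (r : V) : r ∈ G.branch t s ↔ r ∉ G.branch s t := by
  classical
  constructor
  · rintro ⟨Q, hQ⟩ ⟨P, hP⟩
    have h1 : P.bypass.IsPath := P.bypass_isPath
    have h2 : t ∉ P.bypass.support := fun h => hP (P.support_bypass_subset_support h)
    have h3 : (P.bypass.concat hst).IsPath := h1.concat h2 hst
    have h4 : (⟨P.bypass.concat hst, h3⟩ : G.Path r t) = ⟨Q.bypass, Q.bypass_isPath⟩ :=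
      (hG.2.subsingleton_path _ _).elim _ _
    have h5 : P.bypass.concat hst = Q.bypass := congrArg Subtype.val h4
    apply hQ
    apply Q.support_bypass_subset_support
    rw [← h5, SimpleGraph.Walk.support_concat]
    simp
  · intro h
    obtain ⟨P⟩ := hG.1.preconnected r s
    have h1 : t ∈ P.bypass.support := by
      by_contra h2
      exact h ⟨_, h2⟩
    refine ⟨P.bypass.takeUntil t h1, ?_⟩
    exact SimpleGraph.Walk.endpoint_notMem_support_takeUntil P.bypass_isPath h1 hst.ne

end SimpleGraph

namespace CoxeterSystem

/-! ### The Hecke algebra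

The Hecke algebra over `ℤ[v, v⁻¹]` is generated by elements `H_w`, for `w ∈ W`, subject to the
relations `H_1 = 1`, `H_x H_y = H_{xy}` if `ℓ(xy) = ℓ(x) + ℓ(y)`, and
`H_s ^ 2 = 1 + (v⁻¹ - v) H_s` for all simple reflections `s`. The variable `v` is
`LaurentPolynomial.T 1`. -/

/-- The defining relations of the Hecke algebra. -/
inductive HeckeRel {B W : Type*} [Group W] {M : CoxeterMatrix B} (cs : CoxeterSystem M W) :
    FreeAlgebra (LaurentPolynomial ℤ) W → FreeAlgebra (LaurentPolynomial ℤ) W → Prop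
  | one : HeckeRel cs (FreeAlgebra.ι _ 1) 1
  | mul (x y : W) (h : cs.length (x * y) = cs.length x + cs.length y) :
      HeckeRel cs (FreeAlgebra.ι _ x * FreeAlgebra.ι _ y) (FreeAlgebra.ι _ (x * y))
  | quad (i : B) :
      HeckeRel cs (FreeAlgebra.ι _ (cs.simple i) * FreeAlgebra.ι _ (cs.simple i))
        (1 + (LaurentPolynomial.T (-1) - LaurentPolynomial.T 1 : LaurentPolynomial ℤ) •
          FreeAlgebra.ι _ (cs.simple i))

/-- The Hecke algebra of a Coxeter system, over `ℤ[v, v⁻¹]`. -/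
def Hecke {B W : Type*} [Group W] {M : CoxeterMatrix B} (cs : CoxeterSystem M W) : Type _ :=
  RingQuot (HeckeRel cs)

noncomputable instance {B W : Type*} [Group W] {M : CoxeterMatrix B} (cs : CoxeterSystem M W) :
    Ring cs.Hecke :=
  inferInstanceAs (Ring (RingQuot (HeckeRel cs)))

noncomputable instance {B W : Type*} [Group W] {M : CoxeterMatrix B} (cs : CoxeterSystem M W) :
    Algebra (LaurentPolynomial ℤ) cs.Hecke :=
  inferInstanceAs (Algebra (LaurentPolynomial ℤ) (RingQuot (HeckeRel cs)))

/-- The standard basis element `H_w`. -/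
noncomputable def stdBasis {B W : Type*} [Group W] {M : CoxeterMatrix B} (cs : CoxeterSystem M W)
    (w : W) : cs.Hecke :=
  RingQuot.mkAlgHom (LaurentPolynomial ℤ) (HeckeRel cs) (FreeAlgebra.ι _ w)

theorem stdBasis_one {B W : Type*} [Group W] {M : CoxeterMatrix B} (cs : CoxeterSystem M W) :
    cs.stdBasis 1 = 1 := by
  have h := RingQuot.mkAlgHom_rel (LaurentPolynomial ℤ) (HeckeRel.one (cs := cs))
  rw [map_one] at h
  exact h

theorem stdBasis_mul {B W : Type*} [Group W] {M : CoxeterMatrix B} (cs : CoxeterSystem M W)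
    (x y : W) (hxy : cs.length (x * y) = cs.length x + cs.length y) :
    cs.stdBasis x * cs.stdBasis y = cs.stdBasis (x * y) := by
  have h := RingQuot.mkAlgHom_rel (LaurentPolynomial ℤ) (HeckeRel.mul (cs := cs) x y hxy)
  rw [map_mul] at h
  exact h

theorem stdBasis_simple_sq {B W : Type*} [Group W] {M : CoxeterMatrix B} (cs : CoxeterSystem M W)
    (i : B) : cs.stdBasis (cs.simple i) * cs.stdBasis (cs.simple i) =
      1 + (LaurentPolynomial.T (-1) - LaurentPolynomial.T 1 : LaurentPolynomial ℤ) •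
        cs.stdBasis (cs.simple i) := by
  have h := RingQuot.mkAlgHom_rel (LaurentPolynomial ℤ) (HeckeRel.quad (cs := cs) i)
  rw [map_mul, map_add, map_one, map_smul] at h
  exact h

theorem stdBasis_simple_mul_inv {B W : Type*} [Group W] {M : CoxeterMatrix B}
    (cs : CoxeterSystem M W) (i : B) :
    cs.stdBasis (cs.simple i) * (cs.stdBasis (cs.simple i) -
      algebraMap _ _ (LaurentPolynomial.T (-1) - LaurentPolynomial.T 1 : LaurentPolynomial ℤ)) = 1 ∧
    (cs.stdBasis (cs.simple i) -
      algebraMap _ _ (LaurentPolynomial.T (-1) - LaurentPolynomial.T 1 : LaurentPolynomial ℤ)) *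
        cs.stdBasis (cs.simple i) = 1 := by
  constructor
  · rw [mul_sub, stdBasis_simple_sq, ← Algebra.commutes, ← Algebra.smul_def]
    abel
  · rw [sub_mul, stdBasis_simple_sq, ← Algebra.smul_def]
    abel

theorem isUnit_stdBasis_simple {B W : Type*} [Group W] {M : CoxeterMatrix B}
    (cs : CoxeterSystem M W) (i : B) : IsUnit (cs.stdBasis (cs.simple i)) :=
  ⟨⟨_, _, (cs.stdBasis_simple_mul_inv i).1, (cs.stdBasis_simple_mul_inv i).2⟩, rfl⟩

theorem isUnit_stdBasis {B W : Type*} [Group W] {M : CoxeterMatrix B} (cs : CoxeterSystem M W)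
    (w : W) : IsUnit (cs.stdBasis w) := by
  induction hn : cs.length w using Nat.strong_induction_on generalizing w with
  | _ n ih =>
    by_cases hw : w = 1
    · rw [hw, stdBasis_one]
      exact isUnit_one
    · obtain ⟨i, hi⟩ := cs.exists_leftDescent_of_ne_one hw
      have h1 := cs.isLeftDescent_iff.1 hi
      have h2 : cs.stdBasis (cs.simple i) * cs.stdBasis (cs.simple i * w) = cs.stdBasis w := by
        rw [stdBasis_mul]
        · simp
        · simp [← h1, add_comm]
      rw [← h2]
      exact (cs.isUnit_stdBasis_simple i).mul (ih _ (hn ▸ hi) _ rfl)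

/-- The Hecke algebra with the `ℤ[v, v⁻¹]`-algebra structure twisted by `v ↦ v⁻¹`
(an auxiliary type for the definition of the bar involution). -/
def TwistedHecke {B W : Type*} [Group W] {M : CoxeterMatrix B} (cs : CoxeterSystem M W) : Type _ :=
  cs.Hecke

noncomputable instance {B W : Type*} [Group W] {M : CoxeterMatrix B} (cs : CoxeterSystem M W) :
    Ring cs.TwistedHecke :=
  inferInstanceAs (Ring cs.Hecke)

noncomputable instance {B W : Type*} [Group W] {M : CoxeterMatrix B} (cs : CoxeterSystem M W) :
    Algebra (LaurentPolynomial ℤ) cs.TwistedHecke :=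
  RingHom.toAlgebra' (S := cs.Hecke)
    ((algebraMap (LaurentPolynomial ℤ) cs.Hecke).comp
      (LaurentPolynomial.invert (R := ℤ) : LaurentPolynomial ℤ →+* LaurentPolynomial ℤ))
    fun a x => Algebra.commutes (A := cs.Hecke) (LaurentPolynomial.invert a) x

/-- The image `(H_{w⁻¹})⁻¹` of `H_w` under the bar involution. -/
noncomputable def barGen {B W : Type*} [Group W] {M : CoxeterMatrix B} (cs : CoxeterSystem M W)
    (w : W) : cs.TwistedHecke :=
  (Ring.inverse (cs.stdBasis w⁻¹) : cs.Hecke)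

theorem barGen_one {B W : Type*} [Group W] {M : CoxeterMatrix B} (cs : CoxeterSystem M W) :
    cs.barGen 1 = 1 := by
  have h : Ring.inverse (cs.stdBasis (1 : W)⁻¹) = 1 := by
    rw [inv_one, stdBasis_one, Ring.inverse_one]
  exact h

theorem barGen_mul {B W : Type*} [Group W] {M : CoxeterMatrix B} (cs : CoxeterSystem M W)
    (x y : W) (h : cs.length (x * y) = cs.length x + cs.length y) :
    cs.barGen x * cs.barGen y = cs.barGen (x * y) := by
  have h' : Ring.inverse (cs.stdBasis x⁻¹) * Ring.inverse (cs.stdBasis y⁻¹) =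
      Ring.inverse (cs.stdBasis (x * y)⁻¹) := by
    rw [mul_inv_rev, ← stdBasis_mul]
    · obtain ⟨a, ha⟩ := cs.isUnit_stdBasis x⁻¹
      obtain ⟨b, hb⟩ := cs.isUnit_stdBasis y⁻¹
      rw [← ha, ← hb, ← Units.val_mul, Ring.inverse_unit, Ring.inverse_unit,
        Ring.inverse_unit, mul_inv_rev, Units.val_mul]
    · rw [← mul_inv_rev, length_inv, length_inv, length_inv, h, add_comm]
  exact h'

theorem barGen_quad {B W : Type*} [Group W] {M : CoxeterMatrix B} (cs : CoxeterSystem M W)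
    (i : B) : cs.barGen (cs.simple i) * cs.barGen (cs.simple i) =
      1 + (LaurentPolynomial.T (-1) - LaurentPolynomial.T 1 : LaurentPolynomial ℤ) •
        cs.barGen (cs.simple i) := by
  have h : Ring.inverse (cs.stdBasis (cs.simple i)⁻¹) * Ring.inverse (cs.stdBasis (cs.simple i)⁻¹) =
      1 + algebraMap (LaurentPolynomial ℤ) cs.Hecke (LaurentPolynomial.invert
        (LaurentPolynomial.T (-1) - LaurentPolynomial.T 1)) *
          Ring.inverse (cs.stdBasis (cs.simple i)⁻¹) := by
    have h1 := cs.stdBasis_simple_mul_inv i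
    have h2 : Ring.inverse (cs.stdBasis (cs.simple i)) = cs.stdBasis (cs.simple i) -
        algebraMap _ _
          (LaurentPolynomial.T (-1) - LaurentPolynomial.T 1 : LaurentPolynomial ℤ) :=
      Ring.inverse_unit (⟨_, _, h1.1, h1.2⟩ : cs.Heckeˣ)
    have h3 : LaurentPolynomial.invert (R := ℤ)
        (LaurentPolynomial.T (-1) - LaurentPolynomial.T 1) =
        -(LaurentPolynomial.T (-1) - LaurentPolynomial.T 1) := by
      rw [map_sub, LaurentPolynomial.invert_T, LaurentPolynomial.invert_T, neg_sub, neg_neg]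
    rw [inv_simple, h3, h2, map_neg]
    generalize algebraMap (LaurentPolynomial ℤ) cs.Hecke
      (LaurentPolynomial.T (-1) - LaurentPolynomial.T 1) = c at h1
    rw [sub_mul, h1.1]
    noncomm_ring
  rw [Algebra.smul_def]
  exact h

/-- The bar involution as an algebra homomorphism to the twisted algebra: `H_w ↦ (H_{w⁻¹})⁻¹`. -/
noncomputable def barAlgHom {B W : Type*} [Group W] {M : CoxeterMatrix B}
    (cs : CoxeterSystem M W) : cs.Hecke →ₐ[LaurentPolynomial ℤ] cs.TwistedHecke :=
  RingQuot.liftAlgHom (LaurentPolynomial ℤ)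
    ⟨FreeAlgebra.lift (LaurentPolynomial ℤ) cs.barGen, by
      intro a b hab
      cases hab with
      | one => rw [FreeAlgebra.lift_ι_apply, map_one, barGen_one]
      | mul x y h =>
        rw [map_mul, FreeAlgebra.lift_ι_apply, FreeAlgebra.lift_ι_apply, FreeAlgebra.lift_ι_apply,
          cs.barGen_mul x y h]
      | quad i =>
        rw [map_mul, map_add, map_one, map_smul, FreeAlgebra.lift_ι_apply, barGen_quad]⟩

/-- The bar involution of the Hecke algebra: the ring homomorphism with `v ↦ v⁻¹` and
`H_w ↦ (H_{w⁻¹})⁻¹`. -/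
noncomputable def bar {B W : Type*} [Group W] {M : CoxeterMatrix B} (cs : CoxeterSystem M W) :
    cs.Hecke →+* cs.Hecke :=
  (cs.barAlgHom : cs.Hecke →+* cs.TwistedHecke)

theorem bar_stdBasis {B W : Type*} [Group W] {M : CoxeterMatrix B} (cs : CoxeterSystem M W)
    (w : W) : cs.bar (cs.stdBasis w) = Ring.inverse (cs.stdBasis w⁻¹) := by
  have h : cs.barAlgHom (cs.stdBasis w) = cs.barGen w :=
    (RingQuot.liftAlgHom_mkAlgHom_apply (LaurentPolynomial ℤ) _ _ _).trans
      (FreeAlgebra.lift_ι_apply _ _)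
  exact h

theorem bar_algebraMap {B W : Type*} [Group W] {M : CoxeterMatrix B} (cs : CoxeterSystem M W)
    (a : LaurentPolynomial ℤ) :
    cs.bar (algebraMap _ _ a) = algebraMap _ _ (LaurentPolynomial.invert a) :=
  cs.barAlgHom.commutes a

/-! ### The Kazhdan-Lusztig basis and cells -/

/-- `c` is the Kazhdan-Lusztig basis element of `w`: it is invariant under the bar involution and of
the form `H_w + ∑_{y ≠ w} f_y H_y` with all `f_y ∈ v ℤ[v]`. -/
def IsKLElement {B W : Type*} [Group W] {M : CoxeterMatrix B} (cs : CoxeterSystem M W)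
    (w : W) (c : cs.Hecke) : Prop :=
  cs.bar c = c ∧
    ∃ f : W →₀ LaurentPolynomial ℤ,
      c = Finsupp.linearCombination (LaurentPolynomial ℤ) cs.stdBasis f ∧
      f w = 1 ∧
      ∀ y, y ≠ w → ∃ g : Polynomial ℤ, f y = Polynomial.toLaurent (Polynomial.X * g)

/-- The Kazhdan-Lusztig basis: for every `w` the unique element that satisfies `IsKLElement`. -/
noncomputable def klBasis {B W : Type*} [Group W] {M : CoxeterMatrix B} (cs : CoxeterSystem M W)
    (w : W) : cs.Hecke :=
  Classical.epsilon (cs.IsKLElement w)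

/-- The Kazhdan-Lusztig basis element of `y` appears with a non-zero coefficient in the expansion
of `h` in the Kazhdan-Lusztig basis. -/
def AppearsIn {B W : Type*} [Group W] {M : CoxeterMatrix B} (cs : CoxeterSystem M W)
    (y : W) (h : cs.Hecke) : Prop :=
  ∃ f : W →₀ LaurentPolynomial ℤ,
    h = Finsupp.linearCombination (LaurentPolynomial ℤ) cs.klBasis f ∧ f y ≠ 0

/-- The left preorder `x ≤_L y`. -/
def LeftLE {B W : Type*} [Group W] {M : CoxeterMatrix B} (cs : CoxeterSystem M W)
    (x y : W) : Prop :=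
  ∃ w, cs.AppearsIn y (cs.klBasis w * cs.klBasis x)

/-- The right preorder `x ≤_R y`. -/
def RightLE {B W : Type*} [Group W] {M : CoxeterMatrix B} (cs : CoxeterSystem M W)
    (x y : W) : Prop :=
  ∃ w, cs.AppearsIn y (cs.klBasis x * cs.klBasis w)

/-- The left cell `L_i` that contains the simple reflection of `i`. -/
def leftCell {B W : Type*} [Group W] {M : CoxeterMatrix B} (cs : CoxeterSystem M W)
    (i : B) : Set W :=
  {x | cs.LeftLE x (cs.simple i) ∧ cs.LeftLE (cs.simple i) x}

/-- The right cell `R_i` that contains the simple reflection of `i`. -/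
def rightCell {B W : Type*} [Group W] {M : CoxeterMatrix B} (cs : CoxeterSystem M W)
    (i : B) : Set W :=
  {x | cs.RightLE x (cs.simple i) ∧ cs.RightLE (cs.simple i) x}

/-! ### Walks in the diagram and elements of the group -/

/-- The word of a walk `t₁, t₂, …, t_k` in the diagram: it is `t_k … t₂ t₁`, so that a walk from
`p` to `q` has a word of the form `q … p`. -/
def walkWord {B : Type*} {M : CoxeterMatrix B} {p q : B} (P : M.diagram.Walk p q) : List B :=
  P.support.reverse

/-- The map `w ↦ u₁ w u₂` for a walk `P` from `q'` to `q` and a walk `Q` from `p` to `p'`. Here `u₁`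
is the product along `P` without its starting point `q'` and `u₂` is the product along `Q` without
its end point `p'`; so if `w` is given by a walk from `p'` to `q'`, then `u₁ w u₂` is given by the
concatenation of the three walks, in which the common end points are written once. -/
def extend {B W : Type*} [Group W] {M : CoxeterMatrix B} (cs : CoxeterSystem M W)
    {p p' q q' : B} (P : M.diagram.Walk q' q) (Q : M.diagram.Walk p p') (w : W) : W :=
  cs.wordProd (walkWord P).dropLast * w * cs.wordProd (walkWord Q).tail

open Classical in
/-- The map `w ↦ u₁ w u₂`, except that, for `p' = q'`, the simple reflection of `p'` (the trivial
walk at `p'`) is sent to the product along a given walk `K` from `p` to `q`. With `K` the shortest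
path, this is the concatenation of the walks `Q` and `P` after cancellation of their overlap. -/
noncomputable def extendReduced {B W : Type*} [Group W] {M : CoxeterMatrix B}
    (cs : CoxeterSystem M W) {p p' q q' : B} (P : M.diagram.Walk q' q) (Q : M.diagram.Walk p p')
    (K : M.diagram.Walk p q) (w : W) : W :=
  if p' = q' ∧ w = cs.simple p' then cs.wordProd (walkWord K) else cs.extend P Q w

/-! ### Parabolic subsystems -/

/-- The canonical homomorphism to `W` from the Coxeter group of the restricted Coxeter matrix, which
sends simple reflections to simple reflections. -/
def parabolicHom {B W : Type*} [Group W] {M : CoxeterMatrix B} (cs : CoxeterSystem M W)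
    (J : Set B) : (M.restrict J).Group →* W :=
  (M.restrict J).toCoxeterSystem.lift
    ⟨fun j => cs.simple j, fun i j => cs.simple_mul_simple_pow i j⟩

theorem range_parabolicHom {B W : Type*} [Group W] {M : CoxeterMatrix B} (cs : CoxeterSystem M W)
    (J : Set B) : (cs.parabolicHom J).range = Subgroup.closure (cs.simple '' J) := by
  have h (j : J) : cs.parabolicHom J ((M.restrict J).toCoxeterSystem.simple j) = cs.simple j :=
    lift_apply_simple _ _ _
  rw [MonoidHom.range_eq_map, ← (M.restrict J).toCoxeterSystem.subgroup_closure_range_simple,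
    MonoidHom.map_closure, ← Set.range_comp]
  congr 1
  ext w
  simp only [Set.mem_range, Function.comp_apply, h, Subtype.exists, Set.mem_image, exists_prop]

end CoxeterSystem

/-! The cells of simple reflections can be described by words, after which the theorem is a
statement about walks in a tree. By `mem_leftCell_iff` and `mem_rightCell_iff`, the left (right)
cell of a simple reflection consists of the elements with a unique reduced expression whose last
(first) letter is that reflection. Such expressions are the rigid words: no letter is repeated at
once and no infix is one side of a braid relation (`IsRigidWord.isReduced_and_isRigid`,
`IsRigid.isRigidWord`). So `L_p ∩ R_q` is in bijection with the rigid words from `q` to `p`.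

Why the cells have this form: `s ≤_L x` holds iff `s` is a right descent of `x`, since `C_x C_s` is
a multiple of `C_x` and everything in `h C_s` has the right descent `s`. The `C_y` with `y` not
rigid span a left ideal (`klRepr_mul_klBasis_eq_zero`), so only rigid elements can lead back to `s`.
Conversely, a rigid element can be shortened letter by letter down to its last letter by multiplying
with suitable `C_r`, the relevant `μ` being `1`; coefficients at rigid elements are nonnegative at
`v = 1`, so nothing cancels (`exists_evalOne_klRepr_pos`).

In a tree: adjacent letters of a rigid word do not commute, so the word is a walk, and over an edge
with label `3` the pattern `aba` is forbidden, so the walk cannot turn back there. Without labeled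
edges only paths remain. With one labeled edge the walk may turn back on that edge alone: it is a
path, or it enters the edge at the projection of `q`, alternates for fewer than `m` letters, and
leaves from the projection of `p` (`IsRigidWord.nodup_or_isExtendedAltWord`, `IsRigidWord.extend`).
Replacing the two outer paths gives the bijections. Rigidity depends only on the labels between the
letters that occur, which gives the comparison with the dihedral group.

The foundations are the exchange property, the order of a product of two simple reflections, the
standard basis of the Hecke algebra, and the existence of the Kazhdan–Lusztig basis. -/

/-! ### The exchange property -/

namespace CoxeterSystem

variable {B W : Type*} [Group W] {M : CoxeterMatrix B}

open Classical in
/-- The action of a simple reflection on `W × ZMod 2` from which the exchange property is derived. -/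
noncomputable def signedConj (cs : CoxeterSystem M W) (i : B) : Function.End (W × ZMod 2) :=
  fun x => (cs.simple i * x.1 * cs.simple i, x.2 + if x.1 = cs.simple i then 1 else 0)

open Classical in
/-- The composite of the maps `signedConj` along a word, in reverse order. -/
noncomputable def signedConjWord (cs : CoxeterSystem M W) (ω : List B) :
    (Function.End (W × ZMod 2))ᵐᵒᵖ :=
  (ω.map fun i => MulOpposite.op (cs.signedConj i)).prod

-- The second coordinate counts, modulo `2`, how often `t` occurs in the left inversion sequence.
-- The opposite monoid makes the first letter act first, which matches the recursion of
-- `leftInvSeq`.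
open Classical in
theorem unop_signedConjWord_apply (cs : CoxeterSystem M W) (ω : List B) (t : W) (ε : ZMod 2) :
    (cs.signedConjWord ω).unop (t, ε) =
      ((cs.wordProd ω)⁻¹ * t * cs.wordProd ω, ε + ((cs.leftInvSeq ω).count t : ℕ)) := by
  induction ω generalizing t ε with
  | nil =>
    simp [signedConjWord]
    rfl
  | cons i ω ih =>
    have h1 : (cs.signedConjWord (i :: ω)).unop (t, ε) =
        (cs.signedConjWord ω).unop (cs.signedConj i (t, ε)) := by
      simp [signedConjWord]
      rfl
    have h2 : (List.map (⇑(MulAut.conj (cs.simple i))) (cs.leftInvSeq ω)).count t =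
        (cs.leftInvSeq ω).count (cs.simple i * t * cs.simple i) := by
      have h3 : t = MulAut.conj (cs.simple i) (cs.simple i * t * cs.simple i) := by
        simp [mul_assoc]
      conv_lhs => rw [h3]
      exact List.count_map_of_injective _ _ (MulAut.conj (cs.simple i)).injective _
    rw [h1, signedConj, ih, leftInvSeq, List.count_cons, h2, wordProd_cons]
    ext
    · simp [mul_assoc]
    · simp only [beq_iff_eq, Nat.cast_add, Nat.cast_ite, Nat.cast_one, Nat.cast_zero,
        eq_comm (a := t)]
      ring

-- The inversion sequence of this word has length `2m` and period `m`, because `(st)^m = 1`, so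
-- every entry occurs an even number of times. This is the braid relation for `signedConj`.
open Classical in
theorem even_count_leftInvSeq_alternatingWord (cs : CoxeterSystem M W) (i j : B) (t : W) :
    Even ((cs.leftInvSeq (alternatingWord i j (2 * M i j))).count t) := by
  set m := M i j with hm
  set l := cs.leftInvSeq (alternatingWord i j (2 * m)) with hl
  have hlen : l.length = 2 * m := by simp [hl]
  have h : l.take m = l.drop m := by
    apply List.ext_getElem
    · simp [hlen]; lia
    · intro k h1 h2
      have hk : k < m := by simp [hlen] at h1; lia
      rw [List.getElem_take, List.getElem_drop]
      simp only [hl]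
      rw [getElem_leftInvSeq_alternatingWord _ _ _ _ _ (by lia),
        getElem_leftInvSeq_alternatingWord _ _ _ _ _ (by lia),
        prod_alternatingWord_eq_mul_pow, prod_alternatingWord_eq_mul_pow]
      have e1 : (2 * k + 1) / 2 = k := by lia
      have e2 : (2 * (m + k) + 1) / 2 = m + k := by lia
      have e3 : ¬ Even (2 * k + 1) := by simp [parity_simps]
      have e4 : ¬ Even (2 * (m + k) + 1) := by simp [parity_simps]
      rw [e1, e2, if_neg e3, if_neg e4, pow_add, hm, simple_mul_simple_pow', one_mul]
  rw [← List.take_append_drop m l, List.count_append, h]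
  exact ⟨_, rfl⟩

theorem isLiftable_signedConj (cs : CoxeterSystem M W) :
    M.IsLiftable fun i => MulOpposite.op (cs.signedConj i) := by
  classical
  intro i j
  have h1 (p : ℕ) : (MulOpposite.op (cs.signedConj i) * MulOpposite.op (cs.signedConj j)) ^ p =
      cs.signedConjWord (alternatingWord i j (2 * p)) := by
    induction p with
    | zero => simp [signedConjWord, alternatingWord]
    | succ p ih =>
      rw [mul_add, mul_one, alternatingWord_succ', alternatingWord_succ', pow_succ', ih]
      simp [signedConjWord, parity_simps, mul_assoc]
  rw [h1]
  apply MulOpposite.unop_injective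
  funext ⟨t, ε⟩
  rw [unop_signedConjWord_apply]
  have h2 := prod_alternatingWord_eq_mul_pow cs i j (2 * M i j)
  rw [if_pos (by simp), one_mul, Nat.mul_div_cancel_left _ two_pos, simple_mul_simple_pow] at h2
  rw [h2, (ZMod.natCast_eq_zero_iff_even).2 (cs.even_count_leftInvSeq_alternatingWord i j t)]
  simp
  rfl

-- The maps `signedConj` satisfy the Coxeter relations, hence define an action of `W`; the parity is
-- read off from this action.
open Classical in
theorem count_leftInvSeq_eq_of_wordProd_eq (cs : CoxeterSystem M W) {ω ω' : List B}
    (h : cs.wordProd ω = cs.wordProd ω') (t : W) :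
    ((cs.leftInvSeq ω).count t : ZMod 2) = ((cs.leftInvSeq ω').count t : ℕ) := by
  have h1 (ω : List B) : cs.signedConjWord ω =
      cs.lift ⟨_, cs.isLiftable_signedConj⟩ (cs.wordProd ω) := by
    rw [wordProd, map_list_prod, List.map_map]
    unfold signedConjWord
    congr 2
    funext i
    exact (cs.lift_apply_simple cs.isLiftable_signedConj i).symm
  have h2 : (cs.signedConjWord ω).unop (t, 0) = (cs.signedConjWord ω').unop (t, 0) := by
    rw [h1, h1, h]
  rw [unop_signedConjWord_apply, unop_signedConjWord_apply] at h2
  simpa using congrArg Prod.snd h2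

/-- The exchange property for left descents. -/
theorem exists_simple_mul_eq_wordProd_eraseIdx (cs : CoxeterSystem M W) {ω : List B} {i : B}
    (h : cs.IsLeftDescent (cs.wordProd ω) i) :
    ∃ j < ω.length, cs.simple i * cs.wordProd ω = cs.wordProd (ω.eraseIdx j) := by
  classical
  -- The comparison word is `i :: ω'`, in whose inversion sequence `s_i` occurs exactly once. By
  -- parity `s_i` also occurs in that of `ω`, and its position is the letter to erase.
  obtain ⟨ω', hω', h1⟩ := cs.exists_isReduced (cs.simple i * cs.wordProd ω)
  have h2 : cs.wordProd ω = cs.wordProd (i :: ω') := by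
    rw [wordProd_cons, ← h1, simple_mul_simple_cancel_left]
  have h3 : cs.simple i ∉ cs.leftInvSeq ω' := by
    intro h3
    have h4 := (cs.isLeftInversion_of_mem_leftInvSeq hω' h3).2
    rw [← h1, simple_mul_simple_cancel_left] at h4
    exact lt_asymm h h4
  have h4 : cs.simple i ∉ List.map (⇑(MulAut.conj (cs.simple i))) (cs.leftInvSeq ω') := by
    intro h4
    obtain ⟨t, ht, ht'⟩ := List.mem_map.1 h4
    apply h3
    rw [MulAut.conj_apply, inv_simple, mul_eq_right] at ht'
    have h5 : t = cs.simple i := by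
      rw [← mul_left_cancel_iff (a := cs.simple i), ht', simple_mul_simple_self]
    rwa [h5] at ht
  have h5 := cs.count_leftInvSeq_eq_of_wordProd_eq h2 (cs.simple i)
  rw [leftInvSeq, List.count_cons_self, List.count_eq_zero_of_not_mem h4] at h5
  have h6 : cs.simple i ∈ cs.leftInvSeq ω := by
    by_contra h6
    rw [List.count_eq_zero_of_not_mem h6] at h5
    simp at h5
  obtain ⟨j, hj, h7⟩ := List.mem_iff_getElem.1 h6
  refine ⟨j, by simpa using hj, ?_⟩
  rw [← getD_leftInvSeq_mul_wordProd, List.getD_eq_getElem _ 1 hj, h7]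

/-- The exchange property for right descents. -/
theorem exists_wordProd_mul_simple_eq_eraseIdx (cs : CoxeterSystem M W) {ω : List B} {i : B}
    (h : cs.IsRightDescent (cs.wordProd ω) i) :
    ∃ j < ω.length, cs.wordProd ω * cs.simple i = cs.wordProd (ω.eraseIdx j) := by
  rw [← isLeftDescent_inv_iff, ← wordProd_reverse] at h
  obtain ⟨j, hj, h1⟩ := cs.exists_simple_mul_eq_wordProd_eraseIdx h
  rw [List.length_reverse] at hj
  refine ⟨ω.length - 1 - j, by lia, ?_⟩
  rw [← inv_inj, mul_inv_rev, inv_simple, ← wordProd_reverse, h1, ← wordProd_reverse]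
  congr 1
  rw [List.eraseIdx_eq_take_drop_succ, List.eraseIdx_eq_take_drop_succ, List.reverse_append,
    List.take_reverse, List.drop_reverse]
  congr 3 <;> lia

/-- If `ℓ (s w t) = ℓ w` and `ℓ (s w) = ℓ (w t)` then `s w = w t`. -/
theorem simple_mul_eq_mul_simple (cs : CoxeterSystem M W) {w : W} {i j : B}
    (h1 : cs.length (cs.simple i * w * cs.simple j) = cs.length w)
    (h2 : cs.length (cs.simple i * w) = cs.length (w * cs.simple j)) :
    cs.simple i * w = w * cs.simple j := by
  have key (w : W) (h1 : cs.length (cs.simple i * w * cs.simple j) = cs.length w)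
      (h2 : cs.length (cs.simple i * w) = cs.length (w * cs.simple j))
      (h3 : cs.length w < cs.length (cs.simple i * w)) :
      cs.simple i * w = w * cs.simple j := by
    obtain ⟨ω, hω, rfl⟩ := cs.exists_isReduced w
    rw [← wordProd_cons] at *
    have h4 : cs.IsRightDescent (cs.wordProd (i :: ω)) j := by
      rw [IsRightDescent, h1]
      exact h3
    -- The erased letter must be the initial `i`: erasing inside `ω` would make `w s_j` shorter than
    -- `w`, although it has the length of `s_i w`.
    obtain ⟨k, hk, h5⟩ := cs.exists_wordProd_mul_simple_eq_eraseIdx h4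
    cases k with
    | zero =>
      rw [List.eraseIdx_cons_zero] at h5
      rw [← h5, simple_mul_simple_cancel_right]
    | succ k =>
      rw [List.eraseIdx_cons_succ, wordProd_cons, wordProd_cons, mul_assoc,
        mul_left_cancel_iff] at h5
      have h6 := cs.length_wordProd_le (ω.eraseIdx k)
      rw [← h5, ← h2] at h6
      have h7 := hω.eq
      have h8 := List.length_eraseIdx_le ω k
      lia
  rcases cs.length_simple_mul w i with h3 | h3
  · exact key w h1 h2 (by lia)
  · have h4 := key (cs.simple i * w) (by simp [h2]) (by simp [h1]) (by simp; lia)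
    rw [simple_mul_simple_cancel_left] at h4
    conv_rhs => rw [h4, simple_mul_simple_cancel_right]

end CoxeterSystem

/-! ### The geometric representation and the order of a product of two simple reflections -/

namespace CoxeterMatrix

open Polynomial.Chebyshev

variable {B : Type*}

/-- The Cartan coefficient `-2 cos (π / m i j)`, with the convention `π / ∞ = 0`. -/
noncomputable def cartanCoeff (M : CoxeterMatrix B) (i j : B) : ℝ :=
  -(2 * Real.cos (Real.pi / M i j))

theorem cartanCoeff_self (M : CoxeterMatrix B) (i : B) : M.cartanCoeff i i = 2 := by
  simp [cartanCoeff]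

theorem cartanCoeff_comm (M : CoxeterMatrix B) (i j : B) :
    M.cartanCoeff i j = M.cartanCoeff j i := by
  rw [cartanCoeff, M.symmetric, cartanCoeff]

/-- The simple coroot of `i` in the dual of the geometric representation. -/
noncomputable def simpleCoroot (M : CoxeterMatrix B) (i : B) : Module.Dual ℝ (B →₀ ℝ) :=
  Finsupp.linearCombination ℝ (M.cartanCoeff i)

theorem simpleCoroot_single (M : CoxeterMatrix B) (i j : B) :
    M.simpleCoroot i (Finsupp.single j 1) = M.cartanCoeff i j := by
  simp [simpleCoroot]

theorem simpleCoroot_single_self (M : CoxeterMatrix B) (i : B) :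
    M.simpleCoroot i (Finsupp.single i 1) = 2 := by
  rw [simpleCoroot_single, cartanCoeff_self]

/-- The reflection of a simple root in the geometric representation. -/
noncomputable def simpleReflection (M : CoxeterMatrix B) (i : B) : (B →₀ ℝ) ≃ₗ[ℝ] (B →₀ ℝ) :=
  Module.reflection (M.simpleCoroot_single_self i)

/-- This is the trace of a rotation by `2π / m`, the parameter at which the formulas for powers of a
product of two reflections evaluate Chebyshev polynomials. -/
theorem sq_cartanCoeff_sub_two (M : CoxeterMatrix B) (i j : B) :
    M.simpleCoroot i (Finsupp.single j 1) * M.simpleCoroot j (Finsupp.single i 1) - 2 =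
      2 * Real.cos (2 * (Real.pi / M i j)) := by
  rw [simpleCoroot_single, simpleCoroot_single, M.cartanCoeff_comm j i, cartanCoeff, Real.cos_two_mul]
  ring

theorem pi_div_mem_Ioo {m : ℕ} (hm : 3 ≤ m) :
    0 < Real.pi / m ∧ Real.pi / m < Real.pi / 2 := by
  have h1 := Real.pi_pos
  have h2 : (3 : ℝ) ≤ m := by exact_mod_cast hm
  constructor
  · positivity
  · gcongr
    linarith

theorem S_eval_mul_sin (θ : ℝ) (n : ℤ) :
    (S ℝ n).eval (2 * Real.cos (2 * θ)) * Real.sin (2 * θ) = Real.sin ((n + 1) * (2 * θ)) :=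
  S_two_mul_real_cos _ _

/-- Put `θ = π / m`. The power is expressed by values of `S_n` at `2 cos 2θ`, where `S_n sin 2θ =
sin ((n + 1) 2θ)`. Since `mθ = π`, the correction terms contain the factor `S_{k-1} = 0` for `m =
2k` and `S_k + S_{k-1} = 0` for `m = 2k + 1`. The case `m = 2` is separate because `sin 2θ = 0`
there. -/
theorem simpleReflection_mul_pow (M : CoxeterMatrix B) (i j : B) :
    (M.simpleReflection i * M.simpleReflection j) ^ M i j = 1 := by
  rcases eq_or_ne i j with rfl | hij
  · rw [M.diagonal, pow_one]
    apply LinearEquiv.ext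
    intro x
    rw [LinearEquiv.mul_apply]
    exact Module.involutive_reflection (M.simpleCoroot_single_self i) x
  have hne1 : M i j ≠ 1 := M.off_diagonal i j hij
  apply LinearEquiv.ext
  intro z
  rw [simpleReflection, simpleReflection, Module.reflection_mul_reflection_pow_apply _ _ _ _ _
    (M.sq_cartanCoeff_sub_two i j).symm]
  set m := M i j with hm
  set θ := Real.pi / m with hθ
  obtain h0 | h2 | h3 : m = 0 ∨ m = 2 ∨ 3 ≤ m := by lia
  · simp [h0]
  · have hθ2 : θ = Real.pi / 2 := by rw [hθ, h2, Nat.cast_two]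
    have hc : M.cartanCoeff i j = 0 := by
      rw [cartanCoeff, ← hm, ← hθ, hθ2, Real.cos_pi_div_two]
      simp
    have h4 : 2 * Real.cos (2 * θ) = -2 := by
      rw [hθ2, mul_div_cancel₀ _ two_ne_zero, Real.cos_pi]
      norm_num
    rw [simpleCoroot_single, simpleCoroot_single, M.cartanCoeff_comm j i, hc, h4, h2]
    norm_num [S_zero, S_one, S_neg_one]
    abel
  · obtain ⟨hpos, hlt⟩ := pi_div_mem_Ioo h3
    rw [← hθ] at hpos hlt
    have hsin : Real.sin (2 * θ) ≠ 0 := (Real.sin_pos_of_pos_of_lt_pi (by linarith) (by linarith)).ne'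
    have hmθ : m * θ = Real.pi := by
      rw [hθ, mul_div_cancel₀]
      have : 0 < m := by lia
      positivity
    obtain ⟨k, hk | hk⟩ := Nat.even_or_odd' m
    · have e1 : ((m : ℤ) - 2) / 2 = k - 1 := by lia
      have e2 : ((m : ℤ) - 1) / 2 = k - 1 := by lia
      have hS : (S ℝ ((k : ℤ) - 1)).eval (2 * Real.cos (2 * θ)) = 0 := by
        apply (mul_left_inj' hsin).1
        rw [S_eval_mul_sin, zero_mul]
        have : (((k : ℤ) - 1 : ℤ) + 1 : ℝ) * (2 * θ) = m * θ := by rw [hk]; push_cast; ring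
        rw [this, hmθ, Real.sin_pi]
      rw [e1, e2, hS]
      simp
    · have e1 : ((m : ℤ) - 2) / 2 = k - 1 := by lia
      have e2 : ((m : ℤ) - 1) / 2 = k := by lia
      have e3 : ((m : ℤ) - 3) / 2 = k - 1 := by lia
      have e4 : (m : ℤ) / 2 = k := by lia
      have hS : (S ℝ (k : ℤ)).eval (2 * Real.cos (2 * θ)) +
          (S ℝ ((k : ℤ) - 1)).eval (2 * Real.cos (2 * θ)) = 0 := by
        apply (mul_left_inj' hsin).1
        rw [add_mul, S_eval_mul_sin, S_eval_mul_sin, zero_mul]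
        have h5 : (((k : ℤ) - 1 : ℤ) + 1 : ℝ) * (2 * θ) = Real.pi - θ := by
          rw [← hmθ, hk]; push_cast; ring
        have h6 : (((k : ℤ) : ℝ) + 1) * (2 * θ) = θ + Real.pi := by
          rw [← hmθ, hk]; push_cast; ring
        rw [h5, h6, Real.sin_pi_sub, Real.sin_add_pi]
        ring
      rw [e1, e2, e3, e4, hS]
      simp

/-- Apply the power to the root of `i` and compare coordinates. For `m ≥ 3` this gives `S_{n-1} = 0`
and `S_n = 1` at `2 cos 2θ`, hence `cos (2nθ) = 1` with `θ = π / m`. -/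
theorem dvd_of_simpleReflection_mul_pow_eq_one (M : CoxeterMatrix B) {i j : B} (hij : i ≠ j)
    {n : ℕ} (h : (M.simpleReflection i * M.simpleReflection j) ^ n = 1) : M i j ∣ n := by
  have hne1 : M i j ≠ 1 := M.off_diagonal i j hij
  have h1 := Module.reflection_mul_reflection_pow_apply_self (M.simpleCoroot_single_self i)
    (M.simpleCoroot_single_self j) n _ (M.sq_cartanCoeff_sub_two i j).symm
  rw [simpleReflection, simpleReflection] at h
  rw [h] at h1
  have h2 := DFunLike.congr_fun h1 i
  have h3 := DFunLike.congr_fun h1 j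
  have h0 : M.simpleCoroot j (Finsupp.single i 1) = M.cartanCoeff i j := by
    rw [simpleCoroot_single, M.cartanCoeff_comm]
  simp [hij, hij.symm] at h2 h3
  rw [h0] at h3
  clear h0 h1
  set m := M i j with hm
  set θ := Real.pi / m with hθ
  have hcart : M.cartanCoeff i j = -(2 * Real.cos θ) := rfl
  obtain h0 | hm2 | hm3 : m = 0 ∨ m = 2 ∨ 3 ≤ m := by lia
  -- Label `∞`: the coordinate at `j` is a nonzero multiple of `S_{n-1}(2) = n`, so `n = 0`.
  · have hθ0 : θ = 0 := by rw [hθ, h0]; simp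
    rw [hcart, hθ0] at h3
    simp at h3
    rw [h3]
    exact dvd_zero _
  · have hθ2 : θ = Real.pi / 2 := by rw [hθ, hm2, Nat.cast_two]
    have h4 : 2 * Real.cos (2 * θ) = -2 := by
      rw [hθ2, mul_div_cancel₀ _ two_ne_zero, Real.cos_pi]
      norm_num
    rw [h4, S_eval_neg_two, S_eval_neg_two] at h2
    rw [hm2, ← even_iff_two_dvd]
    by_contra hn
    rw [Nat.not_even_iff_odd] at hn
    have hn' : Odd (n : ℤ) := by exact_mod_cast hn
    rw [Int.negOnePow_odd _ hn', Int.negOnePow_even _ (by simpa [parity_simps] using hn')] at h2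
    push_cast at h2
    linarith
  · obtain ⟨hpos, hlt⟩ := pi_div_mem_Ioo hm3
    rw [← hθ] at hpos hlt
    have hsin2 : Real.sin (2 * θ) ≠ 0 :=
      (Real.sin_pos_of_pos_of_lt_pi (by linarith) (by linarith)).ne'
    have hcos : Real.cos θ ≠ 0 := (Real.cos_pos_of_mem_Ioo ⟨by linarith, hlt⟩).ne'
    have h5 : (S ℝ ((n : ℤ) - 1)).eval (2 * Real.cos (2 * θ)) = 0 := by
      rcases h3 with h3 | h3
      · exact h3
      · rw [hcart] at h3
        simp [hcos] at h3
    rw [h5, add_zero] at h2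
    have h6 := S_eval_mul_sin θ n
    have h7 := S_eval_mul_sin θ (n - 1)
    rw [← h2, one_mul] at h6
    rw [h5, zero_mul] at h7
    push_cast at h6 h7
    rw [sub_add_cancel] at h7
    rw [add_mul, one_mul, Real.sin_add, ← h7, zero_mul, zero_add] at h6
    have h8 : Real.cos (n * (2 * θ)) = 1 := mul_right_cancel₀ hsin2 (by rw [← h6, one_mul])
    obtain ⟨k, hk⟩ := (Real.cos_eq_one_iff _).1 h8
    have hm0 : (m : ℝ) ≠ 0 := by
      have : 0 < m := by lia
      positivity
    have h9 : (k : ℝ) * m = n := by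
      have h10 := Real.pi_pos.ne'
      rw [hθ] at hk
      field_simp at hk
      linarith
    have h11 : k * (m : ℤ) = n := by exact_mod_cast h9
    exact Int.natCast_dvd_natCast.1 ⟨k, by rw [← h11, mul_comm]⟩

end CoxeterMatrix

namespace CoxeterSystem

variable {B W : Type*} [Group W] {M : CoxeterMatrix B}

/-- The geometric representation of a Coxeter group. -/
noncomputable def geometricRep (cs : CoxeterSystem M W) : W →* ((B →₀ ℝ) ≃ₗ[ℝ] (B →₀ ℝ)) :=
  cs.lift ⟨M.simpleReflection, M.simpleReflection_mul_pow⟩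

theorem dvd_of_simple_mul_simple_pow_eq_one (cs : CoxeterSystem M W) {i j : B} (hij : i ≠ j)
    {n : ℕ} (h : (cs.simple i * cs.simple j) ^ n = 1) : M i j ∣ n := by
  apply M.dvd_of_simpleReflection_mul_pow_eq_one hij
  have h1 (k : B) : cs.geometricRep (cs.simple k) = M.simpleReflection k :=
    cs.lift_apply_simple M.simpleReflection_mul_pow k
  rw [← h1, ← h1, ← map_mul, ← map_pow, h, map_one]

theorem dvd_of_simple_mul_simple_zpow_eq_one (cs : CoxeterSystem M W) {i j : B} (hij : i ≠ j)
    {n : ℤ} (h : (cs.simple i * cs.simple j) ^ n = 1) : (M i j : ℤ) ∣ n := by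
  obtain ⟨k, rfl | rfl⟩ := n.eq_nat_or_neg
  · exact_mod_cast cs.dvd_of_simple_mul_simple_pow_eq_one hij (by exact_mod_cast h)
  · rw [zpow_neg, inv_eq_one] at h
    rw [dvd_neg]
    exact_mod_cast cs.dvd_of_simple_mul_simple_pow_eq_one hij (by exact_mod_cast h)

theorem simple_injective (cs : CoxeterSystem M W) : Function.Injective cs.simple := by
  intro i j h
  by_contra hij
  have h1 := cs.dvd_of_simple_mul_simple_pow_eq_one hij (n := 1) (by simp [h])
  exact M.off_diagonal i j hij (Nat.dvd_one.1 h1)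

end CoxeterSystem

/-! ### Alternating words -/

namespace CoxeterSystem

variable {B W : Type*} [Group W] {M : CoxeterMatrix B}

/-- The word of length `n` that alternates between `a` and `b` and begins with `a`. -/
def altList (a b : B) : ℕ → List B
  | 0 => []
  | n + 1 => a :: altList b a n

@[simp] theorem length_altList (a b : B) (n : ℕ) : (altList a b n).length = n := by
  induction n generalizing a b with
  | zero => rfl
  | succ n ih => simp [altList, ih]

theorem mem_altList {a b x : B} {n : ℕ} (h : x ∈ altList a b n) : x = a ∨ x = b := by
  induction n generalizing a b with
  | zero => simp [altList] at h
  | succ n ih =>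
    rw [altList, List.mem_cons] at h
    rcases h with h | h
    · exact .inl h
    · exact (ih h).symm

theorem altList_eq_reverse_alternatingWord (a b : B) (n : ℕ) :
    altList a b n = (alternatingWord b a n).reverse := by
  induction n generalizing a b with
  | zero => rfl
  | succ n ih => rw [altList, alternatingWord_succ, ih]; simp

theorem wordProd_altList_comm (cs : CoxeterSystem M W) (a b : B) :
    cs.wordProd (altList a b (M a b)) = cs.wordProd (altList b a (M a b)) := by
  rw [altList_eq_reverse_alternatingWord, altList_eq_reverse_alternatingWord, wordProd_reverse,
    wordProd_reverse, inv_inj]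
  have h := cs.wordProd_braidWord_eq b a
  rwa [braidWord, braidWord, M.symmetric b a] at h

theorem simple_mul_zpow (cs : CoxeterSystem M W) (a b : B) (j : ℤ) :
    cs.simple a * (cs.simple a * cs.simple b) ^ j =
      (cs.simple a * cs.simple b) ^ (-j) * cs.simple a := by
  have h : MulAut.conj (cs.simple a) (cs.simple a * cs.simple b) =
      (cs.simple a * cs.simple b)⁻¹ := by
    simp
  have h1 := congrArg (· ^ j) h
  beta_reduce at h1
  rw [← map_zpow, MulAut.conj_apply, inv_simple, inv_zpow, ← zpow_neg] at h1
  rw [← h1, simple_mul_simple_cancel_right]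

theorem simple_mul_zpow' (cs : CoxeterSystem M W) (a b : B) (j : ℤ) :
    cs.simple b * (cs.simple a * cs.simple b) ^ j =
      (cs.simple a * cs.simple b) ^ (-j - 1) * cs.simple a := by
  have h : cs.simple b = (cs.simple a * cs.simple b) ^ (-1 : ℤ) * cs.simple a := by simp
  conv_lhs => lhs; rw [h]
  rw [mul_assoc, simple_mul_zpow, ← mul_assoc, ← zpow_add]
  congr 2
  ring

/-- The normal form of a product of reflections `a`, `b`, with bounds for the exponent. -/
theorem exists_wordProd_eq_zpow (cs : CoxeterSystem M W) {a b : B} (ω : List B)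
    (h : ∀ x ∈ ω, x = a ∨ x = b) :
    ∃ j : ℤ, -(ω.length + ω.length % 2 : ℤ) ≤ 2 * j ∧ 2 * j ≤ ω.length - ω.length % 2 ∧
      cs.wordProd ω = (cs.simple a * cs.simple b) ^ j *
        if Even ω.length then 1 else cs.simple a := by
  induction ω with
  | nil => exact ⟨0, by simp⟩
  | cons x ω ih =>
    obtain ⟨j, h1, h2, h3⟩ := ih fun y hy => h y (List.mem_cons_of_mem _ hy)
    rw [wordProd_cons, h3, List.length_cons, ← mul_assoc]
    rcases h x List.mem_cons_self with rfl | rfl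
    · refine ⟨-j, by push_cast; lia, by push_cast; lia, ?_⟩
      rw [simple_mul_zpow]
      by_cases hE : Even ω.length <;> simp [hE, parity_simps, -Nat.not_even_iff_odd]
    · refine ⟨-j - 1, by push_cast; lia, by push_cast; lia, ?_⟩
      rw [simple_mul_zpow']
      by_cases hE : Even ω.length <;> simp [hE, parity_simps, -Nat.not_even_iff_odd]

theorem wordProd_altList (cs : CoxeterSystem M W) (a b : B) (n : ℕ) :
    cs.wordProd (altList a b n) =
      (cs.simple a * cs.simple b) ^ (n / 2 : ℤ) * if Even n then 1 else cs.simple a := by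
  induction n using Nat.twoStepInduction with
  | zero => simp [altList]
  | one => simp [altList]
  | more n ih _ =>
    have h1 : ((n + 2 : ℕ) : ℤ) / 2 = 1 + n / 2 := by lia
    rw [altList, altList, wordProd_cons, wordProd_cons, ih, h1, zpow_add, zpow_one]
    simp [parity_simps, mul_assoc]

/-- In the normal form `(ab)^j` or `(ab)^j a`, the alternating word attains the largest exponent for
its length. A word two letters shorter has the same parity and an exponent smaller by at least `1`
and at most `n - 1`, so the difference is not a multiple of `M a b`. -/
theorem wordProd_altList_ne (cs : CoxeterSystem M W) {a b : B} (hab : a ≠ b) {n : ℕ}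
    (hn : M a b = 0 ∨ n ≤ M a b) (ω : List B) (h : ∀ x ∈ ω, x = a ∨ x = b)
    (hω : ω.length + 2 = n) : cs.wordProd (altList a b n) ≠ cs.wordProd ω := by
  intro h1
  obtain ⟨j, hj1, hj2, h2⟩ := cs.exists_wordProd_eq_zpow ω h
  have hE : Even n ↔ Even ω.length := by
    rw [← hω]
    simp [parity_simps]
  rw [wordProd_altList, h2, if_congr hE rfl rfl, mul_right_cancel_iff] at h1
  have h3 := cs.dvd_of_simple_mul_simple_zpow_eq_one hab (n := n / 2 - j)
    (by rw [zpow_sub, h1, mul_inv_cancel])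
  have h4 : 0 < (n / 2 - j : ℤ) := by lia
  have h5 := Int.le_of_dvd h4 h3
  rcases hn with hn | hn
  · rw [hn] at h3
    simp at h3
    lia
  · lia

theorem length_mul_le_of_eq_wordProd_mul (cs : CoxeterSystem M W) {w z : W} {ω : List B}
    (h : w = cs.wordProd ω * z) : cs.length w ≤ ω.length + cs.length z := by
  rw [h]
  exact (cs.length_mul_le _ _).trans (Nat.add_le_add_right (cs.length_wordProd_le _) _)

/-- If `a` and `b` are left descents of `w`, then `w` has reduced expressions that begin with long
alternating words in `a` and `b`. -/
theorem exists_eq_wordProd_altList_mul (cs : CoxeterSystem M W) {w : W} {a b : B} (hab : a ≠ b)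
    (ha : cs.IsLeftDescent w a) (hb : cs.IsLeftDescent w b) (n : ℕ)
    (hn : M a b = 0 ∨ n ≤ M a b) :
    ∃ z, w = cs.wordProd (altList a b n) * z ∧ cs.length w = n + cs.length z := by
  induction n generalizing a b with
  | zero => exact ⟨w, by simp [altList], by simp⟩
  | succ n ih =>
    obtain ⟨z, h1, h2⟩ := ih hab.symm hb ha (by rw [M.symmetric]; lia)
    obtain ⟨ω, hω, rfl⟩ := cs.exists_isReduced z
    have h3 : w = cs.wordProd (altList b a n ++ ω) := by rw [h1, wordProd_append]
    obtain ⟨j, hj, h4⟩ := cs.exists_simple_mul_eq_wordProd_eraseIdx (h3 ▸ ha)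
    have h5 : w = cs.simple a * cs.wordProd ((altList b a n ++ ω).eraseIdx j) := by
      rw [← h4, ← h3, simple_mul_simple_cancel_left]
    -- If the erased letter lay in the alternating prefix, cancelling `z` would equate an
    -- alternating word of length `n + 1` with a word of `n - 1` letters in `a` and `b`.
    rcases lt_or_ge j n with hjn | hjn
    · exfalso
      rw [List.eraseIdx_append_of_lt_length (by simpa using hjn), wordProd_append, ← mul_assoc, h1,
        mul_right_cancel_iff, eq_comm, ← mul_left_cancel_iff (a := cs.simple a),
        simple_mul_simple_cancel_left, ← wordProd_cons] at h5
      refine cs.wordProd_altList_ne hab hn ((altList b a n).eraseIdx j) ?_ ?_ h5.symm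
      · intro x hx
        exact (mem_altList (List.mem_of_mem_eraseIdx hx)).symm
      · rw [List.length_eraseIdx_of_lt (by simpa using hjn), length_altList]
        lia
    · rw [List.eraseIdx_append_of_length_le (by simpa using hjn), length_altList,
        wordProd_append, ← mul_assoc, ← wordProd_cons] at h5
      refine ⟨_, h5, ?_⟩
      have h6 := cs.length_mul_le_of_eq_wordProd_mul (ω := altList a b (n + 1)) h5
      have h7 := cs.length_wordProd_le (ω.eraseIdx (j - n))
      rw [List.length_append, length_altList] at hj
      rw [List.length_eraseIdx_of_lt (by lia)] at h7
      rw [length_altList] at h6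
      have h8 := hω.eq
      lia

/-- For the label `∞` the alternating prefix of a reduced expression could be longer than `w`
itself. -/
theorem coxeterMatrix_ne_zero_of_isLeftDescent (cs : CoxeterSystem M W) {w : W} {a b : B}
    (hab : a ≠ b) (ha : cs.IsLeftDescent w a) (hb : cs.IsLeftDescent w b) : M a b ≠ 0 := by
  intro h
  obtain ⟨z, -, h1⟩ := cs.exists_eq_wordProd_altList_mul hab ha hb (cs.length w + 1) (.inl h)
  lia

/-! ### Elements with a unique reduced expression -/

/-- `w` has a unique reduced expression. -/
def IsRigid (cs : CoxeterSystem M W) (w : W) : Prop :=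
  ∀ ω ω' : List B, cs.IsReduced ω → cs.IsReduced ω' → cs.wordProd ω = w → cs.wordProd ω' = w →
    ω = ω'

/-- A word to which neither a braid move nor a cancellation of adjacent letters applies. -/
def IsRigidWord (M : CoxeterMatrix B) (ω : List B) : Prop :=
  ω.IsChain (· ≠ ·) ∧ ∀ a b, a ≠ b → M a b ≠ 0 → ¬ altList a b (M a b) <:+: ω

theorem IsReduced.tail {cs : CoxeterSystem M W} {a : B} {ω : List B}
    (h : cs.IsReduced (a :: ω)) : cs.IsReduced ω := by
  simpa using h.drop 1

theorem isReduced_cons_iff (cs : CoxeterSystem M W) {a : B} {ω : List B}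
    (hω : cs.IsReduced ω) : cs.IsReduced (a :: ω) ↔ ¬ cs.IsLeftDescent (cs.wordProd ω) a := by
  rw [not_isLeftDescent_iff, IsReduced, wordProd_cons, hω.eq, List.length_cons]

theorem IsReduced.isLeftDescent_head {cs : CoxeterSystem M W} {a : B} {ω : List B}
    (h : cs.IsReduced (a :: ω)) : cs.IsLeftDescent (cs.wordProd (a :: ω)) a := by
  rw [IsLeftDescent, h.eq, wordProd_cons, simple_mul_simple_cancel_left, h.tail.eq]
  simp

theorem exists_isReduced_cons (cs : CoxeterSystem M W) {w : W} {a : B}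
    (h : cs.IsLeftDescent w a) : ∃ ω, cs.IsReduced (a :: ω) ∧ cs.wordProd (a :: ω) = w := by
  obtain ⟨ω, hω, h1⟩ := cs.exists_isReduced (cs.simple a * w)
  have h2 : cs.wordProd (a :: ω) = w := by
    rw [wordProd_cons, ← h1, simple_mul_simple_cancel_left]
  refine ⟨ω, ?_, h2⟩
  rw [isReduced_cons_iff _ hω, ← h1]
  exact cs.isLeftDescent_iff_not_isLeftDescent_mul.1 h

theorem IsRigid.leftDescent_unique {cs : CoxeterSystem M W} {w : W} (hw : cs.IsRigid w) {a b : B}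
    (ha : cs.IsLeftDescent w a) (hb : cs.IsLeftDescent w b) : a = b := by
  obtain ⟨ω, h1, h2⟩ := cs.exists_isReduced_cons ha
  obtain ⟨ω', h3, h4⟩ := cs.exists_isReduced_cons hb
  exact (List.cons.inj (hw _ _ h1 h3 h2 h4)).1

theorem IsRigid.of_cons {cs : CoxeterSystem M W} {w : W} {a : B}
    (hw : cs.IsRigid (cs.simple a * w)) (ha : ¬ cs.IsLeftDescent w a) : cs.IsRigid w := by
  intro ω ω' h1 h2 h3 h4
  have h5 := hw (a :: ω) (a :: ω') ((cs.isReduced_cons_iff h1).2 (h3 ▸ ha))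
    ((cs.isReduced_cons_iff h2).2 (h4 ▸ ha)) (by rw [wordProd_cons, h3]) (by rw [wordProd_cons, h4])
  exact (List.cons.inj h5).2

theorem IsRigid.simple_mul {cs : CoxeterSystem M W} {w : W} (hw : cs.IsRigid w) {a : B}
    (ha : cs.IsLeftDescent w a) : cs.IsRigid (cs.simple a * w) := by
  apply IsRigid.of_cons (a := a)
  · rwa [simple_mul_simple_cancel_left]
  · exact cs.isLeftDescent_iff_not_isLeftDescent_mul.1 ha

theorem isRigid_one (cs : CoxeterSystem M W) : cs.IsRigid 1 := by
  intro ω ω' h1 h2 h3 h4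
  have h5 := h1.eq
  have h6 := h2.eq
  rw [h3, length_one, eq_comm, List.length_eq_zero_iff] at h5
  rw [h4, length_one, eq_comm, List.length_eq_zero_iff] at h6
  rw [h5, h6]

/-- Every reduced expression of `w ≠ 1` must begin with `a`, and what follows is a reduced
expression of the rigid element `s_a w`. -/
theorem isRigid_of_leftDescent_unique {cs : CoxeterSystem M W} {w : W} {a : B}
    (hw : cs.IsRigid (cs.simple a * w)) (h : ∀ b, cs.IsLeftDescent w b → b = a) :
    cs.IsRigid w := by
  by_cases h0 : w = 1
  · rw [h0]
    exact cs.isRigid_one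
  intro ω ω' h1 h2 h3 h4
  have key (ω : List B) (h1 : cs.IsReduced ω) (h3 : cs.wordProd ω = w) :
      ∃ ω₁, ω = a :: ω₁ ∧ cs.IsReduced ω₁ ∧ cs.wordProd ω₁ = cs.simple a * w := by
    cases ω with
    | nil => exact absurd h3.symm (by simpa using h0)
    | cons b ω₁ =>
      obtain rfl := h b (h3 ▸ h1.isLeftDescent_head)
      exact ⟨ω₁, rfl, h1.tail, by rw [← h3, wordProd_cons, simple_mul_simple_cancel_left]⟩
  obtain ⟨ω₁, rfl, h5, h6⟩ := key ω h1 h3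
  obtain ⟨ω₂, rfl, h7, h8⟩ := key ω' h2 h4
  rw [hw _ _ h5 h7 h6 h8]

theorem isRigid_inv_iff (cs : CoxeterSystem M W) {w : W} : cs.IsRigid w⁻¹ ↔ cs.IsRigid w := by
  have key (w : W) (h : cs.IsRigid w) : cs.IsRigid w⁻¹ := by
    intro ω ω' h1 h2 h3 h4
    rw [← List.reverse_inj]
    exact h _ _ h1.reverse h2.reverse (by rw [wordProd_reverse, h3, inv_inv])
      (by rw [wordProd_reverse, h4, inv_inv])
  exact ⟨fun h => inv_inv w ▸ key _ h, key w⟩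

theorem isRigid_simple (cs : CoxeterSystem M W) (i : B) : cs.IsRigid (cs.simple i) := by
  have h : cs.IsRigid (cs.simple i * cs.simple i) := by
    rw [simple_mul_simple_self]
    exact cs.isRigid_one
  apply isRigid_of_leftDescent_unique h
  intro b hb
  rw [IsLeftDescent, length_simple, Nat.lt_one_iff, length_eq_zero_iff, mul_eq_one_iff_eq_inv,
    inv_simple] at hb
  exact cs.simple_injective hb

theorem IsRigidWord.tail {a : B} {ω : List B} (h : IsRigidWord M (a :: ω)) : IsRigidWord M ω :=
  ⟨h.1.tail, fun b c hbc hM h1 => h.2 b c hbc hM (h1.trans (List.suffix_cons a ω).isInfix)⟩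

/-- A rigid word is reduced, and it is the unique reduced expression of its product. -/
theorem IsRigidWord.isReduced_and_isRigid (cs : CoxeterSystem M W) {ω : List B}
    (h : IsRigidWord M ω) : cs.IsReduced ω ∧ cs.IsRigid (cs.wordProd ω) := by
  induction ω with
  | nil => exact ⟨by simp [IsReduced], by simpa using cs.isRigid_one⟩
  | cons a ω ih =>
    obtain ⟨h1, h2⟩ := ih h.tail
    have h3 : cs.IsReduced (a :: ω) := by
      rw [isReduced_cons_iff _ h1]
      intro h3
      cases ω with
      | nil => simp [IsLeftDescent] at h3
      | cons b ω =>
        obtain rfl := h2.leftDescent_unique h3 h1.isLeftDescent_head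
        have h4 := h.1
        simp at h4
    refine ⟨h3, ?_⟩
    apply isRigid_of_leftDescent_unique (a := a)
    · rwa [wordProd_cons, simple_mul_simple_cancel_left]
    intro c hc
    by_contra hca
    have hac : a ≠ c := Ne.symm hca
    have hM := cs.coxeterMatrix_ne_zero_of_isLeftDescent hac h3.isLeftDescent_head hc
    -- A second descent `c` yields a reduced expression that begins with the full braid word of `a`
    -- and `c`. After cancelling `a`, uniqueness for `ω` shows that `a :: ω` itself begins with this
    -- braid word.
    obtain ⟨z, h4, h5⟩ := cs.exists_eq_wordProd_altList_mul hac h3.isLeftDescent_head hc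
      (M a c) (.inr le_rfl)
    obtain ⟨ω₁, hω₁, rfl⟩ := cs.exists_isReduced z
    obtain ⟨m, hm⟩ := Nat.exists_eq_succ_of_ne_zero hM
    have h6 : cs.wordProd ω = cs.wordProd (altList c a m ++ ω₁) := by
      rw [hm, Nat.succ_eq_add_one, altList, wordProd_cons, wordProd_cons, mul_assoc,
        mul_left_cancel_iff] at h4
      rw [h4, wordProd_append]
    have h7 : cs.IsReduced (altList c a m ++ ω₁) := by
      rw [IsReduced, ← h6, h1.eq]
      rw [h3.eq, hω₁.eq] at h5
      simp at h5 ⊢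
      lia
    have h8 := h2 _ _ h1 h7 rfl h6.symm
    apply h.2 a c hac hM
    rw [hm, Nat.succ_eq_add_one, altList, h8]
    exact (List.prefix_append (a :: altList c a m) ω₁).isInfix

/-- The reduced expression of an element with a unique reduced expression is a rigid word. -/
theorem IsRigid.isRigidWord {cs : CoxeterSystem M W} {ω : List B} (hω : cs.IsReduced ω)
    (h : cs.IsRigid (cs.wordProd ω)) : IsRigidWord M ω := by
  constructor
  · rw [List.isChain_iff_forall_rel_of_append_cons_cons]
    rintro a b l₁ l₂ rfl rfl
    have h1 := hω.drop l₁.length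
    rw [List.drop_left, isReduced_cons_iff] at h1
    · apply h1
      have h2 := hω.drop l₁.length
      rw [List.drop_left] at h2
      exact h2.tail.isLeftDescent_head
    · have h2 := hω.drop l₁.length
      rw [List.drop_left] at h2
      exact h2.tail
  · rintro a b hab hM ⟨l₁, l₂, rfl⟩
    have h1 : cs.wordProd (l₁ ++ altList b a (M a b) ++ l₂) =
        cs.wordProd (l₁ ++ altList a b (M a b) ++ l₂) := by
      simp only [wordProd_append]
      rw [wordProd_altList_comm]
    have h2 : cs.IsReduced (l₁ ++ altList b a (M a b) ++ l₂) := by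
      rw [IsReduced, h1, hω.eq]
      simp
    have h3 := h _ _ hω h2 rfl h1
    rw [List.append_left_inj, List.append_right_inj] at h3
    obtain ⟨m, hm⟩ := Nat.exists_eq_succ_of_ne_zero hM
    rw [hm, Nat.succ_eq_add_one, altList, altList] at h3
    exact hab (List.cons.inj h3).1

end CoxeterSystem

/-! ### The standard basis of the Hecke algebra -/

namespace CoxeterSystem

open LaurentPolynomial (T)

theorem finsupp_end_ext {W : Type*}
    {f g : Module.End (LaurentPolynomial ℤ) (W →₀ LaurentPolynomial ℤ)}
    (h : ∀ w, f (Finsupp.single w 1) = g (Finsupp.single w 1)) : f = g :=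
  Finsupp.basisSingleOne.ext fun w => by simpa using h w

variable {B W : Type*} [Group W] {M : CoxeterMatrix B}

open Classical in
/-- Left multiplication by `H_s` on the free module on `W`. -/
noncomputable def regLeft (cs : CoxeterSystem M W) (i : B) :
    Module.End (LaurentPolynomial ℤ) (W →₀ LaurentPolynomial ℤ) :=
  Finsupp.linearCombination _ fun w => Finsupp.single (cs.simple i * w) 1 +
    if cs.IsLeftDescent w i then
      (T (-1) - T 1 : LaurentPolynomial ℤ) • Finsupp.single w 1 else 0

open Classical in
/-- Right multiplication by `H_s` on the free module on `W`. -/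
noncomputable def regRight (cs : CoxeterSystem M W) (i : B) :
    Module.End (LaurentPolynomial ℤ) (W →₀ LaurentPolynomial ℤ) :=
  Finsupp.linearCombination _ fun w => Finsupp.single (w * cs.simple i) 1 +
    if cs.IsRightDescent w i then
      (T (-1) - T 1 : LaurentPolynomial ℤ) • Finsupp.single w 1 else 0

open Classical in
theorem regLeft_single (cs : CoxeterSystem M W) (i : B) (w : W) :
    cs.regLeft i (Finsupp.single w 1) = Finsupp.single (cs.simple i * w) 1 +
      if cs.IsLeftDescent w i then
        (T (-1) - T 1 : LaurentPolynomial ℤ) • Finsupp.single w 1 else 0 := by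
  rw [regLeft, Finsupp.linearCombination_single, one_smul]

open Classical in
theorem regRight_single (cs : CoxeterSystem M W) (i : B) (w : W) :
    cs.regRight i (Finsupp.single w 1) = Finsupp.single (w * cs.simple i) 1 +
      if cs.IsRightDescent w i then
        (T (-1) - T 1 : LaurentPolynomial ℤ) • Finsupp.single w 1 else 0 := by
  rw [regRight, Finsupp.linearCombination_single, one_smul]

/-- Multiplication on one side leaves the descent condition on the other side unchanged, except when
`ℓ(swt) = ℓ(w)` and `ℓ(sw) = ℓ(wt)`. In that case `simple_mul_eq_mul_simple` gives `sw = wt` and the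
two composites coincide. -/
theorem commute_regLeft_regRight (cs : CoxeterSystem M W) (i j : B) :
    Commute (cs.regLeft i) (cs.regRight j) := by
  classical
  apply finsupp_end_ext
  intro w
  rw [Module.End.mul_apply, Module.End.mul_apply, regLeft_single, regRight_single, map_add, map_add,
    apply_ite (cs.regLeft i), apply_ite (cs.regRight j), map_smul, map_smul, map_zero, map_zero,
    regLeft_single, regLeft_single, regRight_single, regRight_single, ← mul_assoc]
  have h1 := cs.length_simple_mul w i
  have h2 := cs.length_mul_simple w j
  have h3 := cs.length_simple_mul (w * cs.simple j) i
  have h4 := cs.length_mul_simple (cs.simple i * w) j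
  rw [← mul_assoc] at h3
  unfold IsLeftDescent IsRightDescent
  by_cases h : cs.simple i * w = w * cs.simple j
  · have h5 : cs.simple i * w * cs.simple j = w := by
      rw [h, simple_mul_simple_cancel_right]
    have h6 : cs.simple i * (w * cs.simple j) = w := by rw [← mul_assoc, h5]
    rw [h6, h, simple_mul_simple_cancel_right]
  · have h5 : ¬ (cs.length (cs.simple i * w * cs.simple j) = cs.length w ∧
        cs.length (cs.simple i * w) = cs.length (w * cs.simple j)) :=
      fun h5 => h (cs.simple_mul_eq_mul_simple h5.1 h5.2)
    rw [← mul_assoc]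
    split_ifs <;> first | lia | (simp only [smul_add, smul_zero]; abel)

/-- The operators `regRight` generate the free module from the vector at `1`. Thus the relations of
the Hecke algebra need to be checked on this one vector only, and the choice of reduced words in
`regOp` does not matter. -/
theorem eq_of_commute_regRight (cs : CoxeterSystem M W)
    {f g : Module.End (LaurentPolynomial ℤ) (W →₀ LaurentPolynomial ℤ)}
    (hf : ∀ i, Commute f (cs.regRight i)) (hg : ∀ i, Commute g (cs.regRight i))
    (h : f (Finsupp.single 1 1) = g (Finsupp.single 1 1)) : f = g := by
  classical
  apply finsupp_end_ext
  intro w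
  induction hn : cs.length w using Nat.strong_induction_on generalizing w with
  | _ n ih =>
    by_cases hw : w = 1
    · rw [hw, h]
    · obtain ⟨i, hi⟩ := cs.exists_rightDescent_of_ne_one hw
      have h1 : cs.regRight i (Finsupp.single (w * cs.simple i) 1) = Finsupp.single w 1 := by
        rw [regRight_single, if_neg (cs.isRightDescent_iff_not_isRightDescent_mul.1 hi),
          simple_mul_simple_cancel_right, add_zero]
      rw [← h1, ← Module.End.mul_apply, ← Module.End.mul_apply, (hf i).eq, (hg i).eq,
        Module.End.mul_apply, Module.End.mul_apply, ih _ (hn ▸ hi) _ rfl]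

/-- The composite of the operators `regLeft` along a word. -/
noncomputable def regLeftWord (cs : CoxeterSystem M W) (ω : List B) :
    Module.End (LaurentPolynomial ℤ) (W →₀ LaurentPolynomial ℤ) :=
  (ω.map cs.regLeft).prod

theorem commute_regLeftWord_regRight (cs : CoxeterSystem M W) (ω : List B) (j : B) :
    Commute (cs.regLeftWord ω) (cs.regRight j) := by
  apply Commute.list_prod_left
  intro f hf
  obtain ⟨i, -, rfl⟩ := List.mem_map.1 hf
  exact cs.commute_regLeft_regRight i j

theorem regLeftWord_single (cs : CoxeterSystem M W) {ω : List B} {y : W}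
    (h : cs.length (cs.wordProd ω * y) = ω.length + cs.length y) :
    cs.regLeftWord ω (Finsupp.single y 1) = Finsupp.single (cs.wordProd ω * y) 1 := by
  classical
  induction ω with
  | nil => simp [regLeftWord]
  | cons i ω ih =>
    have h1 := cs.length_simple_mul (cs.wordProd ω * y) i
    have h2 := (cs.length_mul_le (cs.wordProd ω) y).trans
      (Nat.add_le_add_right (cs.length_wordProd_le ω) _)
    rw [wordProd_cons, mul_assoc, List.length_cons] at h
    have h3 := ih (by lia)
    have h4 : cs.regLeftWord (i :: ω) = cs.regLeft i * cs.regLeftWord ω := by simp [regLeftWord]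
    rw [h4, Module.End.mul_apply, h3, regLeft_single, if_neg, add_zero, wordProd_cons, mul_assoc]
    rw [not_isLeftDescent_iff]
    lia

/-- Left multiplication by `H_w` on the free module on `W`. -/
noncomputable def regOp (cs : CoxeterSystem M W) (w : W) :
    Module.End (LaurentPolynomial ℤ) (W →₀ LaurentPolynomial ℤ) :=
  cs.regLeftWord (cs.exists_isReduced w).choose

theorem commute_regOp_regRight (cs : CoxeterSystem M W) (w : W) (j : B) :
    Commute (cs.regOp w) (cs.regRight j) :=
  cs.commute_regLeftWord_regRight _ j

theorem regOp_single (cs : CoxeterSystem M W) {x y : W}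
    (h : cs.length (x * y) = cs.length x + cs.length y) :
    cs.regOp x (Finsupp.single y 1) = Finsupp.single (x * y) 1 := by
  obtain ⟨h1, h2⟩ := (cs.exists_isReduced x).choose_spec
  rw [regOp, regLeftWord_single, ← h2]
  rw [← h2, h, ← h1.eq, ← h2]

theorem regOp_simple (cs : CoxeterSystem M W) (i : B) : cs.regOp (cs.simple i) = cs.regLeft i := by
  classical
  apply cs.eq_of_commute_regRight (cs.commute_regOp_regRight _) (cs.commute_regLeft_regRight i)
  rw [regOp_single _ (by simp), regLeft_single, if_neg (cs.not_isLeftDescent_one i), add_zero]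

/-- The regular representation of the Hecke algebra on the free module on `W`. -/
noncomputable def regRep (cs : CoxeterSystem M W) :
    cs.Hecke →ₐ[LaurentPolynomial ℤ]
      Module.End (LaurentPolynomial ℤ) (W →₀ LaurentPolynomial ℤ) :=
  RingQuot.liftAlgHom (LaurentPolynomial ℤ)
    ⟨FreeAlgebra.lift (LaurentPolynomial ℤ) cs.regOp, by
      classical
      intro a b hab
      cases hab with
      | one =>
        rw [FreeAlgebra.lift_ι_apply, map_one]
        apply cs.eq_of_commute_regRight (cs.commute_regOp_regRight _) fun i => Commute.one_left _
        rw [regOp_single _ (by simp)]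
        simp
      | mul x y h =>
        rw [map_mul, FreeAlgebra.lift_ι_apply, FreeAlgebra.lift_ι_apply, FreeAlgebra.lift_ι_apply]
        apply cs.eq_of_commute_regRight _ (cs.commute_regOp_regRight _)
        · rw [Module.End.mul_apply, regOp_single _ (by simp), mul_one, regOp_single _ h,
            regOp_single _ (by simp), mul_one]
        · exact fun i =>
            (cs.commute_regOp_regRight x i).mul_left (cs.commute_regOp_regRight y i)
      | quad i =>
        rw [map_mul, map_add, map_one, map_smul, FreeAlgebra.lift_ι_apply, regOp_simple]
        apply cs.eq_of_commute_regRight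
        · exact fun j =>
            (cs.commute_regLeft_regRight i j).mul_left (cs.commute_regLeft_regRight i j)
        · exact fun j => (Commute.one_left _).add_left
            ((cs.commute_regLeft_regRight i j).smul_left _)
        · have h : cs.IsLeftDescent (cs.simple i) i := by simp [IsLeftDescent]
          rw [Module.End.mul_apply, regLeft_single, if_neg (cs.not_isLeftDescent_one i), add_zero,
            mul_one, regLeft_single, if_pos h, simple_mul_simple_self, LinearMap.add_apply,
            LinearMap.smul_apply, regLeft_single, if_neg (cs.not_isLeftDescent_one i), add_zero,
            mul_one, Module.End.one_apply]⟩

theorem regRep_stdBasis (cs : CoxeterSystem M W) (w : W) :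
    cs.regRep (cs.stdBasis w) = cs.regOp w :=
  (RingQuot.liftAlgHom_mkAlgHom_apply (LaurentPolynomial ℤ) _ _ _).trans
    (FreeAlgebra.lift_ι_apply _ _)

/-- In the regular representation `H_w` sends the vector at `1` to the vector at `w`. -/
theorem linearIndependent_stdBasis (cs : CoxeterSystem M W) :
    LinearIndependent (LaurentPolynomial ℤ) cs.stdBasis := by
  let f : cs.Hecke →ₗ[LaurentPolynomial ℤ] (W →₀ LaurentPolynomial ℤ) :=
    (LinearMap.applyₗ (Finsupp.single 1 1)).comp cs.regRep.toLinearMap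
  have h : f ∘ cs.stdBasis = Finsupp.basisSingleOne := by
    funext w
    have h1 : f (cs.stdBasis w) = cs.regRep (cs.stdBasis w) (Finsupp.single 1 1) := rfl
    rw [Function.comp_apply, h1, regRep_stdBasis, regOp_single _ (by simp), mul_one,
      Finsupp.coe_basisSingleOne]
  apply LinearIndependent.of_comp f
  rw [h]
  exact Finsupp.basisSingleOne.linearIndependent

open Classical in
theorem stdBasis_simple_mul (cs : CoxeterSystem M W) (i : B) (y : W) :
    cs.stdBasis (cs.simple i) * cs.stdBasis y = cs.stdBasis (cs.simple i * y) +
      if cs.IsLeftDescent y i then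
        (T (-1) - T 1 : LaurentPolynomial ℤ) • cs.stdBasis y else 0 := by
  split_ifs with h
  · have h1 : cs.stdBasis y = cs.stdBasis (cs.simple i) * cs.stdBasis (cs.simple i * y) := by
      rw [stdBasis_mul, simple_mul_simple_cancel_left]
      rw [simple_mul_simple_cancel_left, length_simple, ← cs.isLeftDescent_iff.1 h, add_comm]
    conv_lhs => rw [h1]
    rw [← mul_assoc, stdBasis_simple_sq, add_mul, one_mul, smul_mul_assoc, ← h1]
  · rw [add_zero, stdBasis_mul]
    rw [cs.not_isLeftDescent_iff.1 h, length_simple, add_comm]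

/-- Serves twice: to show that the `H_w` span the algebra, and to show that the non-rigid
Kazhdan–Lusztig elements span a left ideal. -/
theorem mem_of_stdBasis_simple_mul_mem (cs : CoxeterSystem M W)
    (N : Submodule (LaurentPolynomial ℤ) cs.Hecke)
    (hN : ∀ i, ∀ h ∈ N, cs.stdBasis (cs.simple i) * h ∈ N) (a : cs.Hecke) {h : cs.Hecke}
    (hh : h ∈ N) : a * h ∈ N := by
  have h1 (w : W) : ∀ h ∈ N, cs.stdBasis w * h ∈ N := by
    induction hn : cs.length w using Nat.strong_induction_on generalizing w with
    | _ n ih =>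
      intro h hh
      by_cases hw : w = 1
      · rwa [hw, stdBasis_one, one_mul]
      · obtain ⟨i, hi⟩ := cs.exists_leftDescent_of_ne_one hw
        have h2 : cs.stdBasis w = cs.stdBasis (cs.simple i) * cs.stdBasis (cs.simple i * w) := by
          rw [stdBasis_mul, simple_mul_simple_cancel_left]
          rw [simple_mul_simple_cancel_left, length_simple, ← cs.isLeftDescent_iff.1 hi, add_comm]
        rw [h2, mul_assoc]
        exact hN i _ (ih _ (hn ▸ hi) _ rfl _ hh)
  let φ : FreeAlgebra (LaurentPolynomial ℤ) W →ₐ[LaurentPolynomial ℤ] cs.Hecke :=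
    RingQuot.mkAlgHom (LaurentPolynomial ℤ) (HeckeRel cs)
  obtain ⟨a, rfl⟩ : ∃ b, φ b = a :=
    RingQuot.mkAlgHom_surjective (LaurentPolynomial ℤ) (HeckeRel cs) a
  induction a using FreeAlgebra.induction generalizing h with
  | grade0 r =>
    rw [AlgHom.commutes, ← Algebra.smul_def]
    exact N.smul_mem r hh
  | grade1 w => exact h1 w h hh
  | mul a b ha hb =>
    rw [map_mul, mul_assoc]
    exact ha (hb hh)
  | add a b ha hb =>
    rw [map_add, add_mul]
    exact N.add_mem (ha hh) (hb hh)

theorem span_stdBasis (cs : CoxeterSystem M W) :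
    Submodule.span (LaurentPolynomial ℤ) (Set.range cs.stdBasis) = ⊤ := by
  classical
  rw [eq_top_iff]
  intro a _
  rw [← mul_one a]
  apply cs.mem_of_stdBasis_simple_mul_mem
  · intro i h hh
    induction hh using Submodule.span_induction with
    | mem x hx =>
      obtain ⟨y, rfl⟩ := hx
      rw [stdBasis_simple_mul]
      apply Submodule.add_mem _ (Submodule.subset_span (Set.mem_range_self _))
      split_ifs
      · exact Submodule.smul_mem _ _ (Submodule.subset_span (Set.mem_range_self _))
      · exact Submodule.zero_mem _
    | zero => rw [mul_zero]; exact Submodule.zero_mem _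
    | add x y _ _ hx hy => rw [mul_add]; exact Submodule.add_mem _ hx hy
    | smul c x _ hx => rw [mul_smul_comm]; exact Submodule.smul_mem _ _ hx
  · rw [← stdBasis_one]
    exact Submodule.subset_span (Set.mem_range_self 1)

/-- The standard basis of the Hecke algebra. -/
noncomputable def heckeBasis (cs : CoxeterSystem M W) :
    Module.Basis W (LaurentPolynomial ℤ) cs.Hecke :=
  Module.Basis.mk cs.linearIndependent_stdBasis cs.span_stdBasis.ge

@[simp] theorem heckeBasis_apply (cs : CoxeterSystem M W) (w : W) :
    cs.heckeBasis w = cs.stdBasis w :=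
  Module.Basis.mk_apply _ _ w

end CoxeterSystem

/-! ### Laurent polynomials without terms of exponent `≤ 0` -/

namespace LaurentPolynomial

theorem coeff_T_mul (k : ℤ) (a : LaurentPolynomial ℤ) (n : ℤ) :
    (T k * a).coeff n = a.coeff (n - k) := by
  rw [T, AddMonoidAlgebra.coeff_single_mul_eq_mul_coeff (n - k), one_mul]
  intro m _
  lia

theorem coeff_toLaurent_natCast (f : Polynomial ℤ) (k : ℕ) :
    (Polynomial.toLaurent f).coeff (k : ℤ) = f.coeff k := by
  rw [coeff_toLaurent]
  exact Finsupp.mapDomain_apply Nat.castEmbedding.injective _ k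

theorem coeff_toLaurent_of_neg (f : Polynomial ℤ) {k : ℤ} (hk : k < 0) :
    (Polynomial.toLaurent f).coeff k = 0 := by
  rw [coeff_toLaurent]
  apply Finsupp.mapDomain_of_notMem_range
  rintro ⟨n, hn⟩
  have : (n : ℤ) = k := hn
  lia

/-- The additive subgroup `v ℤ[v]` of `ℤ[v, v⁻¹]`. -/
def strictlyPositive : AddSubgroup (LaurentPolynomial ℤ) where
  carrier := {a | ∀ n ≤ 0, a.coeff n = 0}
  add_mem' {a b} ha hb n hn := by simp [ha n hn, hb n hn]
  zero_mem' n _ := by simp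
  neg_mem' {a} ha n hn := by simp [ha n hn]

theorem mem_strictlyPositive_iff_exists {a : LaurentPolynomial ℤ} :
    a ∈ strictlyPositive ↔ ∃ g : Polynomial ℤ, a = Polynomial.toLaurent (Polynomial.X * g) := by
  constructor
  · intro ha
    obtain ⟨n, f, hf⟩ := exists_T_pow a
    have h1 : Polynomial.X ^ (n + 1) ∣ f := by
      rw [Polynomial.X_pow_dvd_iff]
      intro d hd
      rw [← coeff_toLaurent_natCast, hf, mul_comm, coeff_T_mul]
      exact ha _ (by lia)
    obtain ⟨g, rfl⟩ := h1
    refine ⟨g, ?_⟩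
    have h2 : a * T n * T (-n) = a := by rw [mul_T_assoc, add_neg_cancel, T_zero, mul_one]
    rw [← h2, ← hf, pow_succ, mul_assoc, map_mul, map_pow, Polynomial.toLaurent_X, T_pow, mul_comm,
      ← mul_assoc, ← T_add, mul_one, neg_add_cancel, T_zero, one_mul]
  · rintro ⟨g, rfl⟩ n hn
    rw [map_mul, Polynomial.toLaurent_X, coeff_T_mul]
    exact coeff_toLaurent_of_neg _ (by lia)

theorem eq_zero_of_invert_eq {a : LaurentPolynomial ℤ} (h : invert a = a)
    (ha : a ∈ strictlyPositive) : a = 0 := by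
  ext n
  rw [AddMonoidAlgebra.coeff_zero, Finsupp.zero_apply]
  rcases le_total n 0 with hn | hn
  · exact ha n hn
  · rw [← h, invert_apply]
    exact ha _ (by lia)

theorem T_one_mul_mem {a : LaurentPolynomial ℤ} (ha : ∀ n < 0, a.coeff n = 0) :
    T 1 * a ∈ strictlyPositive := by
  intro n hn
  rw [coeff_T_mul]
  exact ha _ (by lia)

/-- The constant term of `v⁻¹ a` is the linear coefficient of `a`; this is the term that the
`μ`-corrections remove in the recursion for the Kazhdan–Lusztig basis. -/
theorem T_neg_one_mul_sub_mem {a : LaurentPolynomial ℤ} (ha : a ∈ strictlyPositive) :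
    T (-1) * a - C (a.coeff 1) ∈ strictlyPositive := by
  intro n hn
  have h1 : (T (-1) * a - C (a.coeff 1)).coeff n =
      (T (-1) * a).coeff n - (C (a.coeff 1)).coeff n := by simp
  rw [h1, coeff_T_mul, C_apply]
  split_ifs with h
  · simp [h]
  · rw [ha _ (by lia), sub_zero]

end LaurentPolynomial

/-! ### The Kazhdan-Lusztig basis -/

namespace CoxeterSystem

open LaurentPolynomial (T strictlyPositive)

variable {B W : Type*} [Group W] {M : CoxeterMatrix B}

theorem bar_stdBasis_simple (cs : CoxeterSystem M W) (i : B) :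
    cs.bar (cs.stdBasis (cs.simple i)) = cs.stdBasis (cs.simple i) -
      algebraMap _ _ (T (-1) - T 1 : LaurentPolynomial ℤ) := by
  have h := cs.stdBasis_simple_mul_inv i
  rw [bar_stdBasis, inv_simple]
  exact Ring.inverse_unit (⟨_, _, h.1, h.2⟩ : cs.Heckeˣ)

theorem bar_smul (cs : CoxeterSystem M W) (a : LaurentPolynomial ℤ) (h : cs.Hecke) :
    cs.bar (a • h) = LaurentPolynomial.invert a • cs.bar h := by
  rw [Algebra.smul_def, map_mul, bar_algebraMap, ← Algebra.smul_def]

theorem stdBasis_eq_simple_mul (cs : CoxeterSystem M W) {w : W} {i : B}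
    (hi : cs.IsLeftDescent w i) :
    cs.stdBasis w = cs.stdBasis (cs.simple i) * cs.stdBasis (cs.simple i * w) := by
  rw [stdBasis_mul, simple_mul_simple_cancel_left]
  rw [simple_mul_simple_cancel_left, length_simple, ← cs.isLeftDescent_iff.1 hi, add_comm]

/-- The span of the `H_y` with `ℓ y < n`. -/
noncomputable def lengthLT (cs : CoxeterSystem M W) (n : ℕ) :
    Submodule (LaurentPolynomial ℤ) cs.Hecke :=
  Submodule.span _ (cs.stdBasis '' {y | cs.length y < n})

theorem lengthLT_mono (cs : CoxeterSystem M W) {m n : ℕ} (h : m ≤ n) :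
    cs.lengthLT m ≤ cs.lengthLT n :=
  Submodule.span_mono (Set.image_mono fun _ hy => lt_of_lt_of_le hy h)

theorem stdBasis_mem_lengthLT (cs : CoxeterSystem M W) {y : W} {n : ℕ} (h : cs.length y < n) :
    cs.stdBasis y ∈ cs.lengthLT n :=
  Submodule.subset_span ⟨y, h, rfl⟩

theorem repr_eq_zero_of_mem_lengthLT (cs : CoxeterSystem M W) {h : cs.Hecke} {n : ℕ}
    (hh : h ∈ cs.lengthLT n) {y : W} (hy : n ≤ cs.length y) : cs.heckeBasis.repr h y = 0 := by
  induction hh using Submodule.span_induction with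
  | mem x hx =>
    obtain ⟨z, hz, rfl⟩ := hx
    rw [← heckeBasis_apply, Module.Basis.repr_self, Finsupp.single_eq_of_ne]
    rintro rfl
    exact absurd (lt_of_lt_of_le hz hy) (lt_irrefl _)
  | zero => simp
  | add x z _ _ hx hz => rw [map_add, Finsupp.add_apply, hx, hz, add_zero]
  | smul c x _ hx => rw [map_smul, Finsupp.smul_apply, hx, smul_zero]

theorem stdBasis_simple_mul_mem_lengthLT (cs : CoxeterSystem M W) (i : B) {h : cs.Hecke} {n : ℕ}
    (hh : h ∈ cs.lengthLT n) : cs.stdBasis (cs.simple i) * h ∈ cs.lengthLT (n + 1) := by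
  classical
  induction hh using Submodule.span_induction with
  | mem x hx =>
    obtain ⟨z, hz, rfl⟩ := hx
    have hz' : cs.length z < n := hz
    rw [stdBasis_simple_mul]
    apply Submodule.add_mem
    · apply stdBasis_mem_lengthLT
      have := cs.length_simple_mul z i
      lia
    · split_ifs
      · exact Submodule.smul_mem _ _ (cs.stdBasis_mem_lengthLT (by lia))
      · exact Submodule.zero_mem _
  | zero => rw [mul_zero]; exact Submodule.zero_mem _
  | add x z _ _ hx hz => rw [mul_add]; exact Submodule.add_mem _ hx hz
  | smul c x _ hx => rw [mul_smul_comm]; exact Submodule.smul_mem _ _ hx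

/-- The bar involution is unitriangular with respect to the length. -/
theorem bar_stdBasis_sub_mem (cs : CoxeterSystem M W) (w : W) :
    cs.bar (cs.stdBasis w) - cs.stdBasis w ∈ cs.lengthLT (cs.length w) := by
  induction hn : cs.length w using Nat.strong_induction_on generalizing w with
  | _ n ih =>
    by_cases hw : w = 1
    · rw [hw, stdBasis_one, map_one, sub_self]
      exact Submodule.zero_mem _
    · obtain ⟨i, hi⟩ := cs.exists_leftDescent_of_ne_one hw
      have h1 := ih (cs.length (cs.simple i * w)) (hn ▸ hi) _ rfl
      have h2 := cs.isLeftDescent_iff.1 hi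
      rw [cs.stdBasis_eq_simple_mul hi, map_mul, bar_stdBasis_simple]
      set w' := cs.simple i * w
      set l := cs.bar (cs.stdBasis w') - cs.stdBasis w' with hl
      have h3 : cs.bar (cs.stdBasis w') = cs.stdBasis w' + l := by rw [hl]; abel
      have h4 : (cs.stdBasis (cs.simple i) -
          algebraMap _ _ (T (-1) - T 1 : LaurentPolynomial ℤ)) * cs.bar (cs.stdBasis w') -
          cs.stdBasis (cs.simple i) * cs.stdBasis w' = cs.stdBasis (cs.simple i) * l -
            (T (-1) - T 1 : LaurentPolynomial ℤ) • cs.bar (cs.stdBasis w') := by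
        rw [Algebra.smul_def, sub_mul, h3]
        noncomm_ring
      have h5 : cs.length w' + 1 = n := by lia
      rw [h4, ← h5]
      apply Submodule.sub_mem
      · exact cs.stdBasis_simple_mul_mem_lengthLT i h1
      · apply Submodule.smul_mem
        rw [h3]
        exact Submodule.add_mem _ (cs.stdBasis_mem_lengthLT (by lia))
          (cs.lengthLT_mono (by lia) h1)

theorem repr_bar_stdBasis (cs : CoxeterSystem M W) {y z : W} (h : cs.length z ≤ cs.length y) :
    cs.heckeBasis.repr (cs.bar (cs.stdBasis z)) y = cs.heckeBasis.repr (cs.stdBasis z) y := by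
  have h1 := cs.repr_eq_zero_of_mem_lengthLT (cs.bar_stdBasis_sub_mem z) h
  rwa [map_sub, Finsupp.sub_apply, sub_eq_zero] at h1

/-- A bar-invariant element with all coefficients in `v ℤ[v]` vanishes. -/
theorem eq_zero_of_bar_eq (cs : CoxeterSystem M W) {h : cs.Hecke} (hbar : cs.bar h = h)
    (hpos : ∀ y, cs.heckeBasis.repr h y ∈ strictlyPositive) : h = 0 := by
  classical
  by_contra h0
  have h1 : (cs.heckeBasis.repr h).support.Nonempty := by
    rwa [Finsupp.support_nonempty_iff, ne_eq, LinearEquiv.map_eq_zero_iff]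
  -- At an element of maximal length in the support, the triangular bar involution only replaces `v`
  -- by `v⁻¹` in the coefficient, which is therefore symmetric and lies in `v ℤ[v]`.
  obtain ⟨y, hy, hmax⟩ := Finset.exists_max_image _ cs.length h1
  apply Finsupp.mem_support_iff.1 hy
  apply LaurentPolynomial.eq_zero_of_invert_eq _ (hpos y)
  have h2 : h = ∑ z ∈ (cs.heckeBasis.repr h).support,
      cs.heckeBasis.repr h z • cs.stdBasis z := by
    conv_lhs => rw [← cs.heckeBasis.linearCombination_repr h, Finsupp.linearCombination_apply,
      Finsupp.sum]
    simp
  have h3 : cs.heckeBasis.repr (cs.bar h) y = LaurentPolynomial.invert (cs.heckeBasis.repr h y) := by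
    conv_lhs => rw [h2]
    rw [map_sum, map_sum, Finsupp.finsetSum_apply, Finset.sum_eq_single_of_mem y hy]
    · rw [bar_smul, map_smul, Finsupp.smul_apply, repr_bar_stdBasis _ le_rfl, ← heckeBasis_apply,
        Module.Basis.repr_self, Finsupp.single_eq_same, smul_eq_mul, mul_one]
    · intro z hz hzy
      rw [bar_smul, map_smul, Finsupp.smul_apply, repr_bar_stdBasis _ (hmax z hz),
        ← heckeBasis_apply, Module.Basis.repr_self, Finsupp.single_eq_of_ne hzy.symm, smul_zero]
  rw [← h3, hbar]

theorem isKLElement_iff (cs : CoxeterSystem M W) {w : W} {c : cs.Hecke} :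
    cs.IsKLElement w c ↔ cs.bar c = c ∧ cs.heckeBasis.repr c w = 1 ∧
      ∀ y, y ≠ w → cs.heckeBasis.repr c y ∈ strictlyPositive := by
  have h0 : (cs.heckeBasis : W → cs.Hecke) = cs.stdBasis := funext cs.heckeBasis_apply
  simp only [LaurentPolynomial.mem_strictlyPositive_iff_exists]
  constructor
  · rintro ⟨h1, f, h2, h3, h4⟩
    rw [← h0] at h2
    have h5 : cs.heckeBasis.repr c = f := by rw [h2, Module.Basis.repr_linearCombination]
    rw [h5]
    exact ⟨h1, h3, h4⟩
  · rintro ⟨h1, h2, h3⟩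
    refine ⟨h1, cs.heckeBasis.repr c, ?_, h2, h3⟩
    rw [← h0, Module.Basis.linearCombination_repr]

theorem IsKLElement.unique {cs : CoxeterSystem M W} {w : W} {c c' : cs.Hecke}
    (h : cs.IsKLElement w c) (h' : cs.IsKLElement w c') : c = c' := by
  rw [isKLElement_iff] at h h'
  rw [← sub_eq_zero]
  apply cs.eq_zero_of_bar_eq
  · rw [map_sub, h.1, h'.1]
  · intro y
    rw [map_sub, Finsupp.sub_apply]
    by_cases hy : y = w
    · rw [hy, h.2.1, h'.2.1, sub_self]
      exact zero_mem _
    · exact sub_mem (h.2.2 y hy) (h'.2.2 y hy)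

/-- The Kazhdan-Lusztig element `H_s + v` of a simple reflection. -/
noncomputable def klSimple (cs : CoxeterSystem M W) (i : B) : cs.Hecke :=
  cs.stdBasis (cs.simple i) + algebraMap _ _ (T 1 : LaurentPolynomial ℤ)

theorem bar_klSimple (cs : CoxeterSystem M W) (i : B) : cs.bar (cs.klSimple i) = cs.klSimple i := by
  rw [klSimple, map_add, bar_stdBasis_simple, bar_algebraMap, LaurentPolynomial.invert_T, map_sub]
  abel

theorem klSimple_mul_self (cs : CoxeterSystem M W) (i : B) :
    cs.klSimple i * cs.klSimple i = (T 1 + T (-1) : LaurentPolynomial ℤ) • cs.klSimple i := by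
  have h1 : algebraMap (LaurentPolynomial ℤ) cs.Hecke (T 1) *
      algebraMap (LaurentPolynomial ℤ) cs.Hecke (T (-1)) = 1 := by
    rw [← map_mul, ← LaurentPolynomial.T_add, add_neg_cancel, LaurentPolynomial.T_zero, map_one]
  have h2 := Algebra.commutes (T 1 : LaurentPolynomial ℤ) (cs.stdBasis (cs.simple i))
  have h3 := Algebra.commutes (T 1 : LaurentPolynomial ℤ)
    (algebraMap (LaurentPolynomial ℤ) cs.Hecke (T (-1)))
  rw [klSimple, add_mul, mul_add, mul_add, stdBasis_simple_sq, Algebra.smul_def, Algebra.smul_def,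
    map_add, map_sub, ← h2, add_mul, mul_add, mul_add, ← h3, h1]
  noncomm_ring

open Classical in
theorem klSimple_mul_stdBasis (cs : CoxeterSystem M W) (i : B) (y : W) :
    cs.klSimple i * cs.stdBasis y = cs.stdBasis (cs.simple i * y) +
      (T (if cs.IsLeftDescent y i then -1 else 1) : LaurentPolynomial ℤ) • cs.stdBasis y := by
  rw [klSimple, add_mul, stdBasis_simple_mul, ← Algebra.smul_def]
  split_ifs
  · rw [sub_smul]
    abel
  · rw [add_zero]

open Classical in
theorem repr_klSimple_mul (cs : CoxeterSystem M W) (i : B) (h : cs.Hecke) (z : W) :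
    cs.heckeBasis.repr (cs.klSimple i * h) z = cs.heckeBasis.repr h (cs.simple i * z) +
      T (if cs.IsLeftDescent z i then -1 else 1) * cs.heckeBasis.repr h z := by
  have h1 : h ∈ Submodule.span (LaurentPolynomial ℤ) (Set.range cs.stdBasis) := by
    rw [span_stdBasis]
    exact Submodule.mem_top
  induction h1 using Submodule.span_induction with
  | mem x hx =>
    obtain ⟨y, rfl⟩ := hx
    rw [klSimple_mul_stdBasis, map_add, map_smul, ← heckeBasis_apply, ← heckeBasis_apply,
      Module.Basis.repr_self, Module.Basis.repr_self, Finsupp.add_apply, Finsupp.smul_apply]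
    have h2 : cs.simple i * y = z ↔ y = cs.simple i * z := by
      rw [← mul_left_cancel_iff (a := cs.simple i), simple_mul_simple_cancel_left]
    simp only [Finsupp.single_apply, h2]
    congr 1
    split_ifs with h3 h4 h5 <;> simp_all
  | zero => simp
  | add x y _ _ hx hy =>
    rw [mul_add, map_add, map_add, Finsupp.add_apply, Finsupp.add_apply, Finsupp.add_apply, hx, hy]
    ring
  | smul c x _ hx =>
    rw [mul_smul_comm, map_smul, map_smul, Finsupp.smul_apply, Finsupp.smul_apply,
      Finsupp.smul_apply, hx]
    simp only [smul_eq_mul]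
    ring

/-- A Kazhdan-Lusztig element of `w` in which only elements shorter than `w` occur besides `w`. -/
def IsTriangularKL (cs : CoxeterSystem M W) (w : W) (c : cs.Hecke) : Prop :=
  cs.IsKLElement w c ∧ ∀ y, y ≠ w → cs.length w ≤ cs.length y → cs.heckeBasis.repr c y = 0

open Classical in
/-- The elements `z` that occur in `c` and have the left descent `i`. -/
noncomputable def descentSupport (cs : CoxeterSystem M W) (i : B) (c : cs.Hecke) : Finset W :=
  (cs.heckeBasis.repr c).support.filter fun z => cs.IsLeftDescent z i

theorem mem_descentSupport (cs : CoxeterSystem M W) {i : B} {c : cs.Hecke} {z : W} :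
    z ∈ cs.descentSupport i c ↔ cs.heckeBasis.repr c z ≠ 0 ∧ cs.IsLeftDescent z i := by
  simp [descentSupport]

theorem IsTriangularKL.length_lt {cs : CoxeterSystem M W} {y z : W} {c : cs.Hecke} {i : B}
    (hc : cs.IsTriangularKL y c) (hi : ¬ cs.IsLeftDescent y i) (hz : z ∈ cs.descentSupport i c) :
    cs.length z < cs.length y := by
  rw [mem_descentSupport] at hz
  by_contra h
  refine hz.1 (hc.2 z ?_ (by lia))
  rintro rfl
  exact hi hz.2

/-- The recursion for the Kazhdan-Lusztig basis. -/
theorem IsTriangularKL.step {cs : CoxeterSystem M W} {y : W} {c : cs.Hecke} {i : B}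
    (hc : cs.IsTriangularKL y c) (hi : ¬ cs.IsLeftDescent y i) {C : W → cs.Hecke}
    (hC : ∀ z, cs.length z < cs.length y → cs.IsTriangularKL z (C z)) :
    cs.IsTriangularKL (cs.simple i * y) (cs.klSimple i * c -
      ∑ z ∈ cs.descentSupport i c, (cs.heckeBasis.repr c z).coeff 1 • C z) := by
  classical
  have hKL := hc.1
  have hlow := hc.2
  obtain ⟨hbar, hone, hpos⟩ := cs.isKLElement_iff.1 hKL
  have hC' (z : W) (hz : z ∈ cs.descentSupport i c) : cs.IsTriangularKL z (C z) :=
    hC z (hc.length_lt hi hz)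
  have hiy := cs.not_isLeftDescent_iff.1 hi
  have hrepr (x : W) : cs.heckeBasis.repr (cs.klSimple i * c -
      ∑ z ∈ cs.descentSupport i c, (cs.heckeBasis.repr c z).coeff 1 • C z) x =
      cs.heckeBasis.repr c (cs.simple i * x) +
        T (if cs.IsLeftDescent x i then -1 else 1) * cs.heckeBasis.repr c x -
      ∑ z ∈ cs.descentSupport i c,
        (cs.heckeBasis.repr c z).coeff 1 • cs.heckeBasis.repr (C z) x := by
    rw [map_sub, Finsupp.sub_apply, repr_klSimple_mul, map_sum, Finsupp.finsetSum_apply]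
    congr 1
    apply Finset.sum_congr rfl
    intro z _
    rw [map_zsmul, Finsupp.smul_apply]
  have hlowsum (x : W) (hx : cs.length y ≤ cs.length x) : ∑ z ∈ cs.descentSupport i c,
      (cs.heckeBasis.repr c z).coeff 1 • cs.heckeBasis.repr (C z) x = 0 := by
    apply Finset.sum_eq_zero
    intro z hz
    have h1 := hc.length_lt hi hz
    rw [(hC' z hz).2 x (by rintro rfl; lia) (by lia), smul_zero]
  have hne (x : W) (hx : x ≠ cs.simple i * y) : cs.simple i * x ≠ y := by
    rintro rfl
    exact hx (simple_mul_simple_cancel_left _ _).symm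
  refine ⟨cs.isKLElement_iff.2 ⟨?_, ?_, ?_⟩, ?_⟩
  · rw [map_sub, map_mul, bar_klSimple, hbar, map_sum]
    congr 1
    apply Finset.sum_congr rfl
    intro z hz
    rw [map_zsmul, (cs.isKLElement_iff.1 (hC' z hz).1).1]
  · rw [hrepr, simple_mul_simple_cancel_left, hone, hlowsum _ (by lia), hlow _ _ (by lia)]
    · simp
    · intro h
      rw [h] at hiy
      lia
  · intro x hx
    -- Modulo `v ℤ[v]` the corrections contribute at `x` only the constant `δ` below, which comes
    -- from `C x` itself. It cancels the constant term of `v⁻¹` times the coefficient of `x` in `c`.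
    have h1 : ∑ z ∈ cs.descentSupport i c, ((cs.heckeBasis.repr c z).coeff 1 •
        cs.heckeBasis.repr (C z) x - if x = z then
          LaurentPolynomial.C ((cs.heckeBasis.repr c z).coeff 1) else 0) ∈ strictlyPositive := by
      apply sum_mem
      intro z hz
      have h2 := cs.isKLElement_iff.1 (hC' z hz).1
      split_ifs with h
      · rw [h, h2.2.1, zsmul_one, eq_intCast LaurentPolynomial.C, sub_self]
        exact zero_mem _
      · rw [sub_zero]
        exact zsmul_mem (h2.2.2 x h) _
    rw [Finset.sum_sub_distrib, Finset.sum_ite_eq] at h1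
    rw [hrepr]
    set tot := ∑ z ∈ cs.descentSupport i c,
      (cs.heckeBasis.repr c z).coeff 1 • cs.heckeBasis.repr (C z) x
    set δ : LaurentPolynomial ℤ := if x ∈ cs.descentSupport i c then
      LaurentPolynomial.C ((cs.heckeBasis.repr c x).coeff 1) else 0 with hδ
    have h2 : T (if cs.IsLeftDescent x i then -1 else 1) * cs.heckeBasis.repr c x - δ ∈
        strictlyPositive := by
      by_cases hd : cs.IsLeftDescent x i
      · rw [if_pos hd]
        have h3 : δ = LaurentPolynomial.C ((cs.heckeBasis.repr c x).coeff 1) := by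
          rw [hδ]
          split_ifs with h
          · rfl
          · have h4 : cs.heckeBasis.repr c x = 0 := by
              by_contra h4
              exact h (cs.mem_descentSupport.2 ⟨h4, hd⟩)
            simp [h4]
        rw [h3]
        apply LaurentPolynomial.T_neg_one_mul_sub_mem
        apply hpos
        rintro rfl
        exact hi hd
      · have h3 : δ = 0 := by
          rw [hδ, if_neg]
          rw [mem_descentSupport]
          exact fun h => hd h.2
        rw [if_neg hd, h3, sub_zero]
        apply LaurentPolynomial.T_one_mul_mem
        intro n hn
        by_cases hxy : x = y
        · rw [hxy, hone, ← LaurentPolynomial.T_zero, LaurentPolynomial.T_apply, if_neg hn.ne']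
        · exact hpos x hxy n hn.le
    have h3 : cs.heckeBasis.repr c (cs.simple i * x) +
        T (if cs.IsLeftDescent x i then -1 else 1) * cs.heckeBasis.repr c x - tot =
        cs.heckeBasis.repr c (cs.simple i * x) +
        (T (if cs.IsLeftDescent x i then -1 else 1) * cs.heckeBasis.repr c x - δ) - (tot - δ) := by
      ring
    rw [h3]
    exact sub_mem (add_mem (hpos _ (hne x hx)) h2) h1
  · intro x hx hlen
    have h1 := cs.length_simple_mul x i
    rw [hrepr, hlowsum x (by lia), hlow _ (hne x hx) (by lia), hlow x (by rintro rfl; lia) (by lia)]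
    simp

theorem isTriangularKL_one (cs : CoxeterSystem M W) : cs.IsTriangularKL 1 1 := by
  have h1 (y : W) (hy : y ≠ 1) : cs.heckeBasis.repr 1 y = 0 := by
    rw [← stdBasis_one, ← heckeBasis_apply, Module.Basis.repr_self, Finsupp.single_eq_of_ne hy]
  refine ⟨cs.isKLElement_iff.2 ⟨map_one _, ?_, fun y hy => ?_⟩, fun y hy _ => h1 y hy⟩
  · rw [← stdBasis_one, ← heckeBasis_apply, Module.Basis.repr_self, Finsupp.single_eq_same]
  · rw [h1 y hy]
    exact zero_mem _

theorem exists_isTriangularKL (cs : CoxeterSystem M W) (w : W) :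
    ∃ c, cs.IsTriangularKL w c := by
  classical
  induction hn : cs.length w using Nat.strong_induction_on generalizing w with
  | _ n ih =>
    by_cases hw : w = 1
    · exact ⟨1, hw ▸ cs.isTriangularKL_one⟩
    · obtain ⟨i, hi⟩ := cs.exists_leftDescent_of_ne_one hw
      have hi' : cs.length (cs.simple i * w) < n := hn ▸ hi
      obtain ⟨c, hc⟩ := ih _ hi' _ rfl
      choose! C hC using
        fun z (hz : cs.length z < n) => ih (cs.length z) hz z rfl
      have h := hc.step (cs.isLeftDescent_iff_not_isLeftDescent_mul.1 hi) (C := C)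
        fun z hz => hC z (hz.trans hi')
      rw [simple_mul_simple_cancel_left] at h
      exact ⟨_, h⟩

theorem isKLElement_klBasis (cs : CoxeterSystem M W) (w : W) :
    cs.IsKLElement w (cs.klBasis w) :=
  Classical.epsilon_spec ((cs.exists_isTriangularKL w).imp fun _ h => h.1)

theorem IsKLElement.eq_klBasis {cs : CoxeterSystem M W} {w : W} {c : cs.Hecke}
    (h : cs.IsKLElement w c) : c = cs.klBasis w :=
  h.unique (cs.isKLElement_klBasis w)

theorem isTriangularKL_klBasis (cs : CoxeterSystem M W) (w : W) :
    cs.IsTriangularKL w (cs.klBasis w) := by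
  obtain ⟨c, hc⟩ := cs.exists_isTriangularKL w
  rwa [← hc.1.eq_klBasis]

/-- The coefficient of `v` in the coefficient of `H_z` in the Kazhdan-Lusztig element of `y`. -/
noncomputable def klMu (cs : CoxeterSystem M W) (z y : W) : ℤ :=
  (cs.heckeBasis.repr (cs.klBasis y) z).coeff 1

theorem klBasis_simple (cs : CoxeterSystem M W) (i : B) :
    cs.klBasis (cs.simple i) = cs.klSimple i := by
  have h0 := cs.not_isLeftDescent_one i
  have h := cs.isTriangularKL_one.step h0 (C := 0) fun z hz => by simp at hz
  rw [Finset.sum_eq_zero, sub_zero, mul_one, mul_one] at h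
  · exact h.1.eq_klBasis.symm
  · intro z hz
    simp

/-- Multiplication by a Kazhdan-Lusztig generator, in the case of an increase of length. -/
theorem klSimple_mul_klBasis_of_not_isLeftDescent (cs : CoxeterSystem M W) {i : B} {y : W}
    (hi : ¬ cs.IsLeftDescent y i) : cs.klSimple i * cs.klBasis y =
      cs.klBasis (cs.simple i * y) +
        ∑ z ∈ cs.descentSupport i (cs.klBasis y), cs.klMu z y • cs.klBasis z := by
  have h := (cs.isTriangularKL_klBasis y).step hi fun z _ => cs.isTriangularKL_klBasis z
  rw [← h.1.eq_klBasis]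
  simp only [klMu]
  abel

/-- Multiplication by a Kazhdan-Lusztig generator, in the case of a decrease of length. -/
theorem klSimple_mul_klBasis_of_isLeftDescent (cs : CoxeterSystem M W) {i : B} {y : W}
    (hi : cs.IsLeftDescent y i) : cs.klSimple i * cs.klBasis y =
      (T 1 + T (-1) : LaurentPolynomial ℤ) • cs.klBasis y := by
  induction hn : cs.length y using Nat.strong_induction_on generalizing y with
  | _ n ih =>
    have hi' : cs.length (cs.simple i * y) < n := hn ▸ hi
    have h0 := cs.isLeftDescent_iff_not_isLeftDescent_mul.1 hi
    -- `C_y` is `C_s C_{sy}` minus shorter terms with the left descent `s`; the generator `C_s`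
    -- multiplies each of these by `v + v⁻¹`.
    have h1 := cs.klSimple_mul_klBasis_of_not_isLeftDescent h0
    rw [simple_mul_simple_cancel_left, ← sub_eq_iff_eq_add] at h1
    rw [← h1, mul_sub, ← mul_assoc, klSimple_mul_self, smul_sub, smul_mul_assoc, Finset.mul_sum,
      Finset.smul_sum]
    congr 1
    apply Finset.sum_congr rfl
    intro z hz
    have h2 := (cs.isTriangularKL_klBasis _).length_lt h0 hz
    rw [mul_smul_comm, ih _ (h2.trans hi') (cs.mem_descentSupport.1 hz).2 rfl, smul_comm]

/-- Read the eigenvector equation `C_s C_y = (v + v⁻¹) C_y` at `z`. -/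
theorem repr_klBasis_eq_T_mul (cs : CoxeterSystem M W) {i : B} {y z : W}
    (hy : cs.IsLeftDescent y i) (hz : ¬ cs.IsLeftDescent z i) :
    cs.heckeBasis.repr (cs.klBasis y) z =
      T 1 * cs.heckeBasis.repr (cs.klBasis y) (cs.simple i * z) := by
  classical
  have h := congrArg (fun h => cs.heckeBasis.repr h z) (cs.klSimple_mul_klBasis_of_isLeftDescent hy)
  simp only [repr_klSimple_mul, if_neg hz, map_smul, Finsupp.smul_apply, smul_eq_mul] at h
  have h1 : cs.heckeBasis.repr (cs.klBasis y) (cs.simple i * z) =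
      T (-1) * cs.heckeBasis.repr (cs.klBasis y) z := by linear_combination h
  rw [h1, ← mul_assoc, ← LaurentPolynomial.T_add, add_neg_cancel, LaurentPolynomial.T_zero, one_mul]

/-- If `t` is a left descent of `y`, but not of `z`, then `μ(z, y) ≠ 0` forces `y = t z`. -/
theorem eq_simple_mul_of_klMu_ne_zero (cs : CoxeterSystem M W) {i : B} {y z : W}
    (hy : cs.IsLeftDescent y i) (hz : ¬ cs.IsLeftDescent z i) (h : cs.klMu z y ≠ 0) :
    cs.simple i * z = y := by
  by_contra h1
  apply h
  -- If `tz ≠ y`, the coefficient at `tz` has no constant term, so `v` times it has no linear term.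
  rw [klMu, cs.repr_klBasis_eq_T_mul hy hz, LaurentPolynomial.coeff_T_mul]
  exact (cs.isKLElement_iff.1 (cs.isKLElement_klBasis y)).2.2 _ h1 _ (by simp)

theorem klMu_simple_mul (cs : CoxeterSystem M W) {i : B} {y : W} (hy : cs.IsLeftDescent y i) :
    cs.klMu (cs.simple i * y) y = 1 := by
  rw [klMu, cs.repr_klBasis_eq_T_mul hy (cs.isLeftDescent_iff_not_isLeftDescent_mul.1 hy),
    simple_mul_simple_cancel_left, (cs.isKLElement_iff.1 (cs.isKLElement_klBasis y)).2.1, mul_one,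
    LaurentPolynomial.T_apply, if_pos rfl]

theorem repr_klBasis_self (cs : CoxeterSystem M W) (w : W) :
    cs.heckeBasis.repr (cs.klBasis w) w = 1 :=
  (cs.isKLElement_iff.1 (cs.isKLElement_klBasis w)).2.1

theorem linearIndependent_klBasis (cs : CoxeterSystem M W) :
    LinearIndependent (LaurentPolynomial ℤ) cs.klBasis := by
  rw [linearIndependent_iff]
  intro l hl
  by_contra h0
  obtain ⟨y, hy, hmax⟩ := Finset.exists_max_image _ cs.length (Finsupp.support_nonempty_iff.2 h0)
  apply Finsupp.mem_support_iff.1 hy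
  have h1 := congrArg (fun h => cs.heckeBasis.repr h y) hl
  simp only [map_zero, Finsupp.zero_apply] at h1
  rw [Finsupp.linearCombination_apply, Finsupp.sum, map_sum, Finsupp.finsetSum_apply,
    Finset.sum_eq_single_of_mem y hy, map_smul, Finsupp.smul_apply, repr_klBasis_self, smul_eq_mul,
    mul_one] at h1
  · exact h1
  · intro z hz hzy
    rw [map_smul, Finsupp.smul_apply,
      (cs.isTriangularKL_klBasis z).2 y hzy.symm (hmax z hz), smul_zero]

theorem span_klBasis (cs : CoxeterSystem M W) :
    Submodule.span (LaurentPolynomial ℤ) (Set.range cs.klBasis) = ⊤ := by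
  classical
  rw [eq_top_iff, ← cs.span_stdBasis, Submodule.span_le]
  rintro _ ⟨w, rfl⟩
  induction hn : cs.length w using Nat.strong_induction_on generalizing w with
  | _ n ih =>
    have h1 : cs.klBasis w = ∑ y ∈ (cs.heckeBasis.repr (cs.klBasis w)).support,
        cs.heckeBasis.repr (cs.klBasis w) y • cs.stdBasis y := by
      conv_lhs => rw [← cs.heckeBasis.linearCombination_repr (cs.klBasis w),
        Finsupp.linearCombination_apply, Finsupp.sum]
      simp
    have h2 : w ∈ (cs.heckeBasis.repr (cs.klBasis w)).support := by
      rw [Finsupp.mem_support_iff, repr_klBasis_self]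
      exact one_ne_zero
    rw [← Finset.add_sum_erase _ _ h2, repr_klBasis_self, one_smul, ← sub_eq_iff_eq_add] at h1
    rw [← h1]
    apply Submodule.sub_mem
    · exact Submodule.subset_span (Set.mem_range_self w)
    · apply Submodule.sum_mem
      intro y hy
      rw [Finset.mem_erase, Finsupp.mem_support_iff] at hy
      apply Submodule.smul_mem
      refine ih _ ?_ y rfl
      by_contra h3
      exact hy.2 ((cs.isTriangularKL_klBasis w).2 y hy.1 (by lia))

/-- The Kazhdan-Lusztig basis as a basis of the Hecke algebra. -/
noncomputable def klModuleBasis (cs : CoxeterSystem M W) :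
    Module.Basis W (LaurentPolynomial ℤ) cs.Hecke :=
  Module.Basis.mk cs.linearIndependent_klBasis cs.span_klBasis.ge

@[simp] theorem klModuleBasis_apply (cs : CoxeterSystem M W) (w : W) :
    cs.klModuleBasis w = cs.klBasis w :=
  Module.Basis.mk_apply _ _ w

theorem appearsIn_iff (cs : CoxeterSystem M W) {y : W} {h : cs.Hecke} :
    cs.AppearsIn y h ↔ cs.klModuleBasis.repr h y ≠ 0 := by
  have h0 : (cs.klModuleBasis : W → cs.Hecke) = cs.klBasis := funext cs.klModuleBasis_apply
  unfold AppearsIn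
  rw [← h0]
  constructor
  · rintro ⟨f, rfl, hf⟩
    rwa [Module.Basis.repr_linearCombination]
  · intro hy
    exact ⟨_, (cs.klModuleBasis.linearCombination_repr h).symm, hy⟩

/-! ### The anti-automorphism `H_w ↦ H_{w⁻¹}` -/

/-- The anti-automorphism `H_w ↦ H_{w⁻¹}` as a homomorphism to the opposite algebra. -/
noncomputable def flipAlgHom (cs : CoxeterSystem M W) :
    cs.Hecke →ₐ[LaurentPolynomial ℤ] cs.Heckeᵐᵒᵖ :=
  RingQuot.liftAlgHom (LaurentPolynomial ℤ)
    ⟨FreeAlgebra.lift (LaurentPolynomial ℤ) fun w => MulOpposite.op (cs.stdBasis w⁻¹), by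
      intro a b hab
      cases hab with
      | one => rw [FreeAlgebra.lift_ι_apply, map_one, inv_one, stdBasis_one, MulOpposite.op_one]
      | mul x y h =>
        rw [map_mul, FreeAlgebra.lift_ι_apply, FreeAlgebra.lift_ι_apply, FreeAlgebra.lift_ι_apply,
          ← MulOpposite.op_mul, stdBasis_mul, mul_inv_rev]
        rw [← mul_inv_rev, length_inv, length_inv, length_inv, h, add_comm]
      | quad i =>
        rw [map_mul, map_add, map_one, map_smul, FreeAlgebra.lift_ι_apply, ← MulOpposite.op_mul,
          inv_simple, stdBasis_simple_sq, MulOpposite.op_add, MulOpposite.op_one,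
          MulOpposite.op_smul]⟩

/-- The anti-automorphism `H_w ↦ H_{w⁻¹}` as a linear map. -/
noncomputable def flip (cs : CoxeterSystem M W) :
    cs.Hecke →ₗ[LaurentPolynomial ℤ] cs.Hecke :=
  (MulOpposite.opLinearEquiv (LaurentPolynomial ℤ)).symm.toLinearMap.comp cs.flipAlgHom.toLinearMap

theorem flip_stdBasis (cs : CoxeterSystem M W) (w : W) :
    cs.flip (cs.stdBasis w) = cs.stdBasis w⁻¹ := by
  have h : cs.flipAlgHom (cs.stdBasis w) = MulOpposite.op (cs.stdBasis w⁻¹) :=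
    (RingQuot.liftAlgHom_mkAlgHom_apply (LaurentPolynomial ℤ) _ _ _).trans
      (FreeAlgebra.lift_ι_apply _ _)
  exact congrArg MulOpposite.unop h

theorem flip_mul (cs : CoxeterSystem M W) (a b : cs.Hecke) :
    cs.flip (a * b) = cs.flip b * cs.flip a :=
  congrArg MulOpposite.unop (map_mul cs.flipAlgHom a b)

theorem flip_one (cs : CoxeterSystem M W) : cs.flip 1 = 1 := by
  rw [← stdBasis_one, flip_stdBasis, inv_one]

theorem flip_flip (cs : CoxeterSystem M W) (a : cs.Hecke) : cs.flip (cs.flip a) = a := by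
  have h : cs.flip ∘ₗ cs.flip = LinearMap.id :=
    cs.heckeBasis.ext fun w => by simp [flip_stdBasis]
  exact LinearMap.congr_fun h a

theorem repr_flip (cs : CoxeterSystem M W) (a : cs.Hecke) (w : W) :
    cs.heckeBasis.repr (cs.flip a) w = cs.heckeBasis.repr a w⁻¹ := by
  classical
  have h : cs.heckeBasis.coord w ∘ₗ cs.flip = cs.heckeBasis.coord w⁻¹ := by
    apply cs.heckeBasis.ext
    intro y
    rw [LinearMap.comp_apply, heckeBasis_apply, flip_stdBasis, Module.Basis.coord_apply,
      Module.Basis.coord_apply, ← heckeBasis_apply, ← heckeBasis_apply, Module.Basis.repr_self,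
      Module.Basis.repr_self, Finsupp.single_apply, Finsupp.single_apply]
    simp only [inv_eq_iff_eq_inv]
  exact LinearMap.congr_fun h a

theorem flip_inverse_of_isUnit (cs : CoxeterSystem M W) {a : cs.Hecke} (ha : IsUnit a) :
    cs.flip (Ring.inverse a) = Ring.inverse (cs.flip a) := by
  obtain ⟨u, rfl⟩ := ha
  rw [Ring.inverse_unit]
  exact (Ring.inverse_unit (⟨cs.flip u, cs.flip ↑u⁻¹, by rw [← flip_mul, u.inv_mul, flip_one],
    by rw [← flip_mul, u.mul_inv, flip_one]⟩ : cs.Heckeˣ)).symm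

theorem bar_flip (cs : CoxeterSystem M W) (a : cs.Hecke) :
    cs.bar (cs.flip a) = cs.flip (cs.bar a) := by
  have h1 : a ∈ Submodule.span (LaurentPolynomial ℤ) (Set.range cs.stdBasis) := by
    rw [span_stdBasis]
    exact Submodule.mem_top
  induction h1 using Submodule.span_induction with
  | mem x hx =>
    obtain ⟨y, rfl⟩ := hx
    rw [flip_stdBasis, bar_stdBasis, bar_stdBasis,
      flip_inverse_of_isUnit _ (cs.isUnit_stdBasis _), flip_stdBasis]
  | zero => simp
  | add x y _ _ hx hy => simp only [map_add, hx, hy]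
  | smul c x _ hx => rw [map_smul, bar_smul, bar_smul, map_smul, hx]

theorem flip_klBasis (cs : CoxeterSystem M W) (w : W) :
    cs.flip (cs.klBasis w) = cs.klBasis w⁻¹ := by
  obtain ⟨h1, h2, h3⟩ := cs.isKLElement_iff.1 (cs.isKLElement_klBasis w)
  refine IsKLElement.eq_klBasis (cs.isKLElement_iff.2 ⟨?_, ?_, fun y hy => ?_⟩)
  · rw [bar_flip, h1]
  · rw [repr_flip, inv_inv, h2]
  · rw [repr_flip]
    exact h3 _ fun h => hy (by rw [← h, inv_inv])

theorem klRepr_flip (cs : CoxeterSystem M W) (a : cs.Hecke) (w : W) :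
    cs.klModuleBasis.repr (cs.flip a) w = cs.klModuleBasis.repr a w⁻¹ := by
  classical
  have h : cs.klModuleBasis.coord w ∘ₗ cs.flip = cs.klModuleBasis.coord w⁻¹ := by
    apply cs.klModuleBasis.ext
    intro y
    rw [LinearMap.comp_apply, klModuleBasis_apply, flip_klBasis, Module.Basis.coord_apply,
      Module.Basis.coord_apply, ← klModuleBasis_apply, ← klModuleBasis_apply,
      Module.Basis.repr_self, Module.Basis.repr_self, Finsupp.single_apply, Finsupp.single_apply]
    simp only [inv_eq_iff_eq_inv]
  exact LinearMap.congr_fun h a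

/-- `flip` reverses products and sends `C_w` to `C_{w⁻¹}`, so right cells are the inverses of left
cells. -/
theorem rightLE_iff (cs : CoxeterSystem M W) {x y : W} :
    cs.RightLE x y ↔ cs.LeftLE x⁻¹ y⁻¹ := by
  have h (w : W) : cs.AppearsIn y (cs.klBasis x * cs.klBasis w) ↔
      cs.AppearsIn y⁻¹ (cs.klBasis w⁻¹ * cs.klBasis x⁻¹) := by
    rw [appearsIn_iff, appearsIn_iff, ← flip_klBasis, ← flip_klBasis, ← flip_mul, klRepr_flip,
      inv_inv]
  constructor
  · rintro ⟨w, hw⟩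
    exact ⟨w⁻¹, (h w).1 hw⟩
  · rintro ⟨w, hw⟩
    exact ⟨w⁻¹, (h w⁻¹).2 (by rwa [inv_inv])⟩

/-- In the left preorder, the factor `C_w` may be replaced by an arbitrary element. -/
theorem leftLE_iff (cs : CoxeterSystem M W) {x y : W} :
    cs.LeftLE x y ↔ ∃ h, cs.klModuleBasis.repr (h * cs.klBasis x) y ≠ 0 := by
  constructor
  · rintro ⟨w, hw⟩
    exact ⟨_, cs.appearsIn_iff.1 hw⟩
  · rintro ⟨h, hh⟩
    by_contra h0
    apply hh
    have h1 : ∀ w, cs.klModuleBasis.repr (cs.klBasis w * cs.klBasis x) y = 0 := by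
      intro w
      by_contra h2
      exact h0 ⟨w, cs.appearsIn_iff.2 h2⟩
    have h3 : cs.klModuleBasis.coord y ∘ₗ LinearMap.mulRight (LaurentPolynomial ℤ) (cs.klBasis x)
        = 0 := cs.klModuleBasis.ext fun w => by simp [h1]
    exact LinearMap.congr_fun h3 h

end CoxeterSystem

/-! ### The cells of simple reflections -/

namespace CoxeterSystem

open LaurentPolynomial (T strictlyPositive)

variable {B W : Type*} [Group W] {M : CoxeterMatrix B}

open Classical in
theorem klRepr_klBasis (cs : CoxeterSystem M W) (y z : W) :
    cs.klModuleBasis.repr (cs.klBasis y) z = if z = y then 1 else 0 := by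
  rw [← klModuleBasis_apply, Module.Basis.repr_self, Finsupp.single_apply]
  simp only [eq_comm]

open Classical in
theorem klRepr_klSimple_mul_of_isLeftDescent (cs : CoxeterSystem M W) {i : B} {y : W}
    (hi : cs.IsLeftDescent y i) (z : W) :
    cs.klModuleBasis.repr (cs.klSimple i * cs.klBasis y) z =
      if z = y then T 1 + T (-1) else 0 := by
  rw [klSimple_mul_klBasis_of_isLeftDescent _ hi, map_smul, Finsupp.smul_apply, klRepr_klBasis,
    smul_eq_mul, mul_ite, mul_one, mul_zero]

open Classical in
theorem klRepr_klSimple_mul_of_not_isLeftDescent (cs : CoxeterSystem M W) {i : B} {y : W}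
    (hi : ¬ cs.IsLeftDescent y i) (z : W) :
    cs.klModuleBasis.repr (cs.klSimple i * cs.klBasis y) z =
      (if z = cs.simple i * y then 1 else 0) +
        if z ∈ cs.descentSupport i (cs.klBasis y) then (cs.klMu z y : LaurentPolynomial ℤ) else 0 := by
  rw [klSimple_mul_klBasis_of_not_isLeftDescent _ hi, map_add, Finsupp.add_apply, klRepr_klBasis,
    map_sum, Finsupp.finsetSum_apply]
  congr 1
  simp only [map_zsmul, Finsupp.smul_apply, klRepr_klBasis, smul_ite, zsmul_one, smul_zero]
  rw [Finset.sum_ite_eq]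

theorem klRepr_mul (cs : CoxeterSystem M W) (a h : cs.Hecke) (z : W) :
    cs.klModuleBasis.repr (a * h) z = ∑ y ∈ (cs.klModuleBasis.repr h).support,
      cs.klModuleBasis.repr h y * cs.klModuleBasis.repr (a * cs.klBasis y) z := by
  conv_lhs => rw [← cs.klModuleBasis.linearCombination_repr h, Finsupp.linearCombination_apply,
    Finsupp.sum, Finset.mul_sum, map_sum, Finsupp.finsetSum_apply]
  simp

/-- In each case of the multiplication formula, the elements that occur in `C_s C_y` have the left
descent `s`: `y` itself, or `sy` and the members of `descentSupport`. -/
theorem isLeftDescent_of_klRepr_klSimple_mul_ne_zero (cs : CoxeterSystem M W) {i : B}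
    {h : cs.Hecke} {z : W} (hz : cs.klModuleBasis.repr (cs.klSimple i * h) z ≠ 0) :
    cs.IsLeftDescent z i := by
  classical
  by_contra h0
  apply hz
  rw [klRepr_mul]
  apply Finset.sum_eq_zero
  intro y _
  by_cases hy : cs.IsLeftDescent y i
  · rw [klRepr_klSimple_mul_of_isLeftDescent _ hy, if_neg, mul_zero]
    rintro rfl
    exact h0 hy
  · rw [klRepr_klSimple_mul_of_not_isLeftDescent _ hy, if_neg, if_neg, add_zero, mul_zero]
    · rw [mem_descentSupport]
      exact fun h => h0 h.2
    · rintro rfl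
      apply h0
      rw [isLeftDescent_iff_not_isLeftDescent_mul, simple_mul_simple_cancel_left]
      exact hy

/-- Coefficients at rigid elements vanish in `C_s C_y` for `y` that is not rigid. -/
theorem klRepr_klSimple_mul_eq_zero (cs : CoxeterSystem M W) {i : B} {y z : W}
    (hy : ¬ cs.IsRigid y) (hz : cs.IsRigid z) :
    cs.klModuleBasis.repr (cs.klSimple i * cs.klBasis y) z = 0 := by
  classical
  by_cases hi : cs.IsLeftDescent y i
  · rw [klRepr_klSimple_mul_of_isLeftDescent _ hi, if_neg]
    rintro rfl
    exact hy hz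
  · rw [klRepr_klSimple_mul_of_not_isLeftDescent _ hi, if_neg, zero_add]
    · split_ifs with hmem
      · suffices hmu : cs.klMu z y = 0 by rw [hmu, Int.cast_zero]
        by_contra hmu
        have hzi := (cs.mem_descentSupport.1 hmem).2
        -- The only left descent of the rigid `z` is `i`, which is not a descent of `y`. Hence no
        -- left descent `t` of `y` is one of `z`, and `μ ≠ 0` forces `y = tz`. So `y` has a single
        -- left descent `t` with `ty = z` rigid, and would be rigid itself.
        have key (t : B) (ht : cs.IsLeftDescent y t) : cs.simple t * z = y := by
          apply cs.eq_simple_mul_of_klMu_ne_zero ht _ hmu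
          intro htz
          obtain rfl := hz.leftDescent_unique htz hzi
          exact hi ht
        have hy1 : y ≠ 1 := by
          rintro rfl
          exact hy cs.isRigid_one
        obtain ⟨t, ht⟩ := cs.exists_leftDescent_of_ne_one hy1
        apply hy
        apply isRigid_of_leftDescent_unique (a := t)
        · rwa [← key t ht, simple_mul_simple_cancel_left]
        · intro b hb
          have h1 := (key b hb).trans (key t ht).symm
          exact cs.simple_injective (mul_right_cancel h1)
      · rfl
    · rintro rfl
      exact hy (hz.of_cons hi)

/-- The elements of the Kazhdan-Lusztig basis of the non-rigid elements span a left ideal. -/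
theorem klRepr_mul_klBasis_eq_zero (cs : CoxeterSystem M W) (h : cs.Hecke) {y z : W}
    (hy : ¬ cs.IsRigid y) (hz : cs.IsRigid z) :
    cs.klModuleBasis.repr (h * cs.klBasis y) z = 0 := by
  classical
  let N : Submodule (LaurentPolynomial ℤ) cs.Hecke :=
    ⨅ z ∈ {z | cs.IsRigid z}, LinearMap.ker (cs.klModuleBasis.coord z)
  have hN (h : cs.Hecke) : h ∈ N ↔ ∀ z, cs.IsRigid z → cs.klModuleBasis.repr h z = 0 := by
    simp [N, Submodule.mem_iInf]
  refine (hN _).1 ?_ z hz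
  apply cs.mem_of_stdBasis_simple_mul_mem
  · intro i a ha
    have h1 : cs.stdBasis (cs.simple i) * a = cs.klSimple i * a -
        (T 1 : LaurentPolynomial ℤ) • a := by
      rw [klSimple, add_mul, ← Algebra.smul_def, add_sub_cancel_right]
    rw [h1]
    refine N.sub_mem ((hN _).2 fun z hz => ?_) (N.smul_mem _ ha)
    rw [klRepr_mul]
    apply Finset.sum_eq_zero
    intro x _
    by_cases hx : cs.IsRigid x
    · rw [(hN a).1 ha x hx, zero_mul]
    · rw [cs.klRepr_klSimple_mul_eq_zero hx hz, mul_zero]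
  · rw [hN]
    intro z hz
    rw [klRepr_klBasis, if_neg]
    rintro rfl
    exact hy hz

/-! ### Nonnegativity at `v = 1` and the resulting description of the cells -/

/-- Evaluation of Laurent polynomials at `v = 1`. -/
noncomputable def evalOne : LaurentPolynomial ℤ →+* ℤ :=
  LaurentPolynomial.eval₂ (RingHom.id ℤ) 1

theorem evalOne_T (n : ℤ) : evalOne (T n) = 1 := by
  simp [evalOne]

/-- A nonzero `μ(z, y)` occurs here only for `z = ty` with `t` a left descent of `y`, where it is
`1`. General positivity of Kazhdan–Lusztig polynomials is not needed. -/
theorem IsRigid.klMu_nonneg {cs : CoxeterSystem M W} {i : B} {y z : W} (hz : cs.IsRigid z)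
    (hi : ¬ cs.IsLeftDescent y i) (hmem : z ∈ cs.descentSupport i (cs.klBasis y)) :
    0 ≤ cs.klMu z y := by
  by_cases h0 : cs.klMu z y = 0
  · exact h0.ge
  have hzi := (cs.mem_descentSupport.1 hmem).2
  have hlt := (cs.isTriangularKL_klBasis y).length_lt hi hmem
  have hy1 : y ≠ 1 := by
    rintro rfl
    simp at hlt
  obtain ⟨t, ht⟩ := cs.exists_leftDescent_of_ne_one hy1
  have h1 : cs.simple t * z = y := by
    apply cs.eq_simple_mul_of_klMu_ne_zero ht _ h0
    intro htz
    obtain rfl := hz.leftDescent_unique htz hzi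
    exact hi ht
  have h2 : z = cs.simple t * y := by rw [← h1, simple_mul_simple_cancel_left]
  rw [h2, cs.klMu_simple_mul ht]
  exact zero_le_one

theorem evalOne_klRepr_klSimple_mul_nonneg (cs : CoxeterSystem M W) (i : B) (y : W) {z : W}
    (hz : cs.IsRigid z) :
    0 ≤ evalOne (cs.klModuleBasis.repr (cs.klSimple i * cs.klBasis y) z) := by
  classical
  by_cases hi : cs.IsLeftDescent y i
  · rw [klRepr_klSimple_mul_of_isLeftDescent _ hi]
    split_ifs <;> simp [evalOne_T]
  · rw [klRepr_klSimple_mul_of_not_isLeftDescent _ hi, map_add]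
    apply add_nonneg
    · split_ifs <;> simp
    · split_ifs with h
      · rw [map_intCast, Int.cast_id]
        exact hz.klMu_nonneg hi h
      · simp

/-- The step that strips the first letter `t` of `x`: the next letter `i` is not a descent of `x`,
so `C_{tx}` occurs in `C_i C_x` through `μ(tx, x) = 1`. -/
theorem evalOne_klRepr_klSimple_mul_pos (cs : CoxeterSystem M W) {i t : B} {x : W}
    (hx : cs.IsRigid x) (ht : cs.IsLeftDescent x t) (hi : cs.IsLeftDescent (cs.simple t * x) i) :
    0 < evalOne (cs.klModuleBasis.repr (cs.klSimple i * cs.klBasis x) (cs.simple t * x)) := by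
  classical
  have hix : ¬ cs.IsLeftDescent x i := by
    intro h
    obtain rfl := hx.leftDescent_unique h ht
    exact cs.isLeftDescent_iff_not_isLeftDescent_mul.1 h hi
  have hmu := cs.klMu_simple_mul ht
  have hmem : cs.simple t * x ∈ cs.descentSupport i (cs.klBasis x) := by
    rw [mem_descentSupport]
    refine ⟨fun h => ?_, hi⟩
    rw [klMu, h] at hmu
    simp at hmu
  rw [klRepr_klSimple_mul_of_not_isLeftDescent _ hix, if_pos hmem, hmu, map_add, Int.cast_one,
    map_one]
  split_ifs <;> simp

/-- Induction on `ℓ(x)`: multiplication by `C_r`, with `r` the second letter of `x`, moves a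
positive coefficient from `x` to the element without its first letter. Nonnegativity at all rigid
elements excludes cancellation and is preserved, because non-rigid elements contribute nothing to
rigid ones. The process stops at the last letter `i`. -/
theorem exists_evalOne_klRepr_pos (cs : CoxeterSystem M W) {i : B} {x : W} {a : cs.Hecke}
    (hx : cs.IsRigid x) (hxi : cs.IsRightDescent x i)
    (ha : ∀ z, cs.IsRigid z → 0 ≤ evalOne (cs.klModuleBasis.repr a z))
    (hax : 0 < evalOne (cs.klModuleBasis.repr a x)) :
    ∃ b, 0 < evalOne (cs.klModuleBasis.repr (b * a) (cs.simple i)) := by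
  induction hn : cs.length x using Nat.strong_induction_on generalizing x a with
  | _ n ih =>
    have hx1 : x ≠ 1 := by
      rintro rfl
      exact cs.not_isRightDescent_one i hxi
    obtain ⟨t, ht⟩ := cs.exists_leftDescent_of_ne_one hx1
    by_cases hy1 : cs.simple t * x = 1
    · have h1 : x = cs.simple t := by
        rw [mul_eq_one_iff_eq_inv', inv_simple] at hy1
        exact hy1
      have h2 : i = t := by
        rw [h1, IsRightDescent, length_simple, Nat.lt_one_iff, length_eq_zero_iff,
          mul_eq_one_iff_eq_inv', inv_simple] at hxi
        exact cs.simple_injective hxi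
      exact ⟨1, by rwa [one_mul, h2, ← h1]⟩
    · obtain ⟨r, hr⟩ := cs.exists_leftDescent_of_ne_one hy1
      have hexp (z : W) : evalOne (cs.klModuleBasis.repr (cs.klSimple r * a) z) =
          ∑ y ∈ (cs.klModuleBasis.repr a).support, evalOne (cs.klModuleBasis.repr a y) *
            evalOne (cs.klModuleBasis.repr (cs.klSimple r * cs.klBasis y) z) := by
        rw [klRepr_mul, map_sum]
        exact Finset.sum_congr rfl fun y _ => map_mul _ _ _
      have hterm (z : W) (hz : cs.IsRigid z) (y : W) : 0 ≤ evalOne (cs.klModuleBasis.repr a y) *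
            evalOne (cs.klModuleBasis.repr (cs.klSimple r * cs.klBasis y) z) := by
        by_cases hy : cs.IsRigid y
        · exact mul_nonneg (ha y hy) (cs.evalOne_klRepr_klSimple_mul_nonneg r y hz)
        · rw [cs.klRepr_klSimple_mul_eq_zero hy hz, map_zero, mul_zero]
      -- The last letter survives. Otherwise `tx = xi`, and for a reduced word `ω` of `tx` both `t
      -- :: ω` and `ω ++ [i]` are reduced expressions of `x`. They are equal, so `ω` begins with
      -- `t`, against the reducedness of `t :: ω`.
      have hrd : cs.IsRightDescent (cs.simple t * x) i := by
        by_contra h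
        rw [not_isRightDescent_iff] at h
        have h1 := cs.isRightDescent_iff.1 hxi
        have h2 := cs.isLeftDescent_iff.1 ht
        have h3 := cs.simple_mul_eq_mul_simple (w := x) (i := t) (j := i) (by lia) (by lia)
        rw [h3, simple_mul_simple_cancel_right] at h
        have h4 : x * cs.simple i ≠ 1 := h3 ▸ hy1
        have h5 : cs.length (cs.simple t * x) ≠ 0 := by
          rw [ne_eq, length_eq_zero_iff]
          exact hy1
        obtain ⟨ω, hω, h6⟩ := cs.exists_isReduced (cs.simple t * x)
        have h7 : cs.IsReduced (t :: ω) := by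
          rw [IsReduced, wordProd_cons, ← h6, simple_mul_simple_cancel_left, List.length_cons,
            ← hω.eq, ← h6, h2]
        have h8 : cs.IsReduced (ω ++ [i]) := by
          rw [IsReduced, wordProd_append, wordProd_singleton, ← h6, h3,
            simple_mul_simple_cancel_right, List.length_append, ← hω.eq, ← h6, h3]
          simp [h1]
        have h9 := hx _ _ h7 h8 (by rw [wordProd_cons, ← h6, simple_mul_simple_cancel_left])
          (by rw [wordProd_append, wordProd_singleton, ← h6, h3, simple_mul_simple_cancel_right])
        cases ω with
        | nil =>
          rw [wordProd_nil] at h6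
          exact hy1 h6
        | cons b ω =>
          rw [List.cons_append] at h9
          obtain rfl := (List.cons.inj h9).1
          exact cs.isLeftDescent_iff_not_isLeftDescent_mul.1 ht (h6 ▸ hω.isLeftDescent_head)
      obtain ⟨b, hb⟩ := ih _ (hn ▸ ht) (a := cs.klSimple r * a) (hx.simple_mul ht) hrd
        (fun z hz => by
          rw [hexp]
          exact Finset.sum_nonneg fun y _ => hterm z hz y)
        (by
          rw [hexp]
          have hmem : x ∈ (cs.klModuleBasis.repr a).support := by
            rw [Finsupp.mem_support_iff]
            intro h
            rw [h, map_zero] at hax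
            exact lt_irrefl _ hax
          refine lt_of_lt_of_le ?_ (Finset.single_le_sum
            (fun y _ => hterm _ (hx.simple_mul ht) y) hmem)
          exact mul_pos hax (cs.evalOne_klRepr_klSimple_mul_pos hx ht hr)) rfl
      exact ⟨b * cs.klSimple r, by rwa [mul_assoc]⟩

/-- After `flip` the product `h C_s` becomes `C_s h'`, in which only left descents `s` occur.
Conversely `C_x C_s = (v + v⁻¹) C_x`, whose coefficient is `2` at `v = 1`. -/
theorem simple_leftLE_iff (cs : CoxeterSystem M W) {i : B} {x : W} :
    cs.LeftLE (cs.simple i) x ↔ cs.IsRightDescent x i := by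
  classical
  rw [leftLE_iff, ← isLeftDescent_inv_iff]
  constructor
  · rintro ⟨h, hh⟩
    apply cs.isLeftDescent_of_klRepr_klSimple_mul_ne_zero (h := cs.flip h)
    rwa [← klBasis_simple, ← inv_simple, ← flip_klBasis, ← flip_mul, klRepr_flip, inv_inv]
  · intro hx
    refine ⟨cs.klBasis x, ?_⟩
    rw [← flip_flip cs (cs.klBasis x * cs.klBasis (cs.simple i)), flip_mul, flip_klBasis,
      flip_klBasis, inv_simple, klRepr_flip, klBasis_simple,
      klRepr_klSimple_mul_of_isLeftDescent _ hx, if_pos rfl]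
    intro h
    have h1 := congrArg evalOne h
    simp [evalOne_T] at h1

theorem leftLE_simple_iff (cs : CoxeterSystem M W) {i : B} {x : W} (hx : cs.IsRightDescent x i) :
    cs.LeftLE x (cs.simple i) ↔ cs.IsRigid x := by
  classical
  rw [leftLE_iff]
  constructor
  · rintro ⟨h, hh⟩
    by_contra h0
    exact hh (cs.klRepr_mul_klBasis_eq_zero h h0 (cs.isRigid_simple i))
  · intro h
    obtain ⟨b, hb⟩ := cs.exists_evalOne_klRepr_pos (a := cs.klBasis x) h hx
      (fun z _ => by rw [klRepr_klBasis]; split_ifs <;> simp)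
      (by rw [klRepr_klBasis, if_pos rfl]; simp)
    refine ⟨b, fun h1 => ?_⟩
    rw [h1, map_zero] at hb
    exact lt_irrefl _ hb

/-- The left cell of a simple reflection `s` consists of the elements with a unique reduced
expression that ends with `s`. -/
theorem mem_leftCell_iff (cs : CoxeterSystem M W) {i : B} {x : W} :
    x ∈ cs.leftCell i ↔ cs.IsRigid x ∧ cs.IsRightDescent x i := by
  constructor
  · rintro ⟨h1, h2⟩
    have h3 := cs.simple_leftLE_iff.1 h2
    exact ⟨(cs.leftLE_simple_iff h3).1 h1, h3⟩
  · rintro ⟨h1, h2⟩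
    exact ⟨(cs.leftLE_simple_iff h2).2 h1, cs.simple_leftLE_iff.2 h2⟩

/-- The right cell of a simple reflection `s` consists of the elements with a unique reduced
expression that begins with `s`. -/
theorem mem_rightCell_iff (cs : CoxeterSystem M W) {i : B} {x : W} :
    x ∈ cs.rightCell i ↔ cs.IsRigid x ∧ cs.IsLeftDescent x i := by
  have h : x ∈ cs.rightCell i ↔ x⁻¹ ∈ cs.leftCell i := by
    simp only [rightCell, leftCell, Set.mem_ofPred_eq, rightLE_iff, inv_simple]
  rw [h, mem_leftCell_iff, isRigid_inv_iff, isRightDescent_inv_iff]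

/-- The intersection of a left cell and a right cell of simple reflections consists of the products
of the rigid words with the given first and last letters. -/
theorem mem_leftCell_inter_rightCell_iff (cs : CoxeterSystem M W) {p q : B} {x : W} :
    x ∈ cs.leftCell p ∩ cs.rightCell q ↔
      ∃ ω, IsRigidWord M ω ∧ ω.head? = some q ∧ ω.getLast? = some p ∧ cs.wordProd ω = x := by
  rw [Set.mem_inter_iff, mem_leftCell_iff, mem_rightCell_iff]
  constructor
  · rintro ⟨⟨h1, h2⟩, -, h3⟩
    obtain ⟨ω, hω, rfl⟩ := cs.exists_isReduced x
    refine ⟨ω, h1.isRigidWord hω, ?_, ?_, rfl⟩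
    · cases ω with
      | nil => exact absurd h3 (by simpa using cs.not_isLeftDescent_one q)
      | cons a ω =>
        rw [h1.leftDescent_unique h3 hω.isLeftDescent_head]
        rfl
    · rw [← isLeftDescent_inv_iff, ← wordProd_reverse] at h2
      rw [← isRigid_inv_iff, ← wordProd_reverse] at h1
      rw [← List.head?_reverse]
      have h4 := hω.reverse
      generalize ω.reverse = ω' at *
      cases ω' with
      | nil => exact absurd h2 (by simpa using cs.not_isLeftDescent_one p)
      | cons a ω =>
        rw [h1.leftDescent_unique h2 h4.isLeftDescent_head]
        rfl
  · rintro ⟨ω, h1, h2, h3, rfl⟩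
    obtain ⟨h4, h5⟩ := h1.isReduced_and_isRigid cs
    have h6 : cs.IsLeftDescent (cs.wordProd ω) q := by
      cases ω with
      | nil => simp at h2
      | cons a ω =>
        obtain rfl : a = q := by simpa using h2
        exact h4.isLeftDescent_head
    have h7 : cs.IsRightDescent (cs.wordProd ω) p := by
      rw [← isLeftDescent_inv_iff, ← wordProd_reverse]
      rw [← List.head?_reverse] at h3
      have h4 := h4.reverse
      generalize ω.reverse = ω' at *
      cases ω' with
      | nil => simp at h3
      | cons a ω =>
        obtain rfl : a = p := by simpa using h3
        exact h4.isLeftDescent_head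
    exact ⟨⟨h5, h7⟩, h5, h6⟩

theorem IsRigidWord.eq_of_wordProd_eq (cs : CoxeterSystem M W) {ω ω' : List B}
    (h : IsRigidWord M ω) (h' : IsRigidWord M ω') (heq : cs.wordProd ω = cs.wordProd ω') :
    ω = ω' :=
  (h.isReduced_and_isRigid cs).2 _ _ (h.isReduced_and_isRigid cs).1
    (h'.isReduced_and_isRigid cs).1 rfl heq.symm

end CoxeterSystem

/-! ### Paths in trees as lists of vertices -/

namespace SimpleGraph

variable {V : Type*}

/-- `l` lists the vertices of a path from `q` to `p`. -/
def IsPathList (G : SimpleGraph V) (q p : V) (l : List V) : Prop :=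
  l.IsChain G.Adj ∧ l.Nodup ∧ l.head? = some q ∧ l.getLast? = some p

theorem IsPathList.exists_walk {G : SimpleGraph V} {q p : V} {l : List V}
    (h : G.IsPathList q p l) : ∃ P : G.Walk q p, P.IsPath ∧ P.support = l := by
  obtain ⟨h1, h2, h3, h4⟩ := h
  have hne : l ≠ [] := by
    rintro rfl
    simp at h3
  rw [List.head?_eq_some_head hne, Option.some_inj] at h3
  rw [List.getLast?_eq_some_getLast hne, Option.some_inj] at h4
  subst h3 h4
  refine ⟨Walk.ofSupport l hne h1, ?_, Walk.support_ofSupport hne h1⟩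
  rwa [Walk.isPath_def, Walk.support_ofSupport]

theorem Walk.IsPath.isPathList_support {G : SimpleGraph V} {q p : V} {P : G.Walk q p}
    (h : P.IsPath) : G.IsPathList q p P.support := by
  refine ⟨P.isChain_adj_support, h.support_nodup, ?_, ?_⟩
  · rw [List.head?_eq_some_head P.support_ne_nil, P.head_support]
  · rw [List.getLast?_eq_some_getLast P.support_ne_nil, P.getLast_support]

theorem IsAcyclic.isPathList_unique {G : SimpleGraph V} (hG : G.IsAcyclic) {q p : V}
    {l l' : List V} (h : G.IsPathList q p l) (h' : G.IsPathList q p l') : l = l' := by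
  obtain ⟨P, hP, rfl⟩ := h.exists_walk
  obtain ⟨P', hP', rfl⟩ := h'.exists_walk
  have h1 := (hG.subsingleton_path _ _).elim (⟨P, hP⟩ : G.Path q p) ⟨P', hP'⟩
  rw [Subtype.mk.injEq] at h1
  rw [h1]

theorem IsTree.exists_isPathList {G : SimpleGraph V} (hG : G.IsTree) (q p : V) :
    ∃ l, G.IsPathList q p l := by
  obtain ⟨P, hP, -⟩ := hG.existsUnique_path q p
  exact ⟨_, hP.isPathList_support⟩

theorem isPathList_singleton (G : SimpleGraph V) (q : V) : G.IsPathList q q [q] := by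
  simp [IsPathList]

theorem isPathList_pair {G : SimpleGraph V} {a b : V} (h : G.Adj a b) :
    G.IsPathList a b [a, b] := by
  simp [IsPathList, h, h.ne]

theorem IsPathList.cons {G : SimpleGraph V} {a b p : V} {l : List V} (h : G.IsPathList b p l)
    (hab : G.Adj a b) (ha : a ∉ l) : G.IsPathList a p (a :: l) := by
  obtain ⟨h1, h2, h3, h4⟩ := h
  cases l with
  | nil => simp at h3
  | cons c l =>
    obtain rfl : c = b := by simpa using h3
    exact ⟨List.isChain_cons_cons.2 ⟨hab, h1⟩, List.nodup_cons.2 ⟨ha, h2⟩, rfl, by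
      rwa [List.getLast?_cons_cons]⟩

theorem IsPathList.reverse {G : SimpleGraph V} {q p : V} {l : List V} (h : G.IsPathList q p l) :
    G.IsPathList p q l.reverse := by
  obtain ⟨h1, h2, h3, h4⟩ := h
  refine ⟨?_, List.nodup_reverse.2 h2, by rwa [List.head?_reverse], by rwa [List.getLast?_reverse]⟩
  rw [List.isChain_reverse]
  exact h1.imp fun _ _ h => h.symm

/-- In a tree, if the neighbour `a` of `q` lies on a path from `q`, then it is its second vertex. -/
theorem IsAcyclic.eq_cons_of_adj_of_mem {G : SimpleGraph V} (hG : G.IsAcyclic) {q a : V}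
    {l : List V} (h1 : (q :: l).IsChain G.Adj) (h2 : (q :: l).Nodup) (hadj : G.Adj a q)
    (ha : a ∈ l) : ∃ l', l = a :: l' := by
  obtain ⟨l₁, l₂, rfl⟩ := List.append_of_mem ha
  have h3 : G.IsPathList q a (q :: (l₁ ++ [a])) := by
    have hpre : q :: (l₁ ++ [a]) <+: q :: (l₁ ++ a :: l₂) := ⟨l₂, by simp⟩
    refine ⟨h1.prefix hpre, h2.sublist hpre.sublist, rfl, ?_⟩
    rw [← List.cons_append, List.getLast?_append]
    simp
  have h4 := hG.isPathList_unique h3 (isPathList_pair hadj.symm)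
  cases l₁ with
  | nil => exact ⟨l₂, rfl⟩
  | cons b l₁ => simp at h4

/-! ### The projection to an edge of a tree -/

theorem branchProj_eq_or (G : SimpleGraph V) (s t r : V) :
    G.branchProj s t r = s ∨ G.branchProj s t r = t := by
  unfold branchProj
  split_ifs
  · exact .inl rfl
  · exact .inr rfl

theorem mem_branch_self {G : SimpleGraph V} {s t : V} (h : t ≠ s) : s ∈ G.branch s t :=
  ⟨.nil, by simpa using h⟩

theorem mem_branch_of_adj {G : SimpleGraph V} {s t a b : V} (h : G.Adj b a)
    (ha : a ∈ G.branch s t) (hb : b ≠ t) : b ∈ G.branch s t := by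
  obtain ⟨P, hP⟩ := ha
  exact ⟨.cons h P, by simp [hP, hb.symm]⟩

theorem branchProj_left {G : SimpleGraph V} {s t : V} (hst : G.Adj s t) :
    G.branchProj s t s = s :=
  if_pos (mem_branch_self hst.ne')

theorem branchProj_right {G : SimpleGraph V} (hG : G.IsTree) {s t : V} (hst : G.Adj s t) :
    G.branchProj s t t = t :=
  if_neg ((mem_branch_symm_iff hG hst t).1 (mem_branch_self hst.ne))

/-- A walk to `s` that avoids `t` can be prolonged to any neighbour of its start except `t`, and
likewise with `s` and `t` exchanged. So `{s, t}` is the only edge between the two branches. -/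
theorem eq_of_adj_of_mem_branch {G : SimpleGraph V} (hG : G.IsTree) {s t a b : V}
    (hst : G.Adj s t) (hab : G.Adj a b) (ha : a ∈ G.branch s t) (hb : b ∉ G.branch s t) :
    a = s ∧ b = t := by
  have hbt : b = t := by
    by_contra h
    exact hb (mem_branch_of_adj hab.symm ha h)
  refine ⟨?_, hbt⟩
  by_contra h
  exact (mem_branch_symm_iff hG hst a).1
    (mem_branch_of_adj (hbt ▸ hab) (mem_branch_self hst.ne) h) ha

theorem branchProj_eq_of_adj {G : SimpleGraph V} (hG : G.IsTree) {s t a b : V}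
    (hst : G.Adj s t) (hab : G.Adj a b) (hne : s(a, b) ≠ s(s, t)) :
    G.branchProj s t a = G.branchProj s t b := by
  unfold branchProj
  split_ifs with h1 h2 h2
  · rfl
  · obtain ⟨rfl, rfl⟩ := eq_of_adj_of_mem_branch hG hst hab h1 h2
    exact absurd rfl hne
  · obtain ⟨rfl, rfl⟩ := eq_of_adj_of_mem_branch hG hst hab.symm h2 h1
    exact absurd Sym2.eq_swap hne
  · rfl

theorem branchProj_of_mem {G : SimpleGraph V} (hG : G.IsTree) {s t x : V} (hst : G.Adj s t)
    (hx : x = s ∨ x = t) : G.branchProj s t x = x := by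
  rcases hx with rfl | rfl
  · exact branchProj_left hst
  · exact branchProj_right hG hst

/-- The path from a vertex to its projection does not pass through the other end of the edge. -/
theorem notMem_of_isPathList_branchProj {G : SimpleGraph V} (hG : G.IsTree) {s t r x' : V}
    {l : List V} (hst : G.Adj s t) (hx' : s(G.branchProj s t r, x') = s(s, t))
    (hl : G.IsPathList r (G.branchProj s t r) l) : x' ∉ l := by
  classical
  have key (a b : V) (P : G.Walk r a) (hP : b ∉ P.support) (hl : G.IsPathList r a l) : b ∉ l := by
    rw [hG.isAcyclic.isPathList_unique hl P.bypass_isPath.isPathList_support]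
    exact fun h => hP (P.support_bypass_subset_support h)
  by_cases h : r ∈ G.branch s t
  · have h1 : G.branchProj s t r = s := if_pos h
    rw [h1] at hx' hl
    obtain rfl : x' = t := Sym2.congr_right.1 hx'
    obtain ⟨P, hP⟩ := h
    exact key _ _ P hP hl
  · have h1 : G.branchProj s t r = t := if_neg h
    rw [h1] at hx' hl
    rw [Sym2.eq_swap (a := s)] at hx'
    obtain rfl : x' = s := Sym2.congr_right.1 hx'
    obtain ⟨P, hP⟩ := (mem_branch_symm_iff hG hst r).2 h
    exact key _ _ P hP hl

end SimpleGraph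

/-! ### Rigid words in a tree -/

namespace CoxeterSystem

variable {B W : Type*} [Group W] {M : CoxeterMatrix B}

theorem two_le_of_ne {M : CoxeterMatrix B} {a b : B} (hab : a ≠ b) (h0 : M a b ≠ 0) :
    2 ≤ M a b := by
  have := M.off_diagonal a b hab
  lia

theorem altList_prefix (a b : B) {m n : ℕ} (h : m ≤ n) : altList a b m <+: altList a b n := by
  induction m generalizing a b n with
  | zero => exact List.nil_prefix
  | succ m ih =>
    obtain ⟨n, rfl⟩ : ∃ n', n = n' + 1 := ⟨n - 1, by lia⟩
    exact (List.prefix_cons_inj a).2 (ih b a (by lia))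

theorem IsRigidWord.of_infix {ω ω' : List B} (h : IsRigidWord M ω) (h' : ω' <:+: ω) :
    IsRigidWord M ω' :=
  ⟨h.1.infix h', fun a b hab hM h1 => h.2 a b hab hM (h1.trans h')⟩

/-- For the label `2` the two adjacent letters would already form a braid word. Thus rigid words are
walks in the diagram. -/
theorem IsRigidWord.isChain_adj {ω : List B} (h : IsRigidWord M ω) :
    ω.IsChain M.diagram.Adj := by
  rw [List.isChain_iff_forall_rel_of_append_cons_cons]
  rintro a b l₁ l₂ rfl
  have h1 : [a, b] <:+: l₁ ++ a :: b :: l₂ := ⟨l₁, l₂, by simp⟩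
  have hab : a ≠ b := by
    have h2 := (h.of_infix h1).1
    simpa using h2
  refine ⟨hab, fun h2 => h.2 a b hab (by rw [h2]; exact two_ne_zero) ?_⟩
  rw [h2]
  exact h1

/-- Only a braid word at the very front can be new, and its first two letters must be `a` and `b`.
-/
theorem IsRigidWord.cons {a b : B} {ω : List B} (h : IsRigidWord M (b :: ω)) (hab : a ≠ b)
    (h' : M a b ≠ 0 → ¬ altList a b (M a b) <+: a :: b :: ω) : IsRigidWord M (a :: b :: ω) := by
  refine ⟨List.isChain_cons_cons.2 ⟨hab, h.1⟩, fun c d hcd hM h1 => ?_⟩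
  rcases List.infix_cons_iff.1 h1 with h2 | h2
  · obtain ⟨m, hm⟩ := Nat.exists_eq_add_of_le' (two_le_of_ne hcd hM)
    have h3 : c = a ∧ d = b := by
      rw [hm, altList, altList, List.cons_prefix_cons, List.cons_prefix_cons] at h2
      exact ⟨h2.1, h2.2.1⟩
    obtain ⟨rfl, rfl⟩ := h3
    exact h' hM h2
  · exact h.2 c d hcd hM h2

theorem isRigidWord_singleton (a : B) : IsRigidWord M [a] := by
  refine ⟨List.isChain_singleton a, fun c d hcd hM h1 => ?_⟩
  have h2 := h1.length_le
  have h3 := two_le_of_ne hcd hM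
  rw [length_altList, List.length_singleton] at h2
  lia

/-- A braid word with `m ≥ 3` repeats its first letter, and `m = 2` is excluded by adjacency. -/
theorem isRigidWord_of_nodup {ω : List B} (h : ω.IsChain M.diagram.Adj) (hω : ω.Nodup) :
    IsRigidWord M ω := by
  refine ⟨h.imp fun _ _ h => h.1, fun a b hab hM h1 => ?_⟩
  obtain h2 | h2 : M a b = 2 ∨ 3 ≤ M a b := by
    have := two_le_of_ne hab hM
    lia
  · rw [h2] at h1
    have h3 := h.infix h1
    simp only [altList, List.isChain_cons_cons] at h3
    exact h3.1.2 h2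
  · obtain ⟨m, hm⟩ := Nat.exists_eq_add_of_le' h2
    rw [hm] at h1
    have h3 := hω.sublist h1.sublist
    simp [altList] at h3

/-- In a tree the neighbour `a` of `b` can lie on a path from `b` only as its second vertex. The
word would then begin with `aba`, the braid word of the label `3`. -/
theorem IsRigidWord.notMem_of_eq_three (hM : M.diagram.IsTree) {a b : B} {ω : List B}
    (h : IsRigidWord M (a :: b :: ω)) (hω : (b :: ω).Nodup) (h3 : M a b = 3) : a ∉ b :: ω := by
  intro ha
  have h1 := h.isChain_adj
  rw [List.isChain_cons_cons] at h1
  have h2 : a ∈ ω := by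
    rcases List.mem_cons.1 ha with h2 | h2
    · exact absurd h2 h1.1.ne
    · exact h2
  obtain ⟨l, rfl⟩ := hM.isAcyclic.eq_cons_of_adj_of_mem h1.2 hω h1.1 h2
  refine h.2 a b h1.1.ne (by lia) ?_
  rw [h3]
  exact (List.prefix_append [a, b, a] l).isInfix

/-- If all edges are unlabeled, then the rigid words are the paths. -/
theorem IsRigidWord.nodup_of_isUnlabeled (hM : M.diagram.IsTree) (hU : M.IsUnlabeled)
    {ω : List B} (h : IsRigidWord M ω) : ω.Nodup := by
  induction ω with
  | nil => exact List.nodup_nil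
  | cons a ω ih =>
    have h1 := ih h.tail
    cases ω with
    | nil => exact List.nodup_singleton a
    | cons b ω =>
      have h2 := h.isChain_adj
      rw [List.isChain_cons_cons] at h2
      exact List.nodup_cons.2 ⟨h.notMem_of_eq_three hM h1 (hU a b h2.1), h1⟩

theorem leftCell_inter_rightCell_of_isUnlabeled (cs : CoxeterSystem M W) (hM : M.diagram.IsTree)
    (hU : M.IsUnlabeled) (p q : B) : ∃ w : W, cs.leftCell p ∩ cs.rightCell q = {w} := by
  obtain ⟨l, hl⟩ := hM.exists_isPathList q p
  refine ⟨cs.wordProd l, Set.ext fun x => ?_⟩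
  rw [mem_leftCell_inter_rightCell_iff, Set.mem_singleton_iff]
  constructor
  · rintro ⟨ω, h1, h2, h3, rfl⟩
    rw [hM.isAcyclic.isPathList_unique hl
      ⟨h1.isChain_adj, h1.nodup_of_isUnlabeled hM hU, h2, h3⟩]
  · rintro rfl
    exact ⟨l, isRigidWord_of_nodup hl.1 hl.2.1, hl.2.2.1, hl.2.2.2, rfl⟩

end CoxeterSystem

/-! ### Rigid words in a tree with one labeled edge -/

namespace CoxeterMatrix

variable {B : Type*} {M : CoxeterMatrix B} {s t : B}

theorem IsUniqueLabeledEdge.eq_of_sym2_eq {x x' : B} (hx : s(x, x') = s(s, t)) :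
    M x x' = M s t := by
  rcases Sym2.eq_iff.1 hx with ⟨rfl, rfl⟩ | ⟨rfl, rfl⟩
  · rfl
  · exact M.symmetric _ _

theorem IsUniqueLabeledEdge.adj_of_sym2_eq (hU : M.IsUniqueLabeledEdge s t) {x x' : B}
    (hx : s(x, x') = s(s, t)) : M.diagram.Adj x x' := by
  rcases Sym2.eq_iff.1 hx with ⟨rfl, rfl⟩ | ⟨rfl, rfl⟩
  · exact hU.1
  · exact hU.1.symm

end CoxeterMatrix

namespace CoxeterSystem

open SimpleGraph

variable {B W : Type*} [Group W] {M : CoxeterMatrix B} {s t : B}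

/-- `ω` consists of the path from `q` to its projection, an alternating word of length at least two,
and the path from the projection of `p` to `p`, where common ends are written once. -/
def IsExtendedAltWord (M : CoxeterMatrix B) (s t q p : B) (ω : List B) : Prop :=
  ∃ (l₁ l₂ : List B) (x' : B) (k : ℕ),
    M.diagram.IsPathList q (M.diagram.branchProj s t q) (l₁ ++ [M.diagram.branchProj s t q]) ∧
    M.diagram.IsPathList (M.diagram.branchProj s t p) p (M.diagram.branchProj s t p :: l₂) ∧
    s(M.diagram.branchProj s t q, x') = s(s, t) ∧
    (altList (M.diagram.branchProj s t q) x' (k + 2)).getLast? =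
      some (M.diagram.branchProj s t p) ∧
    ω = l₁ ++ (altList (M.diagram.branchProj s t q) x' (k + 2) ++ l₂)

/-- The rigid words in a tree with a unique labeled edge. -/
theorem IsRigidWord.nodup_or_isExtendedAltWord (hM : M.diagram.IsTree)
    (hU : M.IsUniqueLabeledEdge s t) {p q : B} {ω : List B} (h : IsRigidWord M ω)
    (hq : ω.head? = some q) (hp : ω.getLast? = some p) :
    (M.diagram.branchProj s t q = M.diagram.branchProj s t p ∧ ω.Nodup) ∨
      IsExtendedAltWord M s t q p ω := by
  induction ω generalizing q with
  | nil => simp at hq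
  | cons a ω ih =>
    obtain rfl : a = q := by simpa using hq
    cases ω with
    | nil =>
      obtain rfl : a = p := by simpa using hp
      exact .inl ⟨rfl, List.nodup_singleton a⟩
    | cons b ω =>
      have hch := h.isChain_adj
      rw [List.isChain_cons_cons] at hch
      obtain ⟨hab, hch'⟩ := hch
      rw [List.getLast?_cons_cons] at hp
      rcases ih h.tail rfl hp with ⟨hπ, hnd⟩ | ⟨l₁, l₂, x', k, hl₁, hl₂, hx', hlast, hω⟩
      -- The tail is a path. Crossing the labeled edge starts an alternating part of length two,
      -- here `k = 0`; any other edge just prolongs the path.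
      · by_cases he : s(a, b) = s(s, t)
        · right
          have hmem : (a = s ∨ a = t) ∧ (b = s ∨ b = t) := by
            rcases Sym2.eq_iff.1 he with ⟨rfl, rfl⟩ | ⟨rfl, rfl⟩ <;> simp
          have ha := branchProj_of_mem hM hU.1 hmem.1
          have hb := branchProj_of_mem hM hU.1 hmem.2
          have hpath : M.diagram.IsPathList b p (b :: ω) := ⟨hch', hnd, rfl, hp⟩
          refine ⟨[], ω, b, 0, ?_, ?_, ?_, ?_, ?_⟩
          · rw [ha]
            exact isPathList_singleton _ a
          · rwa [← hπ, hb]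
          · rwa [ha]
          · rw [← hπ, hb]
            rfl
          · rw [ha]
            rfl
        · left
          have h3 := hU.2.2 a b hab he
          rw [branchProj_eq_of_adj hM hU.1 hab he]
          exact ⟨hπ, List.nodup_cons.2 ⟨h.notMem_of_eq_three hM hnd h3, hnd⟩⟩
      · right
        by_cases he : s(a, b) = s(s, t)
        · have hmem : (a = s ∨ a = t) ∧ (b = s ∨ b = t) := by
            rcases Sym2.eq_iff.1 he with ⟨rfl, rfl⟩ | ⟨rfl, rfl⟩ <;> simp
          have ha := branchProj_of_mem hM hU.1 hmem.1
          have hb := branchProj_of_mem hM hU.1 hmem.2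
          rw [hb] at hl₁ hx' hlast hω
          -- The tail starts on the labeled edge, so it has no entering path, and the new letter
          -- lengthens its alternating part.
          have h1 : l₁ = [] := by
            have h2 := hM.isAcyclic.isPathList_unique hl₁ (isPathList_singleton _ b)
            simpa using h2
          subst h1
          obtain rfl : x' = a := by
            rw [← he, Sym2.eq_swap (a := a)] at hx'
            exact Sym2.congr_right.1 hx'
          refine ⟨[], l₂, b, k + 1, ?_, hl₂, ?_, ?_, ?_⟩
          · rw [ha]
            exact isPathList_singleton _ _
          · rwa [ha]
          · rw [ha, altList]
            rw [altList] at hlast ⊢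
            rwa [List.getLast?_cons_cons]
          · rw [ha, hω]
            rfl
        -- The new letter prolongs the entering path. Since the whole tail may have repeated
        -- letters, the criterion for the label `3` is applied only to its prefix up to the
        -- projection, which is a path.
        · have h3 := hU.2.2 a b hab he
          have hπ := branchProj_eq_of_adj hM hU.1 hab he
          rw [IsExtendedAltWord, hπ]
          refine ⟨a :: l₁, l₂, x', k, ?_, hl₂, hx', hlast, by rw [hω, List.cons_append]⟩
          rw [List.cons_append]
          apply hl₁.cons hab
          have hpre : l₁ ++ [M.diagram.branchProj s t b] <+: b :: ω := by
            rw [hω, altList]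
            exact ⟨altList x' (M.diagram.branchProj s t b) (k + 1) ++ l₂, by simp⟩
          obtain ⟨l, hl⟩ : ∃ l, l₁ ++ [M.diagram.branchProj s t b] = b :: l := by
            have h1 := hl₁.2.2.1
            cases hc : l₁ ++ [M.diagram.branchProj s t b] with
            | nil => simp at hc
            | cons c l =>
              rw [hc] at h1
              obtain rfl : c = b := by simpa using h1
              exact ⟨l, rfl⟩
          rw [hl] at hpre ⊢
          have h4 : IsRigidWord M (a :: b :: l) :=
            h.of_infix ((List.prefix_cons_inj a).2 hpre).isInfix
          exact h4.notMem_of_eq_three hM (hl ▸ hl₁.2.1) h3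

/-- An alternating word, followed by a path that leaves the edge, is rigid. -/
theorem isRigidWord_altList_append (hU : M.IsUniqueLabeledEdge s t) {y : B} {l₂ : List B}
    (hl : (y :: l₂).IsChain M.diagram.Adj) (hnd : (y :: l₂).Nodup)
    (hl₂ : ∀ r ∈ l₂, r ≠ s ∧ r ≠ t) {x x' : B} (hx : s(x, x') = s(s, t)) {k : ℕ}
    (hlast : (altList x x' (k + 1)).getLast? = some y) (hk : k + 1 < M s t) :
    IsRigidWord M (altList x x' (k + 1) ++ l₂) := by
  induction k generalizing x x' with
  | zero =>
    obtain rfl : x = y := by simpa [altList] using hlast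
    exact isRigidWord_of_nodup hl hnd
  | succ k ih =>
    have hx' : s(x', x) = s(s, t) := by rw [Sym2.eq_swap, hx]
    have h1 : altList x x' (k + 1 + 1) ++ l₂ = x :: x' :: (altList x x' k ++ l₂) := rfl
    have h2 := ih hx' (by
      rw [altList, altList, List.getLast?_cons_cons, ← altList] at hlast
      exact hlast) (by lia)
    rw [h1]
    refine IsRigidWord.cons h2 (hU.adj_of_sym2_eq hx).ne fun _ h3 => ?_
    rw [CoxeterMatrix.IsUniqueLabeledEdge.eq_of_sym2_eq hx, ← h1] at h3
    -- Since `k + 2 < m`, a braid word at the front would reach at least one letter beyond the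
    -- alternating part. That letter would be `s` or `t` and lie in `l₂`.
    have h4 : altList x x' (k + 3) <+: altList x x' (k + 1 + 1) ++ l₂ :=
      (altList_prefix x x' (by lia)).trans h3
    have h5 : ∃ z, altList x x' (k + 3) = altList x x' (k + 1 + 1) ++ [z] ∧ (z = s ∨ z = t) := by
      have h6 (a b : B) (n : ℕ) : ∃ z, altList a b (n + 1) = altList a b n ++ [z] ∧
          (z = a ∨ z = b) := by
        induction n generalizing a b with
        | zero => exact ⟨a, rfl, .inl rfl⟩
        | succ n ih =>
          obtain ⟨z, hz, hz'⟩ := ih b a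
          exact ⟨z, by rw [altList, hz]; rfl, hz'.symm⟩
      obtain ⟨z, hz, hz'⟩ := h6 x x' (k + 2)
      refine ⟨z, hz, ?_⟩
      rcases Sym2.eq_iff.1 hx with ⟨rfl, rfl⟩ | ⟨rfl, rfl⟩
      · exact hz'
      · exact hz'.symm
    obtain ⟨z, hz, hz'⟩ := h5
    rw [hz, List.prefix_append_right_inj] at h4
    have h7 : z ∈ l₂ := h4.subset (List.mem_singleton_self z)
    rcases hz' with rfl | rfl
    · exact (hl₂ _ h7).1 rfl
    · exact (hl₂ _ h7).2 rfl

/-- A path that enters the edge, followed by a rigid word that traverses the edge, is rigid. -/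
theorem isRigidWord_append_of_path (hU : M.IsUniqueLabeledEdge s t) {x x' : B} {l₁ ω : List B}
    (hl : (l₁ ++ [x]).IsChain M.diagram.Adj) (hnd : (l₁ ++ [x]).Nodup)
    (hl₁ : ∀ r ∈ l₁, r ≠ s ∧ r ≠ t) (hx : s(x, x') = s(s, t))
    (h : IsRigidWord M (x :: x' :: ω)) : IsRigidWord M (l₁ ++ x :: x' :: ω) := by
  induction l₁ with
  | nil => exact h
  | cons a l₁ ih =>
    have h1 := ih hl.tail (List.nodup_cons.1 hnd).2 fun r hr => hl₁ r (List.mem_cons_of_mem a hr)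
    have ha := hl₁ a List.mem_cons_self
    have hax' : x' ≠ a := by
      rintro rfl
      rcases Sym2.eq_iff.1 hx with ⟨-, rfl⟩ | ⟨-, rfl⟩
      · exact ha.2 rfl
      · exact ha.1 rfl
    -- Only the first three letters matter: the edge `ab` has label `3`, so it suffices that the
    -- third letter is not `a`. For `l₁ = [a]` this third letter is `x'`.
    obtain ⟨b, c, l, h2, h3, h4⟩ : ∃ b c l, l₁ ++ x :: x' :: ω = b :: c :: l ∧
        M.diagram.Adj a b ∧ c ≠ a := by
      rw [List.cons_append] at hl hnd
      cases l₁ with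
      | nil =>
        exact ⟨x, x', ω, rfl, (List.isChain_cons_cons.1 hl).1, hax'⟩
      | cons b l₁ =>
        cases l₁ with
        | nil =>
          refine ⟨b, x, x' :: ω, rfl, (List.isChain_cons_cons.1 hl).1, ?_⟩
          rintro rfl
          simp at hnd
        | cons c l₁ =>
          refine ⟨b, c, l₁ ++ x :: x' :: ω, rfl, (List.isChain_cons_cons.1 hl).1, ?_⟩
          rintro rfl
          simp at hnd
    rw [List.cons_append, h2]
    rw [h2] at h1
    refine h1.cons h3.ne fun _ h5 => ?_
    have he : s(a, b) ≠ s(s, t) := by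
      intro he
      rcases Sym2.eq_iff.1 he with ⟨rfl, -⟩ | ⟨rfl, -⟩
      · exact ha.1 rfl
      · exact ha.2 rfl
    rw [hU.2.2 a b h3 he, altList, altList, altList, List.cons_prefix_cons, List.cons_prefix_cons,
      List.cons_prefix_cons] at h5
    exact h4 h5.2.2.1.symm

end CoxeterSystem

/-! ### Extension of alternating words by paths, and the bijections -/

namespace CoxeterSystem

open SimpleGraph

variable {B W : Type*} [Group W] {M : CoxeterMatrix B} {s t : B}

theorem eq_or_eq_of_sym2_eq {B : Type*} {s t x x' : B} (hx : s(x, x') = s(s, t)) :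
    (x = s ∨ x = t) ∧ ∀ r, r ≠ x → r ≠ x' → r ≠ s ∧ r ≠ t := by
  rcases Sym2.eq_iff.1 hx with ⟨rfl, rfl⟩ | ⟨rfl, rfl⟩
  · exact ⟨.inl rfl, fun r h1 h2 => ⟨h1, h2⟩⟩
  · exact ⟨.inr rfl, fun r h1 h2 => ⟨h2, h1⟩⟩

/-- The rigid words between two vertices of the labeled edge. -/
theorem IsRigidWord.eq_altList (hM : M.diagram.IsTree) (hU : M.IsUniqueLabeledEdge s t)
    {x y : B} (hx : x = s ∨ x = t) (hy : y = s ∨ y = t) {ω : List B} (h : IsRigidWord M ω)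
    (hhead : ω.head? = some x) (hlast : ω.getLast? = some y) :
    (ω = [x] ∧ x = y) ∨ ∃ x' k, s(x, x') = s(s, t) ∧ ω = altList x x' (k + 2) ∧
      k + 2 < M s t := by
  have hx1 := branchProj_of_mem hM hU.1 hx
  have hy1 := branchProj_of_mem hM hU.1 hy
  rcases h.nodup_or_isExtendedAltWord hM hU hhead hlast with
    ⟨h1, h2⟩ | ⟨l₁, l₂, x', k, hl₁, hl₂, hx', -, rfl⟩
  · left
    rw [hx1, hy1] at h1
    subst h1
    exact ⟨hM.isAcyclic.isPathList_unique ⟨h.isChain_adj, h2, hhead, hlast⟩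
      (isPathList_singleton _ x), rfl⟩
  · right
    rw [hx1] at hl₁ hx' h ⊢
    rw [hy1] at hl₂
    have h1 := hM.isAcyclic.isPathList_unique hl₁ (isPathList_singleton _ x)
    have h2 := hM.isAcyclic.isPathList_unique hl₂ (isPathList_singleton _ y)
    obtain rfl : l₁ = [] := by simpa using h1
    obtain rfl : l₂ = [] := by simpa using h2
    refine ⟨x', k, hx', by simp, ?_⟩
    by_contra hk
    have h3 := CoxeterMatrix.IsUniqueLabeledEdge.eq_of_sym2_eq (M := M) hx'
    have h4 := hU.2.1
    refine h.2 x x' (hU.adj_of_sym2_eq hx').ne (by lia) ?_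
    rw [h3]
    simpa using (altList_prefix x x' (by lia)).isInfix

/-- The converse of `IsRigidWord.nodup_or_isExtendedAltWord`: the outer paths meet `{s, t}` only in
the projections, so no braid word arises at the junctions. The two paths may overlap each other,
since rigidity is a local condition. -/
theorem IsRigidWord.extend (hM : M.diagram.IsTree) (hU : M.IsUniqueLabeledEdge s t) {p q x' : B}
    {k : ℕ} {l₁ l₂ : List B}
    (hl₁ : M.diagram.IsPathList q (M.diagram.branchProj s t q) (l₁ ++ [M.diagram.branchProj s t q]))
    (hl₂ : M.diagram.IsPathList (M.diagram.branchProj s t p) p (M.diagram.branchProj s t p :: l₂))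
    (hx' : s(M.diagram.branchProj s t q, x') = s(s, t))
    (hlast : (altList (M.diagram.branchProj s t q) x' (k + 2)).getLast? =
      some (M.diagram.branchProj s t p)) (hk : k + 2 < M s t) :
    IsRigidWord M (l₁ ++ (altList (M.diagram.branchProj s t q) x' (k + 2) ++ l₂)) ∧
      (l₁ ++ (altList (M.diagram.branchProj s t q) x' (k + 2) ++ l₂)).head? = some q ∧
      (l₁ ++ (altList (M.diagram.branchProj s t q) x' (k + 2) ++ l₂)).getLast? = some p := by
  refine ⟨?_, ?_, ?_⟩
  · have h1 : ∀ r ∈ l₁, r ≠ s ∧ r ≠ t := by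
      intro r hr
      refine (eq_or_eq_of_sym2_eq hx').2 r ?_ ?_
      · rintro rfl
        have h2 := hl₁.2.1
        rw [List.nodup_append] at h2
        exact h2.2.2 _ hr _ (List.mem_singleton_self _) rfl
      · rintro rfl
        exact notMem_of_isPathList_branchProj hM hU.1 hx' hl₁ (List.mem_append_left _ hr)
    have h2 : ∀ r ∈ l₂, r ≠ s ∧ r ≠ t := by
      obtain ⟨y', hy'⟩ : ∃ y', s(M.diagram.branchProj s t p, y') = s(s, t) := by
        rcases branchProj_eq_or M.diagram s t p with h | h
        · exact ⟨t, by rw [h]⟩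
        · exact ⟨s, by rw [h, Sym2.eq_swap]⟩
      intro r hr
      refine (eq_or_eq_of_sym2_eq hy').2 r ?_ ?_
      · rintro rfl
        exact (List.nodup_cons.1 hl₂.2.1).1 hr
      · rintro rfl
        refine notMem_of_isPathList_branchProj hM hU.1 hy' hl₂.reverse ?_
        rw [List.mem_reverse]
        exact List.mem_cons_of_mem _ hr
    exact isRigidWord_append_of_path hU hl₁.1 hl₁.2.1 h1 hx'
      (isRigidWord_altList_append hU hl₂.1 hl₂.2.1 h2 hx' hlast hk)
  · have h1 := hl₁.2.2.1
    rw [List.head?_append] at h1 ⊢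
    exact h1
  · have h1 := hl₂.2.2.2
    rw [← List.singleton_append, List.getLast?_append] at h1
    rw [List.getLast?_append, List.getLast?_append, hlast]
    rw [List.getLast?_singleton] at h1
    rw [h1]
    rfl

theorem isPathList_walkWord {p q : B} {P : M.diagram.Walk p q}
    (hP : P.length = M.diagram.dist p q) : M.diagram.IsPathList q p (walkWord P) :=
  (P.isPath_of_length_eq_dist hP).isPathList_support.reverse

theorem dropLast_append_of_getLast? {B : Type*} {l : List B} {x : B} (h : l.getLast? = some x) :
    l.dropLast ++ [x] = l := by
  rw [List.getLast?_eq_some_iff] at h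
  obtain ⟨l', rfl⟩ := h
  simp

theorem cons_tail_of_head? {B : Type*} {l : List B} {x : B} (h : l.head? = some x) :
    x :: l.tail = l := by
  cases l with
  | nil => simp at h
  | cons a l =>
    obtain rfl : a = x := by simpa using h
    rfl

theorem extend_wordProd (cs : CoxeterSystem M W) {p p' q q' : B} (P : M.diagram.Walk q' q)
    (Q : M.diagram.Walk p p') (ω : List B) : cs.extend P Q (cs.wordProd ω) =
      cs.wordProd ((walkWord P).dropLast ++ (ω ++ (walkWord Q).tail)) := by
  rw [extend, wordProd_append, wordProd_append, mul_assoc]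

/-- The word starts and ends with `x` and has at least two letters. This separates the extended
alternating words from the shortest path when the two projections coincide. -/
theorem not_nodup_altList {x x' : B} {k : ℕ} (h : (altList x x' (k + 2)).getLast? = some x) :
    ¬ (altList x x' (k + 2)).Nodup := by
  rw [altList, altList, List.getLast?_cons_cons] at h
  rw [altList, altList]
  exact fun h1 => (List.nodup_cons.1 h1).1 (List.mem_of_getLast? h)

/-- The exceptional clause of `extendReduced` concerns a one-letter word; a rigid word with at least
two letters has a different product. -/
theorem extendReduced_wordProd_altList (cs : CoxeterSystem M W) {p p' q q' x x' : B} {k : ℕ}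
    (P : M.diagram.Walk q' q) (Q : M.diagram.Walk p p') (K : M.diagram.Walk p q)
    (h : IsRigidWord M (altList x x' (k + 2))) :
    cs.extendReduced P Q K (cs.wordProd (altList x x' (k + 2))) =
      cs.wordProd ((walkWord P).dropLast ++ (altList x x' (k + 2) ++ (walkWord Q).tail)) := by
  rw [extendReduced, if_neg, extend_wordProd]
  rintro ⟨-, h1⟩
  rw [← wordProd_singleton] at h1
  have h2 := congrArg List.length (h.eq_of_wordProd_eq cs (isRigidWord_singleton p') h1)
  simp at h2

/-- On words, the source consists of the alternating words with `2` to `m - 1` letters and, if the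
projections coincide, the one-letter word. The latter goes to the unique path, the former to their
extensions, and these exhaust the rigid words from `q` to `p`. Uniqueness of paths in a tree
identifies the outer pieces of a given rigid word with `P` and `Q`. -/
theorem bijOn_extendReduced (cs : CoxeterSystem M W) (hM : M.diagram.IsTree)
    (hU : M.IsUniqueLabeledEdge s t) {p q : B}
    {P : M.diagram.Walk (M.diagram.branchProj s t q) q}
    {Q : M.diagram.Walk p (M.diagram.branchProj s t p)} {K : M.diagram.Walk p q}
    (hP : P.length = M.diagram.dist (M.diagram.branchProj s t q) q)
    (hQ : Q.length = M.diagram.dist p (M.diagram.branchProj s t p))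
    (hK : K.length = M.diagram.dist p q) :
    Set.BijOn (cs.extendReduced P Q K)
    (cs.leftCell (M.diagram.branchProj s t p) ∩ cs.rightCell (M.diagram.branchProj s t q))
    (cs.leftCell p ∩ cs.rightCell q) := by
  have hPl := isPathList_walkWord hP
  have hQl := isPathList_walkWord hQ
  have hKl := isPathList_walkWord hK
  have hP1 := dropLast_append_of_getLast? hPl.2.2.2
  have hQ1 := cons_tail_of_head? hQl.2.2.1
  have hx := branchProj_eq_or M.diagram s t q
  have hy := branchProj_eq_or M.diagram s t p
  have hKrigid : IsRigidWord M (walkWord K) := isRigidWord_of_nodup hKl.1 hKl.2.1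
  have hK1 (h : M.diagram.branchProj s t q = M.diagram.branchProj s t p) :
      cs.extendReduced P Q K (cs.wordProd [M.diagram.branchProj s t q]) =
        cs.wordProd (walkWord K) := by
    rw [extendReduced, if_pos ⟨h.symm, by rw [wordProd_singleton, h]⟩]
  have hext {x' : B} {k : ℕ} (hx' : s(M.diagram.branchProj s t q, x') = s(s, t))
      (hlast : (altList (M.diagram.branchProj s t q) x' (k + 2)).getLast? =
        some (M.diagram.branchProj s t p)) (hk : k + 2 < M s t) :=
    IsRigidWord.extend hM hU (hP1.symm ▸ hPl) (hQ1.symm ▸ hQl) hx' hlast hk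
  have hne {x' : B} {k : ℕ} (hx' : s(M.diagram.branchProj s t q, x') = s(s, t))
      (hlast : (altList (M.diagram.branchProj s t q) x' (k + 2)).getLast? =
        some (M.diagram.branchProj s t p)) (hk : k + 2 < M s t)
      (h : M.diagram.branchProj s t q = M.diagram.branchProj s t p) :
      cs.wordProd (walkWord K) ≠ cs.wordProd ((walkWord P).dropLast ++
        (altList (M.diagram.branchProj s t q) x' (k + 2) ++ (walkWord Q).tail)) := by
    intro h1
    have h2 := hKrigid.eq_of_wordProd_eq cs (hext hx' hlast hk).1 h1
    have h3 := hKl.2.1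
    rw [h2, List.nodup_append, List.nodup_append] at h3
    rw [← h] at hlast
    exact not_nodup_altList hlast h3.2.1.1
  refine ⟨?_, ?_, ?_⟩
  · intro w hw
    rw [mem_leftCell_inter_rightCell_iff] at hw ⊢
    obtain ⟨ω, h1, h2, h3, rfl⟩ := hw
    rcases h1.eq_altList hM hU hx hy h2 h3 with ⟨rfl, h4⟩ | ⟨x', k, hx', rfl, hk⟩
    · exact ⟨walkWord K, hKrigid, hKl.2.2.1, hKl.2.2.2, (hK1 h4).symm⟩
    · rw [extendReduced_wordProd_altList _ _ _ _ h1]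
      obtain ⟨h4, h5, h6⟩ := hext hx' h3 hk
      exact ⟨_, h4, h5, h6, rfl⟩
  · intro w₁ hw₁ w₂ hw₂ heq
    rw [mem_leftCell_inter_rightCell_iff] at hw₁ hw₂
    obtain ⟨ω₁, h1, h2, h3, rfl⟩ := hw₁
    obtain ⟨ω₂, h1', h2', h3', rfl⟩ := hw₂
    rcases h1.eq_altList hM hU hx hy h2 h3 with ⟨rfl, h4⟩ | ⟨x', k, hx', rfl, hk⟩ <;>
    rcases h1'.eq_altList hM hU hx hy h2' h3' with ⟨rfl, h4'⟩ | ⟨x'', k', hx'', rfl, hk'⟩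
    · rfl
    · rw [hK1 h4, extendReduced_wordProd_altList _ _ _ _ h1'] at heq
      exact absurd heq (hne hx'' h3' hk' h4)
    · rw [hK1 h4', extendReduced_wordProd_altList _ _ _ _ h1] at heq
      exact absurd heq.symm (hne hx' h3 hk h4')
    · rw [extendReduced_wordProd_altList _ _ _ _ h1,
        extendReduced_wordProd_altList _ _ _ _ h1'] at heq
      have h5 := (hext hx' h3 hk).1.eq_of_wordProd_eq cs (hext hx'' h3' hk').1 heq
      rw [List.append_right_inj, List.append_left_inj] at h5
      rw [h5]
  · intro w hw
    rw [mem_leftCell_inter_rightCell_iff] at hw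
    obtain ⟨ω, h1, h2, h3, rfl⟩ := hw
    rcases h1.nodup_or_isExtendedAltWord hM hU h2 h3 with
      ⟨h4, h5⟩ | ⟨l₁, l₂, x', k, hl₁, hl₂, hx', hlast, rfl⟩
    · refine ⟨cs.wordProd [M.diagram.branchProj s t q], ?_, ?_⟩
      · rw [mem_leftCell_inter_rightCell_iff]
        exact ⟨_, isRigidWord_singleton _, rfl, by rw [h4]; rfl, rfl⟩
      · rw [hK1 h4, hM.isAcyclic.isPathList_unique hKl ⟨h1.isChain_adj, h5, h2, h3⟩]
    · have h4 : IsRigidWord M (altList (M.diagram.branchProj s t q) x' (k + 2)) :=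
        h1.of_infix ⟨l₁, l₂, by simp⟩
      refine ⟨cs.wordProd (altList (M.diagram.branchProj s t q) x' (k + 2)), ?_, ?_⟩
      · rw [mem_leftCell_inter_rightCell_iff]
        exact ⟨_, h4, rfl, hlast, rfl⟩
      · rw [extendReduced_wordProd_altList _ _ _ _ h4]
        have h5 := hM.isAcyclic.isPathList_unique hl₁ hPl
        have h6 := hM.isAcyclic.isPathList_unique hl₂ hQl
        rw [← h5, ← h6, List.dropLast_concat, List.tail_cons]

/-- If `Q` and `P` meet only in the common projection, their concatenation is a path and hence
equals `K`, so the exceptional clause changes nothing. -/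
theorem extendReduced_eq_extend (cs : CoxeterSystem M W) (hM : M.diagram.IsTree)
    {p q : B}
    {P : M.diagram.Walk (M.diagram.branchProj s t q) q}
    {Q : M.diagram.Walk p (M.diagram.branchProj s t p)} {K : M.diagram.Walk p q}
    (hP : P.length = M.diagram.dist (M.diagram.branchProj s t q) q)
    (hQ : Q.length = M.diagram.dist p (M.diagram.branchProj s t p))
    (hK : K.length = M.diagram.dist p q)
    (hdisj : ∀ r ∈ P.support, r ∈ Q.support → r = M.diagram.branchProj s t p) (w : W) :
    cs.extendReduced P Q K w = cs.extend P Q w := by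
  rw [extendReduced]
  split_ifs with h
  · obtain ⟨h1, rfl⟩ := h
    have hPl := isPathList_walkWord hP
    have hQl := isPathList_walkWord hQ
    have hKl := isPathList_walkWord hK
    have hP1 := dropLast_append_of_getLast? (hPl.2.2.2.trans (congrArg some h1.symm))
    have hQ1 := cons_tail_of_head? hQl.2.2.1
    rw [← wordProd_singleton, extend_wordProd]
    set l₁ := (walkWord P).dropLast
    set l₂ := (walkWord Q).tail
    have hPnd := hPl.2.1
    have hQnd := hQl.2.1
    have hPch := hPl.1
    have hQch := hQl.1
    rw [← hP1] at hPnd hPch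
    rw [← hQ1] at hQnd hQch
    congr 1
    refine hM.isAcyclic.isPathList_unique hKl ⟨?_, ?_, ?_, ?_⟩
    · rw [List.singleton_append]
      exact List.isChain_split.2 ⟨hPch, hQch⟩
    · rw [List.singleton_append, List.nodup_append]
      refine ⟨(List.nodup_append.1 hPnd).1, hQnd, fun a ha b hb => ?_⟩
      rintro rfl
      have h2 : a ∈ P.support := by
        rw [← List.mem_reverse]
        change a ∈ walkWord P
        rw [← hP1]
        exact List.mem_append_left _ ha
      have h3 : a ∈ Q.support := by
        rw [← List.mem_reverse]
        change a ∈ walkWord Q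
        rwa [← hQ1]
      exact (List.nodup_append.1 hPnd).2.2 a ha _ (List.mem_singleton_self _) (hdisj a h2 h3)
    · have h2 := hPl.2.2.1
      rw [← hP1] at h2
      rw [List.head?_append] at h2 ⊢
      exact h2
    · have h2 := hQl.2.2.2
      rw [← hQ1] at h2
      rw [List.singleton_append, List.getLast?_append, h2]
      rfl
  · rfl

/-! ### The dihedral parabolic subgroup -/

theorem map_altList {B' : Type*} (f : B' → B) (a b : B') (n : ℕ) :
    (altList a b n).map f = altList (f a) (f b) n := by
  induction n generalizing a b with
  | zero => rfl
  | succ n ih => rw [altList, List.map_cons, ih, altList]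

theorem parabolicHom_wordProd (cs : CoxeterSystem M W) (J : Set B) (ω : List J) :
    cs.parabolicHom J ((M.restrict J).toCoxeterSystem.wordProd ω) =
      cs.wordProd (ω.map Subtype.val) := by
  rw [wordProd, map_list_prod, wordProd, List.map_map, List.map_map]
  congr 2
  funext j
  exact lift_apply_simple _ _ _

/-- A braid word inside a word with letters in `J` has both its letters in `J`, and the labels are
the same in the restricted matrix. -/
theorem isRigidWord_map_val_iff (J : Set B) (ω : List J) :
    IsRigidWord M (ω.map Subtype.val) ↔ IsRigidWord (M.restrict J) ω := by
  unfold IsRigidWord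
  rw [List.isChain_map]
  refine and_congr ⟨fun h => h.imp fun _ _ h1 h2 => h1 (congrArg _ h2),
    fun h => h.imp fun _ _ h1 h2 => h1 (Subtype.ext h2)⟩ ⟨fun h a b hab hM h1 => ?_,
    fun h a b hab hM h1 => ?_⟩
  · refine h a b (fun h2 => hab (Subtype.ext h2)) hM ?_
    have h2 := h1.map Subtype.val
    rwa [map_altList] at h2
  · obtain ⟨m, hm⟩ := Nat.exists_eq_add_of_le' (two_le_of_ne hab hM)
    have h2 : ∀ x ∈ altList a b (M a b), x ∈ J := by
      intro x hx
      obtain ⟨y, -, rfl⟩ := List.mem_map.1 (h1.subset hx)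
      exact y.2
    rw [hm] at h2
    have ha : a ∈ J := h2 a (by simp [altList])
    have hb : b ∈ J := h2 b (by simp [altList])
    refine h ⟨a, ha⟩ ⟨b, hb⟩ (fun h3 => hab (congrArg Subtype.val h3)) hM ?_
    have h3 : altList a b (M a b) =
        (altList (⟨a, ha⟩ : J) ⟨b, hb⟩ (M a b)).map Subtype.val := by
      rw [map_altList]
    rw [h3] at h1
    obtain ⟨l₁, l₂, h4⟩ := h1
    obtain ⟨l₃, l₅, h5, h6, -⟩ := List.map_eq_append_iff.1 h4.symm
    obtain ⟨l₆, l₇, h7, -, h8⟩ := List.map_eq_append_iff.1 h6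
    rw [List.map_inj_right fun _ _ => Subtype.ext] at h8
    exact ⟨l₆, l₅, by rw [h5, h7, h8]; rfl⟩

theorem even_length_of_wordProd_eq_one (cs : CoxeterSystem M W) {ω : List B}
    (h : cs.wordProd ω = 1) : Even ω.length := by
  have h1 (ω : List B) :
      cs.lengthParity (cs.wordProd ω) = Multiplicative.ofAdd (ω.length : ZMod 2) := by
    induction ω with
    | nil => simp
    | cons i ω ih =>
      rw [wordProd_cons, map_mul, ih, lengthParity_simple, List.length_cons, ← ofAdd_add]
      push_cast
      rw [add_comm]
  have h2 := h1 ω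
  rw [h, map_one, eq_comm, ofAdd_eq_one] at h2
  exact (ZMod.natCast_eq_zero_iff_even).1 h2

/-- By parity an element of the kernel is a product of an even number of letters, hence a power of
`st`. Its image being trivial, `M s t` divides the exponent, and this power of `st` is already
trivial in the dihedral group. -/
theorem parabolicHom_pair_injective (cs : CoxeterSystem M W) (hst : s ≠ t) :
    Function.Injective (cs.parabolicHom {s, t}) := by
  set cs' := (M.restrict {s, t}).toCoxeterSystem
  rw [injective_iff_map_eq_one]
  intro w hw
  obtain ⟨ω, rfl⟩ := cs'.wordProd_surjective w
  rw [parabolicHom_wordProd] at hw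
  have hE := cs.even_length_of_wordProd_eq_one hw
  rw [List.length_map] at hE
  obtain ⟨j, -, -, h1⟩ := cs'.exists_wordProd_eq_zpow (a := ⟨s, by simp⟩) (b := ⟨t, by simp⟩) ω
    (by
      rintro ⟨x, rfl | rfl⟩ -
      · exact .inl rfl
      · exact .inr rfl)
  rw [if_pos hE, mul_one] at h1
  have h2 (j : ({s, t} : Set B)) : cs.parabolicHom {s, t} (cs'.simple j) = cs.simple j :=
    lift_apply_simple _ _ _
  have h3 := congrArg (cs.parabolicHom {s, t}) h1
  rw [parabolicHom_wordProd, hw, map_zpow, map_mul, h2, h2] at h3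
  obtain ⟨k, rfl⟩ := cs.dvd_of_simple_mul_simple_zpow_eq_one hst h3.symm
  have h4 := cs'.simple_mul_simple_pow ⟨s, by simp⟩ ⟨t, by simp⟩
  have h5 : (M.restrict {s, t}) ⟨s, by simp⟩ ⟨t, by simp⟩ = M s t := rfl
  rw [h5] at h4
  rw [h1, zpow_mul, zpow_natCast, h4, one_zpow]

/-- By `IsRigidWord.eq_altList`, rigid words between vertices of the edge use only `s` and `t`, and
rigidity means the same in both Coxeter systems. -/
theorem leftCell_inter_rightCell_eq_image (cs : CoxeterSystem M W) (hM : M.diagram.IsTree)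
    (hU : M.IsUniqueLabeledEdge s t) (p q : ({s, t} : Set B)) :
    cs.leftCell (p : B) ∩ cs.rightCell (q : B) = cs.parabolicHom {s, t} ''
      ((M.restrict {s, t}).toCoxeterSystem.leftCell p ∩
        (M.restrict {s, t}).toCoxeterSystem.rightCell q) := by
  ext w
  rw [mem_leftCell_inter_rightCell_iff, Set.mem_image]
  simp only [mem_leftCell_inter_rightCell_iff]
  constructor
  · rintro ⟨ω, h1, h2, h3, rfl⟩
    have h4 : ∀ r ∈ ω, r ∈ ({s, t} : Set B) := by
      have hq : (q : B) = s ∨ (q : B) = t := q.2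
      have hp : (p : B) = s ∨ (p : B) = t := p.2
      intro r hr
      rcases h1.eq_altList hM hU hq hp h2 h3 with ⟨rfl, -⟩ | ⟨x', k, hx', rfl, -⟩
      · rw [List.mem_singleton.1 hr]
        exact q.2
      · rcases mem_altList hr with rfl | rfl
        · exact q.2
        · rw [Sym2.eq_swap] at hx'
          exact (eq_or_eq_of_sym2_eq hx').1
    lift ω to List ({s, t} : Set B) using h4
    refine ⟨_, ⟨ω, (isRigidWord_map_val_iff _ ω).1 h1, ?_, ?_, rfl⟩, parabolicHom_wordProd _ _ _⟩
    · rw [List.head?_map] at h2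
      exact Option.map_injective Subtype.val_injective h2
    · rw [List.getLast?_map] at h3
      exact Option.map_injective Subtype.val_injective h3
  · rintro ⟨_, ⟨ω, h1, h2, h3, rfl⟩, rfl⟩
    refine ⟨ω.map Subtype.val, (isRigidWord_map_val_iff _ ω).2 h1, ?_, ?_,
      (parabolicHom_wordProd _ _ _).symm⟩
    · rw [List.head?_map, h2]
      rfl
    · rw [List.getLast?_map, h3]
      rfl

end CoxeterSystem

theorem proposition2p4 {B W : Type*} [Finite B] [Group W] {M : CoxeterMatrix B}
    (cs : CoxeterSystem M W) (hM : M.diagram.IsTree) :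
    -- unlabeled trees
    (M.IsUnlabeled → ∀ p q : B, ∃ w : W, cs.leftCell p ∩ cs.rightCell q = {w}) ∧
    -- trees with a unique labeled edge `{s, t}`
    (∀ s t : B, M.IsUniqueLabeledEdge s t →
      -- the bijections, for shortest paths `P`, `Q` and `K`
      (∀ (p q : B)
        (P : M.diagram.Walk (M.diagram.branchProj s t q) q)
        (Q : M.diagram.Walk p (M.diagram.branchProj s t p))
        (K : M.diagram.Walk p q),
        P.length = M.diagram.dist (M.diagram.branchProj s t q) q →
        Q.length = M.diagram.dist p (M.diagram.branchProj s t p) →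
        K.length = M.diagram.dist p q →
        Set.BijOn (cs.extendReduced P Q K)
          (cs.leftCell (M.diagram.branchProj s t p) ∩ cs.rightCell (M.diagram.branchProj s t q))
          (cs.leftCell p ∩ cs.rightCell q) ∧
        ((∀ r ∈ P.support, r ∈ Q.support → r = M.diagram.branchProj s t p) →
          Set.BijOn (cs.extend P Q)
            (cs.leftCell (M.diagram.branchProj s t p) ∩ cs.rightCell (M.diagram.branchProj s t q))
            (cs.leftCell p ∩ cs.rightCell q))) ∧
      -- the dihedral parabolic subgroup and its cells
      (Function.Injective (cs.parabolicHom {s, t}) ∧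
        ∀ p q : ({s, t} : Set B),
          cs.leftCell (p : B) ∩ cs.rightCell (q : B) =
            cs.parabolicHom {s, t} ''
              ((M.restrict {s, t}).toCoxeterSystem.leftCell p ∩
                (M.restrict {s, t}).toCoxeterSystem.rightCell q))) := by
  refine ⟨fun hU p q => cs.leftCell_inter_rightCell_of_isUnlabeled hM hU p q,
    fun s t hU => ⟨?_, ?_, ?_⟩⟩
  · intro p q P Q K hP hQ hK
    have h := cs.bijOn_extendReduced hM hU hP hQ hK
    exact ⟨h, fun hdisj =>
      h.congr fun w _ => cs.extendReduced_eq_extend hM hP hQ hK hdisj w⟩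
  · exact cs.parabolicHom_pair_injective hU.1.ne
  · exact cs.leftCell_inter_rightCell_eq_image hM hU
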